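/- Let $P=((V,E),(V_1,V_R),\delta)$ be a finite Markov decision process (MDP): $(V,E)$ is a finite directed graph with $V\neq\emptyset$ in which every vertex has an outgoing edge, $V$ is partitioned into player-1 vertices $V_1$ and random vertices $V_R$, and for $v\in V_R$, $\delta(v)$ is a probability distribution on $V$ whose support is the set of out-neighbours of $v$. Put $n=|V|$ and $m=|E|$. A player-1 strategy $\sigma$ maps each finite history ending in a vertex of $V_1$ to a successor of that vertex; with a start vertex $v$ it induces a probability measure $\Pr^\sigma_v$ on infinite plays. For a set $\psi$ of plays, the almost-sure winning set $\langle 1\rangle_{as}(P,\psi)$ is the set of vertices $v$ for which some $\sigma$ has $\Pr^\sigma_v(\psi)=1$. Let $\mathrm{Inf}(\omega)$ be the set of vertices occurring infinitely often in the play $\omega$. For pairs $(L_i,U_i)$, $1\le i\le k$, of subsets of $V$, the Rabin objective is $\{\omega\mid \exists i:\ L_i\cap \mathrm{Inf}(\omega)\ne\emptyset \text{ and } U_i\cap \mathrm{Inf}(\omega)=\emptyset\}$. For $T\subseteq V$ let $\mathrm{B\ddot uchi}(T)=\{\omega\mid \mathrm{Inf}(\omega)\cap T\neq\emptyset\}$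 (the Rabin pair $(T,\emptyset)$) and $\mathrm{coB\ddot uchi}(T)=\{\omega\mid \mathrm{Inf}(\omega)\cap T=\emptyset\}$ (the Rabin pair $(V,T)$). For objectives $\psi_1,\dots,\psi_k$, the winning set of the disjunctive objective is $\langle 1\rangle_{as}(P,\bigcup_i\psi_i)$, and that of the disjunctive query is $\bigcup_i\langle 1\rangle_{as}(P,\psi_i)$. An end-component is a set $X\subseteq V$ whose induced sub-MDP is strongly connected and has at least one edge, such that all edges leaving a random vertex of $X$ stay in $X$. A MEC is an inclusion-maximal end-component, and a MEC-decomposition lists all MECs together with the vertices in no MEC. Running times are those of a RAM with unit cost and words of logarithmically many bits (in the size of the input); graphs are given by adjacency lists and vertex sets by lists. Let some algorithm compute MEC-decompositions, let $\mathrm{MEC}=\mathrm{MEC}(n,m)$ bound its running time on all MDPs with at most $n$ vertices and at most $m$ edges, and assume $\mathrm{MEC}(n,m)=\Omega(m)$, where $n$ and $m$ are the numbers of vertices and edges of an MDP. **Theorem.** 1. Given $P$ and $k\ge 1$ Rabin pairs, the almost-sure winning set for the Rabin objective can be computed in $O(k\cdot \mathrm{MEC})$ time. 2. Given $P$ and $T_1,\dots,T_k\subseteq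 V$ with $b=\sum_i|T_i|$, the almost-sure winning set for the disjunctive objective of $\mathrm{B\ddot uchi}(T_1),\dots,\mathrm{B\ddot uchi}(T_k)$ can be computed in $O(\mathrm{MEC}+b)$ time, and that for the disjunctive query in $O(k\cdot m+\mathrm{MEC})$ time. 3. Given $P$ and $T_1,\dots,T_k\subseteq V$, the almost-sure winning sets for the disjunctive objective and for the disjunctive query of $\mathrm{coB\ddot uchi}(T_1),\dots,\mathrm{coB\ddot uchi}(T_k)$ can each be computed in $O(k\cdot m+\mathrm{MEC})$ time. The implied constants depend only on the MEC-decomposition algorithm and the constant in $\mathrm{MEC}=\Omega(m)$. -/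

import Mathlib

open MeasureTheory ProbabilityTheory Filter Finset

/-! ### Markov decision processes -/

/-- A finite Markov decision process. The vertices are `0, …, n - 1`; `succ v` is the set `E(v)` of
out-neighbours of `v`; `VR` is the set of random vertices, and all other vertices belong to
player 1. The transition probabilities `δ` are arbitrary with the prescribed support (the uniform
distribution is a special case). Every vertex has an outgoing edge. -/
structure MDP where
  n : ℕ
  n_pos : 0 < n
  succ : Fin n → Finset (Fin n)
  VR : Finset (Fin n)
  δ : {v : Fin n // v ∈ VR} → PMF (Fin n)
  mem_succ_iff : ∀ (v : {v : Fin n // v ∈ VR}) (w : Fin n), w ∈ succ v ↔ 0 < δ v w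
  succ_nonempty : ∀ v, (succ v).Nonempty

namespace MDP

/-- The number of edges. -/
def m (P : MDP) : ℕ := ∑ v, (P.succ v).card

/-! ### End-components -/

/-- `X` is an end-component: the induced sub-MDP is strongly connected, it contains all outgoing
edges of its random vertices, and it contains at least one edge. -/
def IsEndComponent (P : MDP) (X : Finset (Fin P.n)) : Prop :=
  (∀ u ∈ X, ∀ v ∈ X, Relation.ReflTransGen (fun a b => a ∈ X ∧ b ∈ X ∧ b ∈ P.succ a) u v) ∧
  (∀ v ∈ X, v ∈ P.VR → P.succ v ⊆ X) ∧
  (∃ u ∈ X, ∃ v ∈ X, v ∈ P.succ u)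

/-- `X` is a maximal end-component. -/
def IsMEC (P : MDP) (X : Finset (Fin P.n)) : Prop := Maximal P.IsEndComponent X

/-! ### Strategies and the probability of sets of plays -/

/-- A history of length `t + 1`: the vertices `v₀, …, v_t`. -/
abbrev History (P : MDP) (t : ℕ) : Type := Finset.Iic t → Fin P.n

/-- The last vertex of a history. -/
def History.last {P : MDP} {t : ℕ} (h : P.History t) : Fin P.n := h ⟨t, Finset.mem_Iic.2 le_rfl⟩

/-- A player 1 strategy: it maps every history that ends in a player 1 vertex to a successor of
that vertex (the value at other histories is irrelevant). -/
structure Strategy (P : MDP) where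
  next : (t : ℕ) → P.History t → Fin P.n
  legal : ∀ (t : ℕ) (h : P.History t), h.last ∉ P.VR → next t h ∈ P.succ h.last

/-- The distribution of the next vertex after the history `h` when player 1 plays `σ`. -/
noncomputable def stepMeasure (P : MDP) (σ : P.Strategy) (t : ℕ) (h : P.History t) :
    Measure (Fin P.n) :=
  if hv : h.last ∈ P.VR then (P.δ ⟨h.last, hv⟩).toMeasure else Measure.dirac (σ.next t h)

/-- The one-step transition kernels when player 1 plays `σ`. -/
noncomputable def stepKernel (P : MDP) (σ : P.Strategy) (t : ℕ) :
    Kernel (P.History t) (Fin P.n) :=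
  Kernel.ofFunOfCountable (P.stepMeasure σ t)

instance stepKernel_isMarkovKernel (P : MDP) (σ : P.Strategy) (t : ℕ) :
    IsMarkovKernel (P.stepKernel σ t) := by
  refine ⟨fun h => ?_⟩
  change IsProbabilityMeasure (P.stepMeasure σ t h)
  unfold stepMeasure
  split_ifs <;> infer_instance

/-- The probability measure on infinite vertex sequences when the play starts at `v` and player 1
plays `σ` (Ionescu-Tulcea). -/
noncomputable def pr (P : MDP) (σ : P.Strategy) (v : Fin P.n) : Measure (ℕ → Fin P.n) :=
  Kernel.traj (X := fun _ => Fin P.n) (P.stepKernel σ) 0 (fun _ => v)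

/-- The almost-sure winning set of player 1 for the objective `ψ`. -/
def almostSure (P : MDP) (ψ : Set (ℕ → Fin P.n)) : Set (Fin P.n) :=
  {v | ∃ σ : P.Strategy, P.pr σ v ψ = 1}

/-! ### Objectives -/

/-- The set `Ω` of plays. -/
def plays (P : MDP) : Set (ℕ → Fin P.n) := {ω | ∀ i, ω (i + 1) ∈ P.succ (ω i)}

/-- The set `Inf(ω)` of vertices that occur infinitely often. -/
def inf (P : MDP) (ω : ℕ → Fin P.n) : Set (Fin P.n) := {v | ∃ᶠ i in atTop, ω i = v}

/-- The Rabin objective of the pairs `(L i, U i)`. -/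
def rabin (P : MDP) {k : ℕ} (L U : Fin k → Finset (Fin P.n)) : Set (ℕ → Fin P.n) :=
  {ω ∈ P.plays | ∃ i, (↑(L i) ∩ P.inf ω).Nonempty ∧ ↑(U i) ∩ P.inf ω = ∅}

/-- The Büchi objective; it is the objective of the single Rabin pair `(T, ∅)`. -/
def buchi (P : MDP) (T : Finset (Fin P.n)) : Set (ℕ → Fin P.n) :=
  {ω ∈ P.plays | (P.inf ω ∩ ↑T).Nonempty}

/-- The coBüchi objective; it is the objective of the single Rabin pair `(V, T)`. -/
def coBuchi (P : MDP) (T : Finset (Fin P.n)) : Set (ℕ → Fin P.n) :=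
  {ω ∈ P.plays | P.inf ω ∩ ↑T = ∅}

theorem buchi_eq_rabin (P : MDP) (T : Finset (Fin P.n)) :
    P.buchi T = P.rabin (fun _ : Fin 1 => T) (fun _ => ∅) := by
  ext ω
  simp [buchi, rabin, Set.inter_comm]

theorem coBuchi_eq_rabin (P : MDP) (T : Finset (Fin P.n)) :
    P.coBuchi T = P.rabin (fun _ : Fin 1 => Finset.univ) (fun _ => T) := by
  ext ω
  have h : (P.inf ω).Nonempty := by
    obtain ⟨v, hv⟩ := Finite.exists_infinite_fiber ω
    exact ⟨v, Nat.frequently_atTop_iff_infinite.2 (Set.infinite_coe_iff.1 hv)⟩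
  simp [coBuchi, rabin, Set.inter_comm, h]

end MDP

/-! ### The machine model

A word RAM, programmed in a structured language with finitely many registers `var x` and finitely
many arrays (random access memories) `get a i`. Every executed assignment and every evaluated test
costs one time step; expressions belong to the program, so evaluating one takes constantly many
machine operations on numbers of `O(log W)` bits. Every number written into memory, and every address written to, has to be
smaller than the word bound `W`. -/

inductive Op
  | add | sub | mul | div | lt | eq

/-- Subtraction is truncated at `0`; a comparison returns `1` (true) or `0` (false). -/
def Op.eval : Op → ℕ → ℕ → ℕ
  | .add, a, b => a + b
  | .sub, a, b => a - b
  | .mul, a, b => a * b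
  | .div, a, b => a / b
  | .lt, a, b => if a < b then 1 else 0
  | .eq, a, b => if a = b then 1 else 0

inductive Expr
  | lit (c : ℕ)
  | var (x : ℕ)
  | get (a : ℕ) (i : Expr)
  | bin (o : Op) (e f : Expr)

/-- `set x e` is `x := e`, `put a i e` is `a[i] := e`; tests succeed on nonzero values. -/
inductive Cmd
  | set (x : ℕ) (e : Expr)
  | put (a : ℕ) (i e : Expr)
  | seq (c d : Cmd)
  | ite (e : Expr) (c d : Cmd)
  | while (e : Expr) (c : Cmd)

/-- The memory: the registers and the arrays. -/
structure State where
  reg : ℕ → ℕ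
  arr : ℕ → ℕ → ℕ

/-- All memory cells contain words. -/
def State.Fits (s : State) (W : ℕ) : Prop := (∀ x, s.reg x < W) ∧ ∀ a i, s.arr a i < W

def State.setReg (s : State) (x v : ℕ) : State :=
  { s with reg := Function.update s.reg x v }

def State.setArr (s : State) (a i v : ℕ) : State :=
  { s with arr := Function.update s.arr a (Function.update (s.arr a) i v) }

def Expr.eval (s : State) : Expr → ℕ
  | .lit c => c
  | .var x => s.reg x
  | .get a i => s.arr a (i.eval s)
  | .bin o e f => o.eval (e.eval s) (f.eval s)

/-- `Runs W c s t s'`: with word bound `W`, the program `c` started in `s` halts after `t` steps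
in `s'`. -/
inductive Runs (W : ℕ) : Cmd → State → ℕ → State → Prop
  | set (x : ℕ) (e : Expr) (s : State) (he : e.eval s < W) :
      Runs W (.set x e) s 1 (s.setReg x (e.eval s))
  | put (a : ℕ) (i e : Expr) (s : State) (hi : i.eval s < W) (he : e.eval s < W) :
      Runs W (.put a i e) s 1 (s.setArr a (i.eval s) (e.eval s))
  | seq (c d : Cmd) (s s' s'' : State) (t t' : ℕ) (hc : Runs W c s t s') (hd : Runs W d s' t' s'') :
      Runs W (.seq c d) s (t + t') s''
  | ite_true (e : Expr) (c d : Cmd) (s s' : State) (t : ℕ) (he : e.eval s ≠ 0)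
      (hc : Runs W c s t s') : Runs W (.ite e c d) s (t + 1) s'
  | ite_false (e : Expr) (c d : Cmd) (s s' : State) (t : ℕ) (he : e.eval s = 0)
      (hd : Runs W d s t s') : Runs W (.ite e c d) s (t + 1) s'
  | while_true (e : Expr) (c : Cmd) (s s' s'' : State) (t t' : ℕ) (he : e.eval s ≠ 0)
      (hc : Runs W c s t s') (hw : Runs W (.while e c) s' t' s'') :
      Runs W (.while e c) s (t + t' + 1) s''
  | while_false (e : Expr) (c : Cmd) (s : State) (he : e.eval s = 0) :
      Runs W (.while e c) s 1 s

/-- The program `c` solves, within `time I` steps on every instance `I`, the problem with the given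
input encoding and output condition, on words of `O(log (size I))` bits: the word bound may be any
number from some fixed polynomial in `size I` on. The memory outside the input has arbitrary
initial contents (so a program has to initialise the memory that it uses). -/
def Cmd.Solves {ι : Type} (c : Cmd) (size : ι → ℕ) (input output : ι → State → Prop)
    (time : ι → ℕ) : Prop :=
  ∃ d : ℕ, ∀ (I : ι) (W : ℕ) (s : State), (size I + 2) ^ d ≤ W → s.Fits W → input I s →
    ∃ (t : ℕ) (s' : State), Runs W c s t s' ∧ output I s' ∧ t ≤ time I

/-! ### Encodings -/

/-- The arrays `off` and `elt` list the members of the sets `F 0, …, F (k - 1)` one set after the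
other, each set in any order and without repetition; the members of `F i` are at the positions
`off i, …, off (i + 1) - 1` of `elt`. -/
def ListsFamily {n k : ℕ} (off elt : ℕ → ℕ) (F : Fin k → Finset (Fin n)) : Prop :=
  off 0 = 0 ∧ ∀ i : Fin k, off (i : ℕ) ≤ off ((i : ℕ) + 1) ∧
    Set.BijOn elt (Set.Ico (off (i : ℕ)) (off ((i : ℕ) + 1))) (Fin.val '' (F i : Set (Fin n)))

open Classical in
/-- The MDP is given by its number of vertices (register `0`), the indicator of the random vertices
(array `0`) and its adjacency lists (arrays `1` and `2`). -/
def MDP.Input (P : MDP) (s : State) : Prop :=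
  s.reg 0 = P.n ∧ (∀ v : Fin P.n, s.arr 0 v = if v ∈ P.VR then 1 else 0) ∧
    ListsFamily (s.arr 1) (s.arr 2) P.succ

/-- The array `7` contains the MEC-decomposition: two vertices have the same nonzero label iff some
MEC contains both (so the label `0` marks the vertices in no MEC); the labels are at most `n`. -/
def MDP.OutputsMECs (P : MDP) (s : State) : Prop :=
  (∀ v : Fin P.n, s.arr 7 v ≤ P.n) ∧
    ∀ u v : Fin P.n, (s.arr 7 u ≠ 0 ∧ s.arr 7 u = s.arr 7 v) ↔ ∃ X, P.IsMEC X ∧ u ∈ X ∧ v ∈ X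

open Classical in
/-- The array `7` contains the indicator of the vertex set `S`. -/
def MDP.OutputsSet (P : MDP) (S : Set (Fin P.n)) (s : State) : Prop :=
  ∀ v : Fin P.n, s.arr 7 v = if v ∈ S then 1 else 0

/-- The program `A` computes MEC-decompositions, and `MEC n m` bounds its running time on all MDPs
with at most `n` vertices and at most `m` edges. -/
def ComputesMECs (A : Cmd) (MEC : ℕ → ℕ → ℕ) : Prop :=
  ∃ time : MDP → ℕ, A.Solves (fun P : MDP => P.n + P.m) MDP.Input MDP.OutputsMECs time ∧
    ∀ (P : MDP) (n m : ℕ), P.n ≤ n → P.m ≤ m → time P ≤ MEC n m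

/-- An MDP with `k ≥ 1` Rabin pairs `(L i, U i)`. -/
structure RabinInstance where
  P : MDP
  k : ℕ
  k_pos : 0 < k
  L : Fin k → Finset (Fin P.n)
  U : Fin k → Finset (Fin P.n)

namespace RabinInstance

/-- The total number of elements in the pairs. -/
def b (I : RabinInstance) : ℕ := ∑ i, ((I.L i).card + (I.U i).card)

def size (I : RabinInstance) : ℕ := I.P.n + I.P.m + I.k + I.b

/-- The number `k` is in register `1`, the sets `L i` are in the arrays `3` and `4`, and the sets
`U i` are in the arrays `5` and `6`. -/
def Input (I : RabinInstance) (s : State) : Prop :=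
  I.P.Input s ∧ s.reg 1 = I.k ∧ ListsFamily (s.arr 3) (s.arr 4) I.L ∧
    ListsFamily (s.arr 5) (s.arr 6) I.U

end RabinInstance

/-- An MDP with `k` target sets `T i`. -/
structure TargetInstance where
  P : MDP
  k : ℕ
  T : Fin k → Finset (Fin P.n)

namespace TargetInstance

/-- The total number of elements in the target sets. -/
def b (I : TargetInstance) : ℕ := ∑ i, (I.T i).card

def size (I : TargetInstance) : ℕ := I.P.n + I.P.m + I.k + I.b

/-- The number `k` is in register `1` and the sets `T i` are in the arrays `3` and `4`. -/
def Input (I : TargetInstance) (s : State) : Prop :=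
  I.P.Input s ∧ s.reg 1 = I.k ∧ ListsFamily (s.arr 3) (s.arr 4) I.T

end TargetInstance

/-- The program `c` computes, for every MDP with Rabin pairs, the set `win` in time `time`. -/
def Cmd.ComputesRabin (c : Cmd) (win : (I : RabinInstance) → Set (Fin I.P.n))
    (time : RabinInstance → ℕ) : Prop :=
  c.Solves RabinInstance.size RabinInstance.Input (fun I => I.P.OutputsSet (win I)) time

/-- The program `c` computes, for every MDP with target sets, the set `win` in time `time`. -/
def Cmd.ComputesTarget (c : Cmd) (win : (I : TargetInstance) → Set (Fin I.P.n))
    (time : TargetInstance → ℕ) : Prop :=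
  c.Solves TargetInstance.size TargetInstance.Input (fun I => I.P.OutputsSet (win I)) time

/-! ### Programs: frames, renaming, symbolic execution and loops -/

/-! All five objectives depend on a play only through `inf ω`. By a conditional Borel–Cantelli
argument every successor of a random vertex that is visited infinitely often is itself visited
infinitely often, so `inf ω` is almost surely an end-component (`ae_succ_mem_inf`,
`ae_isEndComponent_inf`).

The first main point, `almostSure_infObjective`, makes winning combinatorial: the winning set is the
complement of the least set `lose` that random vertices enter through one successor, player vertices
outside all MECs through all successors, and a MEC without a good end-component through all its
exits. Losing vertices do lose with positive probability, because the risk propagates backwards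
along these rules (`loseClosed_riskSet`). Elsewhere player 1 fixes one good end-component in each
good MEC, stays there once inside, and otherwise uses all edges to non-losing vertices in turn; then
`inf ω` is closed under the edges in use, and `good_of_closed` shows that it is good.

Hence only the choice of the MECs to be treated as good depends on the objective. By
`almostSure_eq_winOf` it suffices to give a vertex set `G` that meets every good end-component and
contains no losing vertex of a MEC. For Büchi this is the target set; for coBüchi it is the
complement of the random attractor of the target; for a Rabin pair it is the union of the MECs that
meet `L` after the attractor of `U` is cut off. A disjunctive objective takes the union of these
sets. A disjunctive query takes the union of the separate winning sets.

Attractors, and `lose` after contraction of the MECs, are least sets closed under "at least `thr y`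
outgoing edges of `y` lead into the set", and a worklist computes such sets in linear time
(`does_closure`). So Büchi and coBüchi need one MEC-decomposition and linear passes, while Rabin
needs one more decomposition per pair, of an MDP with no more vertices or edges (`m_restrict_le`).
The given decomposition program is run unchanged in a separate region of the memory. Lower-order
terms are absorbed by `n ≤ m` and `m = O(MEC)`. -/

namespace Cmd

/-- The registers that occur on the left of an assignment. -/
def wr : Cmd → List ℕ
  | .set x _ => [x]
  | .put _ _ _ => []
  | .seq c d => c.wr ++ d.wr
  | .ite _ c d => c.wr ++ d.wr
  | .while _ c => c.wr

/-- The arrays that occur on the left of an assignment. -/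
def wa : Cmd → List ℕ
  | .set _ _ => []
  | .put a _ _ => [a]
  | .seq c d => c.wa ++ d.wa
  | .ite _ c d => c.wa ++ d.wa
  | .while _ c => c.wa

end Cmd

namespace Runs

variable {W : ℕ} {c : Cmd} {s s' : State} {t : ℕ}

/-- The frame rule: facts about memory that a subroutine never assigns survive its run. For concrete
programs the side condition is settled by `decide`. -/
theorem reg_eq (h : Runs W c s t s') {x : ℕ} (hx : x ∉ c.wr) : s'.reg x = s.reg x := by
  induction h with
  | set y e s he =>
    simp only [Cmd.wr, List.mem_singleton] at hx
    simp [State.setReg, hx]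
  | put => rfl
  | seq c d s s' s'' t t' _ _ ih1 ih2 =>
    simp only [Cmd.wr, List.mem_append, not_or] at hx
    rw [ih2 hx.2, ih1 hx.1]
  | ite_true e c d s s' t _ _ ih =>
    simp only [Cmd.wr, List.mem_append, not_or] at hx
    exact ih hx.1
  | ite_false e c d s s' t _ _ ih =>
    simp only [Cmd.wr, List.mem_append, not_or] at hx
    exact ih hx.2
  | while_true e c s s' s'' t t' _ _ _ ih1 ih2 => rw [ih2 hx, ih1 hx]
  | while_false => rfl

theorem arr_eq (h : Runs W c s t s') {a : ℕ} (ha : a ∉ c.wa) : s'.arr a = s.arr a := by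
  induction h with
  | set => rfl
  | put b i e s hi he =>
    simp only [Cmd.wa, List.mem_singleton] at ha
    simp [State.setArr, ha]
  | seq c d s s' s'' t t' _ _ ih1 ih2 =>
    simp only [Cmd.wa, List.mem_append, not_or] at ha
    rw [ih2 ha.2, ih1 ha.1]
  | ite_true e c d s s' t _ _ ih =>
    simp only [Cmd.wa, List.mem_append, not_or] at ha
    exact ih ha.1
  | ite_false e c d s s' t _ _ ih =>
    simp only [Cmd.wa, List.mem_append, not_or] at ha
    exact ih ha.2
  | while_true e c s s' s'' t t' _ _ _ ih1 ih2 => rw [ih2 ha, ih1 ha]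
  | while_false => rfl

theorem fits (h : Runs W c s t s') (hs : s.Fits W) : s'.Fits W := by
  induction h with
  | set y e s he =>
    refine ⟨fun x => ?_, hs.2⟩
    by_cases hx : x = y <;> simp [State.setReg, hx, he, hs.1 x]
  | put b i e s hi he =>
    refine ⟨hs.1, fun a j => ?_⟩
    by_cases ha : a = b
    · subst ha
      by_cases hj : j = i.eval s <;> simp [State.setArr, hj, he, hs.2 a j]
    · simp [State.setArr, ha, hs.2 a j]
  | seq c d s s' s'' t t' _ _ ih1 ih2 => exact ih2 (ih1 hs)
  | ite_true e c d s s' t _ _ ih => exact ih hs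
  | ite_false e c d s s' t _ _ ih => exact ih hs
  | while_true e c s s' s'' t t' _ _ _ ih1 ih2 => exact ih2 (ih1 hs)
  | while_false => exact hs

end Runs

/-! #### Shifting the memory of a program -/

/-- The surrounding programs keep their own data below `100`; they touch cells from `100` on only to
hand over an input to the decomposition program and to read its labels. -/
def Expr.shift : Expr → Expr
  | .lit c => .lit c
  | .var x => .var (x + 100)
  | .get a i => .get (a + 100) i.shift
  | .bin o e f => .bin o e.shift f.shift

/-- The program that works on the registers and arrays from `100` on. -/
def Cmd.shift : Cmd → Cmd
  | .set x e => .set (x + 100) e.shift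
  | .put a i e => .put (a + 100) i.shift e.shift
  | .seq c d => .seq c.shift d.shift
  | .ite e c d => .ite e.shift c.shift d.shift
  | .while e c => .while e.shift c.shift

/-- The part of the memory from `100` on. -/
def State.pull (s : State) : State := ⟨fun x => s.reg (x + 100), fun a => s.arr (a + 100)⟩

theorem Expr.eval_shift (s : State) (e : Expr) : e.shift.eval s = e.eval s.pull := by
  induction e with
  | lit => rfl
  | var => rfl
  | get a i ih => simp [shift, eval, ih, State.pull]
  | bin o e f ihe ihf => simp [shift, eval, ihe, ihf]

theorem State.pull_setReg (s : State) (x v : ℕ) :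
    (s.setReg (x + 100) v).pull = s.pull.setReg x v := by
  simp only [pull, setReg, State.mk.injEq, and_true]
  ext y
  simp [Function.update_apply]

theorem State.pull_setArr (s : State) (a i v : ℕ) :
    (s.setArr (a + 100) i v).pull = s.pull.setArr a i v := by
  simp only [pull, setArr, State.mk.injEq, true_and]
  ext y j
  by_cases h : y = a <;> simp [Function.update_apply, h]

/-- A shifted program sees the memory only through `pull`, so a run is copied step by step, with the
same time and the same word bound. -/
theorem Runs.shift {W : ℕ} {c : Cmd} {s u u' : State} {t : ℕ} (h : Runs W c u t u')
    (hs : s.pull = u) : ∃ s', Runs W c.shift s t s' ∧ s'.pull = u' := by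
  induction h generalizing s with
  | set x e u he =>
    subst hs
    rw [← Expr.eval_shift] at he ⊢
    exact ⟨_, .set _ _ _ he, State.pull_setReg _ _ _⟩
  | put a i e u hi he =>
    subst hs
    rw [← Expr.eval_shift] at hi he ⊢
    rw [← Expr.eval_shift]
    exact ⟨_, .put _ _ _ _ hi he, State.pull_setArr _ _ _ _⟩
  | seq c d u u' u'' t t' _ _ ih1 ih2 =>
    obtain ⟨s1, h1, e1⟩ := ih1 hs
    obtain ⟨s2, h2, e2⟩ := ih2 e1
    exact ⟨s2, .seq _ _ _ _ _ _ _ h1 h2, e2⟩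
  | ite_true e c d u u' t he _ ih =>
    subst hs
    obtain ⟨s1, h1, e1⟩ := ih rfl
    exact ⟨s1, .ite_true _ _ _ _ _ _ (by rwa [Expr.eval_shift]) h1, e1⟩
  | ite_false e c d u u' t he _ ih =>
    subst hs
    obtain ⟨s1, h1, e1⟩ := ih rfl
    exact ⟨s1, .ite_false _ _ _ _ _ _ (by rwa [Expr.eval_shift]) h1, e1⟩
  | while_true e c u u' u'' t t' he _ _ ih1 ih2 =>
    subst hs
    obtain ⟨s1, h1, e1⟩ := ih1 rfl
    obtain ⟨s2, h2, e2⟩ := ih2 e1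
    exact ⟨s2, .while_true _ _ _ _ _ _ _ (by rwa [Expr.eval_shift]) h1 h2, e2⟩
  | while_false e c u he =>
    subst hs
    exact ⟨s, .while_false _ _ _ (by rwa [Expr.eval_shift]), rfl⟩

/-- The decomposition program is arbitrary, so its set of assigned registers cannot be evaluated;
this bound takes the place of `decide` in frame arguments. -/
theorem Cmd.le_of_mem_wr_shift {c : Cmd} {x : ℕ} (h : x ∈ c.shift.wr) : 100 ≤ x := by
  induction c <;> simp_all [shift, wr] <;> grind

theorem Cmd.le_of_mem_wa_shift {c : Cmd} {x : ℕ} (h : x ∈ c.shift.wa) : 100 ≤ x := by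
  induction c <;> simp_all [shift, wa] <;> grind

/-! #### Triples with time bounds -/

/-- From `s`, the program `c` halts within `T` steps in a state with the property `Q`. -/
def Cmd.Does (W : ℕ) (c : Cmd) (s : State) (T : ℕ) (Q : State → Prop) : Prop :=
  ∃ t s', Runs W c s t s' ∧ t ≤ T ∧ Q s'

/-- The implication between postconditions receives the run itself, so the frame rule is available
in it. The same holds for `Does.seq`. -/
theorem Cmd.Does.mono {W : ℕ} {c : Cmd} {s : State} {T T' : ℕ} {Q Q' : State → Prop}
    (h : c.Does W s T Q) (hT : T ≤ T') (hQ : ∀ t s', Runs W c s t s' → Q s' → Q' s') :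
    c.Does W s T' Q' := by
  obtain ⟨t, s', hr, ht, hq⟩ := h
  exact ⟨t, s', hr, ht.trans hT, hQ t s' hr hq⟩

theorem Cmd.Does.seq {W : ℕ} {c d : Cmd} {s : State} {T T' : ℕ} {Q Q' : State → Prop}
    (h : c.Does W s T Q) (h' : ∀ t s', Runs W c s t s' → Q s' → d.Does W s' T' Q') :
    (Cmd.seq c d).Does W s (T + T') Q' := by
  obtain ⟨t, s', hr, ht, hq⟩ := h
  obtain ⟨t', s'', hr', ht', hq'⟩ := h' t s' hr hq
  exact ⟨_, s'', .seq _ _ _ _ _ _ _ hr hr', add_le_add ht ht', hq'⟩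

/-! #### Symbolic execution of loop-free programs -/

namespace Cmd

/-- The value at a loop is junk; `Ok` is false there. -/
def exec : Cmd → State → State
  | .set x e, s => s.setReg x (e.eval s)
  | .put a i e, s => s.setArr a (i.eval s) (e.eval s)
  | .seq c d, s => d.exec (c.exec s)
  | .ite e c d, s => if e.eval s = 0 then d.exec s else c.exec s
  | .while _ _, s => s

/-- All numbers written by the loop-free program are below `W`. -/
def Ok (W : ℕ) : Cmd → State → Prop
  | .set _ e, s => e.eval s < W
  | .put _ i e, s => i.eval s < W ∧ e.eval s < W
  | .seq c d, s => c.Ok W s ∧ d.Ok W (c.exec s)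
  | .ite e c d, s => if e.eval s = 0 then d.Ok W s else c.Ok W s
  | .while _ _, _ => False

def len : Cmd → ℕ
  | .set _ _ => 1
  | .put _ _ _ => 1
  | .seq c d => c.len + d.len
  | .ite _ c d => max c.len d.len + 1
  | .while _ _ => 0

theorem Ok.runs {W : ℕ} {c : Cmd} {s : State} (h : c.Ok W s) :
    ∃ t, Runs W c s t (c.exec s) ∧ t ≤ c.len := by
  induction c generalizing s with
  | set x e => exact ⟨1, .set _ _ _ h, le_rfl⟩
  | put a i e => exact ⟨1, .put _ _ _ _ h.1 h.2, le_rfl⟩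
  | seq c d ihc ihd =>
    obtain ⟨t, hr, ht⟩ := ihc h.1
    obtain ⟨t', hr', ht'⟩ := ihd h.2
    exact ⟨_, .seq _ _ _ _ _ _ _ hr hr', add_le_add ht ht'⟩
  | ite e c d ihc ihd =>
    by_cases he : e.eval s = 0
    · simp only [Ok, he, if_true] at h
      obtain ⟨t, hr, ht⟩ := ihd h
      refine ⟨_, ?_, Nat.succ_le_succ (ht.trans (le_max_right _ _))⟩
      simpa [exec, he] using Runs.ite_false e c d s _ t he hr
    · simp only [Ok, he, if_false] at h
      obtain ⟨t, hr, ht⟩ := ihc h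
      refine ⟨_, ?_, Nat.succ_le_succ (ht.trans (le_max_left _ _))⟩
      simpa [exec, he] using Runs.ite_true e c d s _ t he hr
  | _ => exact h.elim

theorem Ok.does {W : ℕ} {c : Cmd} {s : State} {Q : State → Prop} (h : c.Ok W s)
    (hQ : Q (c.exec s)) : c.Does W s c.len Q := by
  obtain ⟨t, hr, ht⟩ := h.runs
  exact ⟨t, _, hr, ht, hQ⟩

/-! #### Loops -/

/-- A loop with a potential `n` that pays for the steps. -/
theorem does_while {W : ℕ} {e : Expr} {c : Cmd} (Inv : ℕ → State → Prop)
    (hstep : ∀ n s, Inv n s → e.eval s ≠ 0 →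
      ∃ t s' n', Runs W c s t s' ∧ Inv n' s' ∧ t + 1 + n' ≤ n)
    {n : ℕ} {s : State} (hs : Inv n s) :
    (Cmd.while e c).Does W s (n + 1) (fun s' => (∃ n', Inv n' s') ∧ e.eval s' = 0) := by
  induction n using Nat.strong_induction_on generalizing s with
  | _ n ih =>
    by_cases he : e.eval s = 0
    · exact ⟨1, s, .while_false _ _ _ he, by omega, ⟨n, hs⟩, he⟩
    · obtain ⟨t, s', n', hr, hi, hn⟩ := hstep n s hs he
      obtain ⟨t', s'', hr', ht', hq⟩ := ih n' (by omega) hi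
      exact ⟨_, s'', .while_true _ _ _ _ _ _ _ he hr hr', by omega, hq⟩

/-- `for r in [r, hi) do c`, where the register `r` is initialised. -/
def loop (c : Cmd) (r : ℕ) (hi : Expr) : Cmd :=
  .while (.bin .lt (.var r) hi) (.seq c (.set r (.bin .add (.var r) (.lit 1))))

/-- `for r in [lo, hi) do c`. -/
def forLoop (c : Cmd) (r : ℕ) (lo hi : Expr) : Cmd := .seq (.set r lo) (c.loop r hi)

/-- Two states agree outside the memory that `c` may change. -/
def Frame (c : Cmd) (s s' : State) : Prop :=
  (∀ x, x ∉ c.wr → s'.reg x = s.reg x) ∧ ∀ a, a ∉ c.wa → s'.arr a = s.arr a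

/-- An iteration costs `K` for the body, one step for the increment and one for the test. The body
may assign to the counter as long as it restores its value, which happens in the no-op branches. The
new invariant is required of the state after the increment. -/
theorem does_loop {W r : ℕ} {hi : Expr} {c : Cmd} {s₀ : State} (Inv : ℕ → State → Prop)
    {lo b K : ℕ} (hr : s₀.reg r = lo) (hlo : lo ≤ b) (h₀ : Inv lo s₀) (hW : s₀.Fits W)
    (hhi : ∀ j s, (c.loop r hi).Frame s₀ s → Inv j s → hi.eval s = b) (hb : b < W)
    (hstep : ∀ j s, lo ≤ j → j < b → (c.loop r hi).Frame s₀ s → s.Fits W → s.reg r = j →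
      Inv j s → c.Does W s K (fun s' => s'.reg r = j ∧ Inv (j + 1) (s'.setReg r (j + 1)))) :
    (c.loop r hi).Does W s₀ ((b - lo) * (K + 2) + 1)
      (fun s' => s'.reg r = b ∧ Inv b s' ∧ s'.Fits W) := by
  have key := does_while (W := W) (e := .bin .lt (.var r) hi)
    (c := .seq c (.set r (.bin .add (.var r) (.lit 1))))
    (fun n s => lo ≤ s.reg r ∧ s.reg r ≤ b ∧ Inv (s.reg r) s ∧ (c.loop r hi).Frame s₀ s ∧
      s.Fits W ∧ n = (b - s.reg r) * (K + 2)) ?_ (s := s₀)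
    ⟨hr ▸ le_rfl, hr ▸ hlo, hr ▸ h₀, ⟨fun _ _ => rfl, fun _ _ => rfl⟩, hW, rfl⟩
  · rw [hr] at key
    refine key.mono le_rfl ?_
    rintro t s' - ⟨⟨-, -, h2, h3, h4, h5, -⟩, he⟩
    have : s'.reg r = b := by
      simp only [Expr.eval, Op.eval, hhi _ _ h4 h3] at he
      split_ifs at he
      omega
    exact ⟨this, this ▸ h3, h5⟩
  · rintro n s ⟨h1, h2, h3, h4, h5, rfl⟩ he
    have hlt : s.reg r < b := by
      simp only [Expr.eval, Op.eval, hhi _ _ h4 h3] at he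
      split_ifs at he with h
      · exact h
      · exact absurd rfl he
    obtain ⟨t, s', hrun, ht, hreg, hinv⟩ := hstep _ s h1 hlt h4 h5 rfl h3
    have hrun' : Runs W (.seq c (.set r (.bin .add (.var r) (.lit 1)))) s (t + 1)
        (s'.setReg r (s.reg r + 1)) := by
      refine .seq _ _ _ _ _ _ _ hrun ?_
      have := Runs.set (W := W) r (.bin .add (.var r) (.lit 1)) s'
        (by simp only [Expr.eval, Op.eval]; omega)
      simpa only [Expr.eval, Op.eval, hreg] using this
    have hreg' : (s'.setReg r (s.reg r + 1)).reg r = s.reg r + 1 := by simp [State.setReg]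
    refine ⟨_, _, _, hrun', ⟨?_, ?_, ?_, ?_, hrun'.fits h5, rfl⟩, ?_⟩
    · omega
    · omega
    · rwa [hreg']
    · exact ⟨fun x hx => (hrun'.reg_eq hx).trans (h4.1 x hx),
        fun x hx => (hrun'.arr_eq hx).trans (h4.2 x hx)⟩
    · rw [hreg']
      obtain ⟨d, hd⟩ := Nat.exists_eq_add_of_lt hlt
      have e1 : b - s.reg r = d + 1 := by omega
      have e2 : b - (s.reg r + 1) = d := by omega
      rw [e1, e2, Nat.succ_mul]
      omega

theorem does_forLoop {W r : ℕ} {elo ehi : Expr} {c : Cmd} {s₀ : State} (Inv : ℕ → State → Prop)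
    {lo b K : ℕ} (hr : elo.eval s₀ = lo) (hlo : lo ≤ b) (h₀ : Inv lo (s₀.setReg r lo))
    (hW : s₀.Fits W)
    (hhi : ∀ j s, (c.forLoop r elo ehi).Frame s₀ s → Inv j s → ehi.eval s = b) (hb : b < W)
    (hstep : ∀ j s, lo ≤ j → j < b → (c.forLoop r elo ehi).Frame s₀ s → s.Fits W → s.reg r = j →
      Inv j s → c.Does W s K (fun s' => s'.reg r = j ∧ Inv (j + 1) (s'.setReg r (j + 1)))) :
    (c.forLoop r elo ehi).Does W s₀ ((b - lo) * (K + 2) + 2)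
      (fun s' => s'.reg r = b ∧ Inv b s' ∧ s'.Fits W) := by
  have hfr : ∀ s, (c.loop r ehi).Frame (s₀.setReg r lo) s → (c.forLoop r elo ehi).Frame s₀ s := by
    refine fun s h => ⟨fun x hx => ?_, fun a ha => ?_⟩
    · simp only [Cmd.forLoop, wr, List.mem_append, List.mem_singleton, not_or] at hx
      rw [h.1 x hx.2]
      simp [State.setReg, hx.1]
    · simp only [Cmd.forLoop, wa, List.nil_append] at ha
      exact h.2 a ha
  have hset : Runs W (.set r elo) s₀ 1 (s₀.setReg r lo) := by
    have := Runs.set (W := W) r elo s₀ (by omega)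
    rwa [hr] at this
  obtain ⟨t, s', hrun, ht, hq⟩ := does_loop (W := W) (c := c) (r := r) (hi := ehi)
    (s₀ := s₀.setReg r lo) Inv (K := K) (by simp [State.setReg]) hlo h₀ (hset.fits hW)
    (fun j s h => hhi j s (hfr s h)) hb (fun j s h1 h2 h3 => hstep j s h1 h2 (hfr s h3))
  exact ⟨_, s', .seq _ _ _ _ _ _ _ hset hrun, by omega, hq⟩

end Cmd

/-! ### Three kinds of loops over arrays -/

namespace Cmd

/-- `for r in [0, hi) do a[r] := e`. -/
def fill (a r : ℕ) (hi e : Expr) : Cmd := (Cmd.put a (.var r) e).forLoop r (.lit 0) hi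

/-- `for r in [lo, hi) do if p then a[i] := e`. -/
def scatter (a r : ℕ) (lo hi p i e : Expr) : Cmd :=
  (Cmd.ite p (.put a i e) (.set r (.var r))).forLoop r lo hi

/-- `for r in [0, hi) do a[i] := a[i] + e`. -/
def accum (a r : ℕ) (hi i e : Expr) : Cmd :=
  (Cmd.put a i (.bin .add (.get a i) e)).forLoop r (.lit 0) hi

/-- The expression may read `a` at the position about to be overwritten, where the old value is
still present; this permits updates in place. -/
theorem does_fill {W a r b : ℕ} {hi e : Expr} {s : State} (f : ℕ → ℕ) (hs : s.Fits W)
    (hb : b < W)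
    (hhi : ∀ s' : State, (∀ x, x ≠ r → s'.reg x = s.reg x) → (∀ x, x ≠ a → s'.arr x = s.arr x) →
      hi.eval s' = b)
    (he : ∀ s' : State, (∀ x, x ≠ r → s'.reg x = s.reg x) → (∀ x, x ≠ a → s'.arr x = s.arr x) →
      ∀ v < b, s'.Fits W → s'.reg r = v → s'.arr a v = s.arr a v → e.eval s' = f v ∧ f v < W) :
    (fill a r hi e).Does W s (3 * b + 2) (fun s' =>
      s'.reg r = b ∧ (∀ v < b, s'.arr a v = f v) ∧ ∀ v, b ≤ v → s'.arr a v = s.arr a v) := by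
  have hfr : ∀ s', ((Cmd.put a (.var r) e).forLoop r (.lit 0) hi).Frame s s' →
      (∀ x, x ≠ r → s'.reg x = s.reg x) ∧ ∀ x, x ≠ a → s'.arr x = s.arr x := by
    refine fun s' h => ⟨fun x hx => h.1 x ?_, fun x hx => h.2 x ?_⟩ <;>
      simp [forLoop, loop, wr, wa, hx]
  refine (does_forLoop (W := W) (c := .put a (.var r) e) (r := r) (elo := .lit 0) (ehi := hi)
    (s₀ := s) (lo := 0) (b := b) (K := 1)
    (fun j s' => (∀ v < j, s'.arr a v = f v) ∧ ∀ v, j ≤ v → s'.arr a v = s.arr a v)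
    rfl (Nat.zero_le _) ⟨by simp, fun _ _ => rfl⟩ hs
    (fun j s' h _ => hhi s' (hfr s' h).1 (hfr s' h).2) hb ?_).mono (by omega) ?_
  · rintro j s' - hj h hW hr ⟨h1, h2⟩
    obtain ⟨e1, e2⟩ := he s' (hfr s' h).1 (hfr s' h).2 j hj hW hr (h2 j le_rfl)
    refine Ok.does (c := .put a (.var r) e) ⟨by simpa [Expr.eval, hr] using hj.trans hb, by
      rwa [e1]⟩ ⟨hr, ?_⟩
    simp only [exec, Expr.eval, hr, e1, State.setArr, State.setReg, Function.update_self]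
    refine ⟨fun v hv => ?_, fun v hv => ?_⟩
    · rcases Nat.lt_succ_iff_lt_or_eq.1 hv with h | h
      · rw [Function.update_of_ne (by omega), h1 v h]
      · simp [h]
    · rw [Function.update_of_ne (by omega), h2 v (by omega)]
  · rintro t s' - ⟨h1, h2, h3⟩
    exact ⟨h1, h2⟩

-- All writes store the same value, so their order and multiplicity are irrelevant and the result is
-- described by an existential. The language has no empty command; the else branch assigns the
-- counter to itself.
open Classical in
theorem does_scatter {W a r lo b v : ℕ} {elo hi p i e : Expr} {s : State} (C : ℕ → Prop)
    (ix : ℕ → ℕ) (hs : s.Fits W) (hb : b < W) (hlo : elo.eval s = lo) (hlb : lo ≤ b) (hv : v < W)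
    (hhi : ∀ s' : State, (∀ x, x ≠ r → s'.reg x = s.reg x) → (∀ x, x ≠ a → s'.arr x = s.arr x) →
      hi.eval s' = b)
    (he : ∀ s' : State, (∀ x, x ≠ r → s'.reg x = s.reg x) → (∀ x, x ≠ a → s'.arr x = s.arr x) →
      ∀ j, lo ≤ j → j < b → s'.Fits W → s'.reg r = j → (p.eval s' ≠ 0 ↔ C j) ∧ (C j →
        i.eval s' = ix j ∧ ix j < W ∧ e.eval s' = v)) :
    (scatter a r elo hi p i e).Does W s (4 * (b - lo) + 2) (fun s' => s'.reg r = b ∧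
      ∀ y, s'.arr a y = if ∃ j, lo ≤ j ∧ j < b ∧ C j ∧ ix j = y then v else s.arr a y) := by
  have hfr : ∀ s', ((Cmd.ite p (.put a i e) (.set r (.var r))).forLoop r elo hi).Frame s s' →
      (∀ x, x ≠ r → s'.reg x = s.reg x) ∧ ∀ x, x ≠ a → s'.arr x = s.arr x := by
    refine fun s' h => ⟨fun x hx => h.1 x ?_, fun x hx => h.2 x ?_⟩ <;>
      simp [forLoop, loop, wr, wa, hx]
  refine (does_forLoop (W := W) (c := .ite p (.put a i e) (.set r (.var r))) (r := r) (elo := elo)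
    (ehi := hi) (s₀ := s) (lo := lo) (b := b) (K := 2)
    (fun j s' => ∀ y, s'.arr a y =
      if ∃ j', lo ≤ j' ∧ j' < j ∧ C j' ∧ ix j' = y then v else s.arr a y)
    hlo hlb ?_ hs (fun j s' h _ => hhi s' (hfr s' h).1 (hfr s' h).2) hb ?_).mono (by omega) ?_
  · intro y
    rw [if_neg]
    · rfl
    · rintro ⟨j, h1, h2, -⟩
      omega
  · rintro j s' hj1 hj h hW hr h1
    obtain ⟨e1, e2⟩ := he s' (hfr s' h).1 (hfr s' h).2 j hj1 hj hW hr
    by_cases hc : C j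
    · obtain ⟨i1, i2, i3⟩ := e2 hc
      have hp := e1.2 hc
      refine Ok.does (c := .ite p (.put a i e) (.set r (.var r))) ?_ ⟨?_, fun y => ?_⟩
      · simp only [Ok, if_neg hp]
        exact ⟨by omega, by omega⟩
      · simp only [exec, if_neg hp]
        exact hr
      · simp only [exec, if_neg hp, i1, i3, State.setArr, State.setReg, Function.update_self,
          Function.update_apply]
        by_cases hy : y = ix j
        · rw [if_pos hy, if_pos ⟨j, hj1, by omega, hc, hy.symm⟩]
        · rw [if_neg hy, h1]
          congr 1
          apply propext
          refine exists_congr fun j' => and_congr_right fun _ => ⟨fun h => ⟨by omega, h.2⟩,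
            fun h => ⟨?_, h.2⟩⟩
          rcases Nat.lt_succ_iff_lt_or_eq.1 h.1 with h' | h'
          · exact h'
          · exact absurd (h' ▸ h.2.2).symm hy
    · have hp : p.eval s' = 0 := by
        by_contra h
        exact hc (e1.1 h)
      have hset : s'.setReg r j = s' := by
        cases s'
        simp only [State.setReg, State.mk.injEq, and_true]
        ext x
        by_cases hx : x = r <;> simp_all
      refine Ok.does (c := .ite p (.put a i e) (.set r (.var r))) ?_ ⟨?_, fun y => ?_⟩
      · simp only [Ok, if_pos hp, Expr.eval]
        exact hW.1 r
      · simp [exec, if_pos hp, Expr.eval, State.setReg, hr]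
      · simp only [exec, if_pos hp, Expr.eval, hr, hset]
        refine (h1 y).trans ?_
        congr 1
        apply propext
        refine exists_congr fun j' => and_congr_right fun _ => ⟨fun h => ⟨by omega, h.2⟩,
            fun h => ⟨?_, h.2⟩⟩
        rcases Nat.lt_succ_iff_lt_or_eq.1 h.1 with h' | h'
        · exact h'
        · exact absurd (h' ▸ h.2.1) hc
  · rintro t s' - ⟨h1, h2, h3⟩
    exact ⟨h1, h2⟩

/-- Only the final sums need a bound, because partial sums of naturals never exceed them. -/
theorem does_accum {W a r b : ℕ} {hi i e : Expr} {s : State} (ix f : ℕ → ℕ) (hs : s.Fits W)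
    (hb : b < W)
    (hhi : ∀ s' : State, (∀ x, x ≠ r → s'.reg x = s.reg x) → (∀ x, x ≠ a → s'.arr x = s.arr x) →
      hi.eval s' = b)
    (he : ∀ s' : State, (∀ x, x ≠ r → s'.reg x = s.reg x) → (∀ x, x ≠ a → s'.arr x = s.arr x) →
      ∀ j < b, s'.Fits W → s'.reg r = j → i.eval s' = ix j ∧ e.eval s' = f j ∧ ix j < W)
    (hbd : ∀ j < b, s.arr a (ix j) + ∑ j' ∈ range b with ix j' = ix j, f j' < W) :
    (accum a r hi i e).Does W s (3 * b + 2) (fun s' => s'.reg r = b ∧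
      ∀ y, s'.arr a y = s.arr a y + ∑ j ∈ range b with ix j = y, f j) := by
  have hfr : ∀ s', ((Cmd.put a i (.bin .add (.get a i) e)).forLoop r (.lit 0) hi).Frame s s' →
      (∀ x, x ≠ r → s'.reg x = s.reg x) ∧ ∀ x, x ≠ a → s'.arr x = s.arr x := by
    refine fun s' h => ⟨fun x hx => h.1 x ?_, fun x hx => h.2 x ?_⟩ <;>
      simp [forLoop, loop, wr, wa, hx]
  refine (does_forLoop (W := W) (c := .put a i (.bin .add (.get a i) e)) (r := r) (elo := .lit 0)
    (ehi := hi) (s₀ := s) (lo := 0) (b := b) (K := 1)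
    (fun j s' => ∀ y, s'.arr a y = s.arr a y + ∑ j' ∈ range j with ix j' = y, f j')
    rfl (Nat.zero_le _) (fun y => by simp [State.setReg]) hs
    (fun j s' h _ => hhi s' (hfr s' h).1 (hfr s' h).2) hb ?_).mono (by omega) ?_
  · rintro j s' - hj h hW hr h1
    obtain ⟨e1, e2, e3⟩ := he s' (hfr s' h).1 (hfr s' h).2 j hj hW hr
    have hsum : ∀ y, ∑ j' ∈ range (j + 1) with ix j' = y, f j' =
        (∑ j' ∈ range j with ix j' = y, f j') + if ix j = y then f j else 0 := by
      intro y
      rw [Finset.sum_filter, Finset.sum_range_succ, Finset.sum_filter]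
    refine Ok.does (c := .put a i (.bin .add (.get a i) e)) ⟨by rwa [e1], ?_⟩ ⟨hr, fun y => ?_⟩
    · simp only [Expr.eval, Op.eval, e1, e2, h1]
      refine lt_of_le_of_lt ?_ (hbd j hj)
      have := hsum (ix j)
      rw [if_pos rfl] at this
      rw [add_assoc, ← this]
      gcongr
      omega
    · simp only [exec, Expr.eval, Op.eval, e1, e2, State.setArr, State.setReg,
        Function.update_self, Function.update_apply, hsum, h1]
      by_cases hy : y = ix j
      · simp [hy, add_assoc]
      · simp [hy, Ne.symm hy]
  · rintro t s' - ⟨h1, h2, h3⟩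
    exact ⟨h1, h2⟩

end Cmd

/-! ### Least threshold-closed sets of multigraphs in linear time -/

open Classical in
/-- The edges `e < M` go from `src e` to `dst e`. A node `y < N` belongs to `S` as soon as at least
`thr y` of its outgoing edges lead to `S`. -/
def ThrClosed (N M : ℕ) (src dst thr : ℕ → ℕ) (S : Set ℕ) : Prop :=
  ∀ y < N, thr y ≤ #{e ∈ range M | src e = y ∧ dst e ∈ S} → y ∈ S

/-- The least threshold-closed set of nodes. -/
def thrClosure (N M : ℕ) (src dst thr : ℕ → ℕ) : Set ℕ :=
  {y | y < N ∧ ∀ S, ThrClosed N M src dst thr S → y ∈ S}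

/-- Closed sets are stable under intersection: the number of edges that lead into a set is monotone
in the set. -/
theorem thrClosed_thrClosure {N M : ℕ} {src dst thr : ℕ → ℕ} :
    ThrClosed N M src dst thr (thrClosure N M src dst thr) := by
  classical
  refine fun y hy h => ⟨hy, fun S hS => hS y hy (h.trans (card_le_card fun e he => ?_))⟩
  simp only [mem_filter] at he ⊢
  exact ⟨he.1, he.2.1, he.2.2.2 S hS⟩

/-- The number of the last edge into `x` before the edge `j`, plus one. -/
def lastEdge (dst : ℕ → ℕ) (x : ℕ) : ℕ → ℕ
  | 0 => 0
  | j + 1 => if dst j = x then j + 1 else lastEdge dst x j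

theorem lastEdge_le (dst : ℕ → ℕ) (x j : ℕ) : lastEdge dst x j ≤ j := by
  induction j with
  | zero => rfl
  | succ j ih => unfold lastEdge; split_ifs <;> omega

/-- Following the links from `lastEdge` downwards therefore misses no edge into `x`. Edge numbers
are stored plus one, so that `0` can end a list. -/
theorem lt_lastEdge {dst : ℕ → ℕ} {x j e : ℕ} (he : e < j) (hx : dst e = x) :
    e < lastEdge dst x j := by
  induction j with
  | zero => omega
  | succ j ih =>
    unfold lastEdge
    split_ifs with h
    · exact he
    · exact ih (by rcases Nat.lt_succ_iff_lt_or_eq.1 he with h' | rfl <;> [exact h'; exact absurd hx h])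

theorem dst_lastEdge {dst : ℕ → ℕ} {x j : ℕ} (h : lastEdge dst x j ≠ 0) :
    dst (lastEdge dst x j - 1) = x := by
  induction j with
  | zero => exact absurd rfl h
  | succ j ih =>
    unfold lastEdge at h ⊢
    split_ifs at h ⊢ with h'
    · simpa using h'
    · exact ih h

/-! ### The worklist program: reversed adjacency lists and initial stack -/

namespace Cmd

def skip : Cmd := .set 21 (.var 21)

/-- The lists of the edges into each node: the heads are in the array `25` and the links in the
array `26`. -/
def linkEdges : Cmd :=
  .seq (fill 25 21 (.var 22) (.lit 0))
    ((Cmd.seq (.put 26 (.var 21) (.get 25 (.get 22 (.var 21))))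
      (.put 25 (.get 22 (.var 21)) (.bin .add (.var 21) (.lit 1)))).forLoop 21 (.lit 0) (.var 20))

/-- Mark the nodes with threshold `0` in the array `24` and put them on the stack `27`. -/
def initStack : Cmd :=
  .seq (fill 24 21 (.var 22) (.bin .eq (.get 23 (.var 21)) (.lit 0)))
    (.seq (.set 23 (.lit 0))
      ((Cmd.ite (.get 24 (.var 21)) (.seq (.put 27 (.var 23) (.var 21))
        (.set 23 (.bin .add (.var 23) (.lit 1)))) skip).forLoop 21 (.lit 0) (.var 22)))

/-- Process the edge with number `reg 24 - 1`. -/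
def processEdge : Cmd :=
  .seq (.set 25 (.get 21 (.bin .sub (.var 24) (.lit 1))))
    (.seq (.set 24 (.get 26 (.bin .sub (.var 24) (.lit 1))))
      (.ite (.get 24 (.var 25)) skip
        (.seq (.put 23 (.var 25) (.bin .sub (.get 23 (.var 25)) (.lit 1)))
          (.ite (.get 23 (.var 25)) skip
            (.seq (.put 24 (.var 25) (.lit 1))
              (.seq (.put 27 (.var 23) (.var 25)) (.set 23 (.bin .add (.var 23) (.lit 1)))))))))

/-- Pop a node from the stack and start with the list of its incoming edges. -/
def popNode : Cmd :=
  .seq (.set 23 (.bin .sub (.var 23) (.lit 1))) (.set 24 (.get 25 (.get 27 (.var 23))))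

/-- Compute the least threshold-closed set of the graph with `reg 22` nodes and `reg 20` edges, from
`arr 21` to `arr 22`, with the thresholds `arr 23`; its indicator is stored in `arr 24`. -/
def closure : Cmd :=
  .seq linkEdges (.seq initStack (.seq (.set 24 (.lit 0))
    (.while (.bin .add (.var 23) (.var 24)) (.ite (.var 24) processEdge popNode))))

/-- When the edge `j` is inserted, the head of the list of its target is the last earlier edge with
this target; it becomes the link of `j`, and `j` becomes the head. -/
theorem does_linkEdges {W N M : ℕ} {s : State} (hs : s.Fits W) (hN : s.reg 22 = N)
    (hM : s.reg 20 = M) (hdst : ∀ e < M, s.arr 22 e < N) :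
    linkEdges.Does W s (3 * N + 4 * M + 4) (fun s' =>
      (∀ y < N, s'.arr 25 y = lastEdge (s.arr 22) y M) ∧
      ∀ e < M, s'.arr 26 e = lastEdge (s.arr 22) (s.arr 22 e) e) := by
  have hNW : N < W := hN ▸ hs.1 22
  have hMW : M < W := hM ▸ hs.1 20
  refine ((does_fill (W := W) (b := N) (fun _ => 0) hs hNW (fun s' h1 h2 => ?_)
    (fun s' h1 h2 v hv hf _ _ => ⟨rfl, by omega⟩)).seq (T' := 4 * M + 2) ?_).mono (by omega)
      fun _ _ _ h => h
  · simpa [Expr.eval, h1] using hN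
  intro t s1 r1 h1
  have e22 : s1.arr 22 = s.arr 22 := r1.arr_eq (by decide)
  have e20 : s1.reg 20 = M := (r1.reg_eq (by decide)).trans hM
  refine (does_forLoop (W := W) (lo := 0) (b := M) (K := 2) (fun j s' =>
      (∀ y < N, s'.arr 25 y = lastEdge (s.arr 22) y j) ∧
      ∀ e < j, s'.arr 26 e = lastEdge (s.arr 22) (s.arr 22 e) e) rfl (Nat.zero_le _)
      ⟨fun y hy => h1.2.1 y hy, by simp⟩ (r1.fits hs) (fun j s' hf _ => ?_) hMW ?_).mono (by omega)
      fun _ _ _ h => h.2.1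
  · rw [Expr.eval, hf.1 20 (by decide), e20]
  · rintro j s' - hj hf hW hr ⟨i1, i2⟩
    have f22 : s'.arr 22 = s.arr 22 := (hf.2 22 (by decide)).trans e22
    refine Ok.does ⟨⟨?_, ?_⟩, ?_, ?_⟩ ⟨?_, ?_, ?_⟩
    · simp only [Expr.eval]; exact hW.1 _
    · simp only [Expr.eval]; exact hW.2 _ _
    · simp only [exec, Expr.eval, State.setArr]; simpa using hW.2 _ _
    · simp only [exec, Expr.eval, State.setArr, Op.eval, hr]; omega
    · simpa [exec, State.setArr] using hr
    · intro y hy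
      simp only [exec, Expr.eval, State.setArr, State.setReg, Op.eval, hr, f22, Function.update_self,
        Function.update_apply, lastEdge]
      by_cases h : y = s.arr 22 j
      · simp [h]
      · simp [h, Ne.symm h, i1 y hy]
    · intro e he
      simp only [exec, Expr.eval, State.setArr, State.setReg, Op.eval, hr, f22]
      rcases Nat.lt_succ_iff_lt_or_eq.1 he with h | rfl
      · simp [h.ne, i2 e h]
      · simp [i1 _ (hdst e hj)]

/-- Register `23` is the stack pointer. Injectivity of the stack is recorded because it later bounds
the height of the stack. -/
theorem does_initStack {W N : ℕ} {s : State} (hs : s.Fits W) (hN : s.reg 22 = N) (hW1 : 1 < W) :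
    initStack.Does W s (8 * N + 5) (fun s' =>
      (∀ y < N, s'.arr 24 y = if s.arr 23 y = 0 then 1 else 0) ∧
      (∀ i < s'.reg 23, s'.arr 27 i < N ∧ s.arr 23 (s'.arr 27 i) = 0) ∧
      (∀ i < s'.reg 23, ∀ j < s'.reg 23, s'.arr 27 i = s'.arr 27 j → i = j) ∧
      (∀ y < N, s.arr 23 y = 0 → ∃ i < s'.reg 23, s'.arr 27 i = y)) := by
  have hNW : N < W := hN ▸ hs.1 22
  refine ((does_fill (W := W) (b := N) (fun y => if s.arr 23 y = 0 then 1 else 0) hs hNW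
    (fun s' h1 h2 => ?_) (fun s' h1 h2 v hv hf hr _ => ⟨?_, ?_⟩)).seq (T' := 5 * N + 3) ?_).mono
      (by omega) fun _ _ _ h => h
  · simpa [Expr.eval, h1] using hN
  · simp [Expr.eval, Op.eval, h2, hr]
  · split_ifs <;> omega
  intro t s1 r1 h1
  have e23 : s1.arr 23 = s.arr 23 := r1.arr_eq (by decide)
  refine ((Ok.does (c := .set 23 (.lit 0)) (s := s1) (W := W)
    (Q := fun s2 => s2 = s1.setReg 23 0) (by simp only [Ok, Expr.eval]; omega) rfl).seq
      (T' := 5 * N + 2) ?_).mono (by simp [len]; omega) fun _ _ _ h => h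
  rintro t' s2 r2 rfl
  have e22 : (s1.setReg 23 0).reg 22 = N := (r2.reg_eq (by decide)).trans
    ((r1.reg_eq (by decide)).trans hN)
  refine (does_forLoop (W := W) (lo := 0) (b := N) (K := 3) (fun x s' => s'.reg 23 ≤ x ∧
      (∀ i < s'.reg 23, s'.arr 27 i < x ∧ s.arr 23 (s'.arr 27 i) = 0) ∧
      (∀ i < s'.reg 23, ∀ j < s'.reg 23, s'.arr 27 i = s'.arr 27 j → i = j) ∧
      (∀ y < x, s.arr 23 y = 0 → ∃ i < s'.reg 23, s'.arr 27 i = y))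
      rfl (Nat.zero_le _) (by simp [State.setReg]) (r2.fits (r1.fits hs))
      (fun j s' hf _ => ?_) hNW ?_).mono (by omega) ?_
  · rw [Expr.eval, hf.1 22 (by decide), e22]
  · rintro x s' - hx hf hW hr ⟨i0, i1, i2, i3⟩
    have f24 : s'.arr 24 x = if s.arr 23 x = 0 then 1 else 0 := by
      rw [hf.2 24 (by decide)]
      exact h1.2.1 x hx
    by_cases h0 : s.arr 23 x = 0
    · rw [if_pos h0] at f24
      refine Ok.does ?_ ⟨?_, ?_⟩
      · simp [Ok, exec, Expr.eval, Op.eval, State.setArr, hr, f24]; omega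
      · simp [exec, Expr.eval, State.setArr, State.setReg, hr, f24]
      · simp only [exec, Expr.eval, Op.eval, State.setArr, State.setReg, hr, f24]
        simp only [one_ne_zero, if_false, Function.update_apply, Nat.reduceEqDiff,
          Nat.reduceEqDiff, if_true]
        refine ⟨by omega, fun i hi => ?_, fun i hi j hj => ?_, fun y hy hy0 => ?_⟩
        · split_ifs with h
          · exact ⟨by omega, h0⟩
          · exact ⟨(i1 i (by omega)).1.trans (by omega), (i1 i (by omega)).2⟩
        · split_ifs with h h' h'
          · omega
          · intro h''
            have := (i1 j (by omega)).1
            omega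
          · intro h''
            have := (i1 i (by omega)).1
            omega
          · exact i2 i (by omega) j (by omega)
        · rcases Nat.lt_succ_iff_lt_or_eq.1 hy with h | rfl
          · obtain ⟨i, hi, hiy⟩ := i3 y h hy0
            exact ⟨i, by omega, by rw [if_neg (by omega), hiy]⟩
          · exact ⟨s'.reg 23, by omega, by simp⟩
    · rw [if_neg h0] at f24
      refine Ok.does ?_ ⟨?_, ?_⟩
      · simp [Ok, Expr.eval, hr, f24, skip]; omega
      · simp [exec, Expr.eval, State.setReg, hr, f24, skip]
      · simp only [exec, Expr.eval, State.setReg, hr, f24, skip]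
        simp only [if_true, Function.update_apply, Nat.reduceEqDiff, if_false]
        refine ⟨by omega, fun i hi => ⟨(i1 i hi).1.trans (by omega), (i1 i hi).2⟩, i2,
          fun y hy hy0 => ?_⟩
        rcases Nat.lt_succ_iff_lt_or_eq.1 hy with h | rfl
        · exact i3 y h hy0
        · exact absurd hy0 h0
  · rintro t3 s3 r3 ⟨-, ⟨-, i1, i2, i3⟩, -⟩
    refine ⟨fun y hy => ?_, i1, i2, i3⟩
    rw [r3.arr_eq (by decide)]
    exact h1.2.1 y hy

end Cmd

/-- The edges into `D`, except for those into `x` before the position `p`. -/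
def processedEdges (M : ℕ) (dst : ℕ → ℕ) (D : Finset ℕ) (x p : ℕ) : Finset ℕ :=
  {e ∈ range M | dst e ∈ D ∧ ¬(dst e = x ∧ e < p)}

/-- The invariant of the main loop of `closure`: the nodes of `D` were popped from the stack, `x` is
the last of them, and `s₀` is the state before the loop. -/
structure ClosureInv (W N M : ℕ) (thr : ℕ → ℕ) (s₀ : State) (D : Finset ℕ) (x : ℕ) (s : State) :
    Prop where
  fits : s.Fits W
  src : s.arr 21 = s₀.arr 21
  heads : s.arr 25 = s₀.arr 25
  links : s.arr 26 = s₀.arr 26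
  D_le : D ⊆ range N
  bool : ∀ y < N, s.arr 24 y = 0 ∨ s.arr 24 y = 1
  marked : ∀ y < N, s.arr 24 y = 1 ↔ y ∈ D ∨ ∃ i < s.reg 23, s.arr 27 i = y
  stack : ∀ i < s.reg 23, s.arr 27 i < N ∧ s.arr 27 i ∉ D
  inj : ∀ i < s.reg 23, ∀ j < s.reg 23, s.arr 27 i = s.arr 27 j → i = j
  count : ∀ y < N, s.arr 24 y = 0 → 0 < s.arr 23 y ∧
    s.arr 23 y + #{e ∈ processedEdges M (s₀.arr 22) D x (s.reg 24) | s₀.arr 21 e = y} = thr y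
  sound : ∀ y < N, s.arr 24 y = 1 → y ∈ thrClosure N M (s₀.arr 21) (s₀.arr 22) thr
  pos : s.reg 24 ≤ M
  cur : s.reg 24 ≠ 0 → s₀.arr 22 (s.reg 24 - 1) = x ∧ x ∈ D

/-- The stack entries are distinct and disjoint from the popped nodes, and all of them are below
`N`. This keeps the stack pointer within the word bound and limits the number of pops. -/
theorem ClosureInv.sp_le {W N M : ℕ} {thr : ℕ → ℕ} {s₀ s : State} {D : Finset ℕ} {x : ℕ}
    (h : ClosureInv W N M thr s₀ D x s) : s.reg 23 + D.card ≤ N := by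
  have h1 : ((range (s.reg 23)).image (s.arr 27) ∪ D).card ≤ (range N).card := by
    refine card_le_card (union_subset (fun y hy => ?_) h.D_le)
    obtain ⟨i, hi, rfl⟩ := mem_image.1 hy
    exact mem_range.2 (h.stack i (mem_range.1 hi)).1
  rw [card_union_of_disjoint, card_image_of_injOn, card_range, card_range] at h1
  · exact h1
  · exact fun i hi j hj => h.inj i (by simpa using hi) j (by simpa using hj)
  · refine disjoint_left.2 fun y hy => ?_
    obtain ⟨i, hi, rfl⟩ := mem_image.1 hy
    exact (h.stack i (mem_range.1 hi)).2

/-! ### The main loop of the worklist program -/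

namespace Cmd

section

variable {W N M : ℕ} {thr : ℕ → ℕ} {s₀ s : State} {D : Finset ℕ} {x : ℕ}

/-- At this moment all edges into `D` are processed. Adding `x'` to `D` with its whole list still
pending leaves the processed edges unchanged, because every edge into `x'` lies before the head of
that list. So all counters remain correct. -/
theorem does_popNode (hlast : ∀ y < N, s₀.arr 25 y = lastEdge (s₀.arr 22) y M)
    (h : ClosureInv W N M thr s₀ D x s) (hp : s.reg 24 = 0) (hsp : s.reg 23 ≠ 0) :
    popNode.Does W s 2 (fun s' => ∃ x', x' ∉ D ∧
      processedEdges M (s₀.arr 22) (insert x' D) x' (s'.reg 24) =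
        processedEdges M (s₀.arr 22) D x (s.reg 24) ∧
      ClosureInv W N M thr s₀ (insert x' D) x' s') := by
  obtain ⟨hx1, hx2⟩ := h.stack (s.reg 23 - 1) (by omega)
  set x' := s.arr 27 (s.reg 23 - 1) with hx'
  have ok : popNode.Ok W s := by
    refine ⟨?_, ?_⟩
    · simp only [Ok, Expr.eval, Op.eval]
      have := h.fits.1 23
      omega
    · simp only [exec, Ok, Expr.eval, Op.eval, State.setReg]
      exact h.fits.2 _ _
  obtain ⟨t, hr, ht⟩ := ok.runs
  have hq : processedEdges M (s₀.arr 22) (insert x' D) x' (lastEdge (s₀.arr 22) x' M) =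
      processedEdges M (s₀.arr 22) D x 0 := by
    ext e
    simp only [processedEdges, mem_filter, mem_range, mem_insert]
    constructor
    · rintro ⟨h1, h2, h3⟩
      refine ⟨h1, h2.resolve_left fun h => h3 ⟨h, lt_lastEdge h1 h⟩, by omega⟩
    · rintro ⟨h1, h2, -⟩
      exact ⟨h1, Or.inr h2, fun h => hx2 (h.1 ▸ h2)⟩
  have e24 : (popNode.exec s).reg 24 = lastEdge (s₀.arr 22) x' M := by
    simp [popNode, exec, Expr.eval, Op.eval, State.setReg, h.heads, ← hx', hlast x' hx1]
  have e23 : (popNode.exec s).reg 23 = s.reg 23 - 1 := by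
    simp [popNode, exec, Expr.eval, Op.eval, State.setReg]
  have ea : (popNode.exec s).arr = s.arr := rfl
  refine ⟨t, _, hr, ht, x', hx2, by rw [e24, hq, hp], ?_⟩
  constructor <;> try simp only [e23, ea, e24]
  · exact hr.fits h.fits
  · exact h.src
  · exact h.heads
  · exact h.links
  · exact insert_subset (mem_range.2 hx1) h.D_le
  · exact h.bool
  · intro y hy
    rw [h.marked y hy, mem_insert]
    constructor
    · rintro (h1 | ⟨i, hi, rfl⟩)
      · exact Or.inl (Or.inr h1)
      · by_cases hi' : i = s.reg 23 - 1
        · exact Or.inl (Or.inl (by rw [hi', hx']))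
        · exact Or.inr ⟨i, by omega, rfl⟩
    · rintro ((rfl | h1) | ⟨i, hi, rfl⟩)
      · exact Or.inr ⟨s.reg 23 - 1, by omega, rfl⟩
      · exact Or.inl h1
      · exact Or.inr ⟨i, by omega, rfl⟩
  · intro i hi
    obtain ⟨h1, h2⟩ := h.stack i (by omega)
    refine ⟨h1, fun h3 => (mem_insert.1 h3).elim (fun h4 => ?_) h2⟩
    have := h.inj i (by omega) (s.reg 23 - 1) (by omega) h4
    omega
  · exact fun i hi j hj => h.inj i (by omega) j (by omega)
  · intro y hy h0
    rw [hq]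
    have := h.count y hy h0
    rwa [hp] at this
  · exact h.sound
  · exact lastEdge_le _ _ _
  · exact fun h0 => ⟨dst_lastEdge h0, mem_insert_self _ _⟩

/-- Exactly one edge becomes processed. The counter of an unmarked source is its threshold minus the
number of its processed edges, so reaching `0` means that enough edges lead into `D`. -/
theorem does_processEdge (hsrc : ∀ e < M, s₀.arr 21 e < N)
    (hlink : ∀ e < M, s₀.arr 26 e = lastEdge (s₀.arr 22) (s₀.arr 22 e) e) (hW1 : 1 < W) (hNW : N < W)
    (h : ClosureInv W N M thr s₀ D x s) (hp : s.reg 24 ≠ 0) :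
    processEdge.Does W s 8 (fun s' =>
      (processedEdges M (s₀.arr 22) D x (s'.reg 24)).card =
        (processedEdges M (s₀.arr 22) D x (s.reg 24)).card + 1 ∧
      ClosureInv W N M thr s₀ D x s') := by
  obtain ⟨e, he⟩ : ∃ e, s.reg 24 = e + 1 := ⟨_, (Nat.succ_pred hp).symm⟩
  have heM : e < M := by have := h.pos; omega
  obtain ⟨hex, hxD⟩ := h.cur hp
  rw [he, Nat.add_sub_cancel] at hex
  set p' := lastEdge (s₀.arr 22) x e with hp'
  set Q := processedEdges M (s₀.arr 22) D x (e + 1) with hQ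
  -- No edge into `x` lies between its predecessor in the list and `e`, so moving to the link adds
  -- `e` alone.
  have hq : processedEdges M (s₀.arr 22) D x p' = insert e Q := by
    ext e'
    simp only [hQ, processedEdges, mem_filter, mem_range, mem_insert]
    have hle := lastEdge_le (s₀.arr 22) x e
    constructor
    · rintro ⟨h1, h2, h3⟩
      by_cases h4 : e' = e
      · exact Or.inl h4
      · refine Or.inr ⟨h1, h2, fun h5 => h3 ⟨h5.1, lt_lastEdge (by omega) h5.1⟩⟩
    · rintro (rfl | ⟨h1, h2, h3⟩)
      · exact ⟨heM, hex ▸ hxD, by omega⟩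
      · exact ⟨h1, h2, fun h4 => h3 ⟨h4.1, by omega⟩⟩
  have heQ : e ∉ Q := by
    exact fun h' => (mem_filter.1 h').2.2 ⟨hex, by omega⟩
  have hQD : ∀ e' ∈ insert e Q, e' < M ∧ s₀.arr 22 e' ∈ D := by
    rw [← hq]
    intro e' he'
    simp only [processedEdges, mem_filter, mem_range] at he'
    exact ⟨he'.1, he'.2.1⟩
  set u := s₀.arr 21 e with hu
  have huN : u < N := hsrc e heM
  have hcount : ∀ y, #{e' ∈ insert e Q | s₀.arr 21 e' = y} =
      #{e' ∈ Q | s₀.arr 21 e' = y} + if u = y then 1 else 0 := by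
    intro y
    rw [filter_insert]
    split_ifs with h1
    · exact card_insert_of_notMem fun h2 => heQ (mem_filter.1 h2).1
    · rfl
  have hcnt := h.count
  rw [he, ← hQ] at hcnt
  have hlk : s.arr 26 e = p' := by rw [h.links, hlink e heM, hex]
  have hsp := h.sp_le
  have hfit := h.fits
  have hinD : ∀ y ∈ D, y < N ∧ s.arr 24 y = 1 := fun y hy =>
    ⟨mem_range.1 (h.D_le hy), (h.marked y (mem_range.1 (h.D_le hy))).2 (Or.inl hy)⟩
  have hsrc' : s.arr 21 e = u := by rw [h.src]
  have hp'M : p' ≤ M := (lastEdge_le _ _ _).trans heM.le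
  have hcur : p' ≠ 0 → s₀.arr 22 (p' - 1) = x ∧ x ∈ D := fun h0 => ⟨dst_lastEdge h0, hxD⟩
  have hcard : (insert e Q).card = Q.card + 1 := card_insert_of_notMem heQ
  have ok1 : (Cmd.set 25 (.get 21 (.bin .sub (.var 24) (.lit 1)))).Ok W s := hfit.2 _ _
  have fitp : p' < W := hlk ▸ hfit.2 26 e
  rcases h.bool u huN with hu0 | hu1
  · obtain ⟨hc1, hc2⟩ := hcnt u huN hu0
    have huD : u ∉ D := fun hD => by simp [(hinD u hD).2] at hu0
    have hust : ∀ i < s.reg 23, s.arr 27 i ≠ u := fun i hi hiu => by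
      have := (h.marked u huN).2 (Or.inr ⟨i, hi, hiu⟩)
      omega
    by_cases h1 : s.arr 23 u = 1
    · have ok : processEdge.Ok W s := by
        refine ⟨ok1, ?_, ?_⟩
        · simp only [exec, Expr.eval, Op.eval, State.setReg]; exact hfit.2 _ _
        · simp [exec, Expr.eval, Op.eval, State.setReg, State.setArr, he, hsrc', hlk, hu0, h1, Ok]
          have := hfit.1 23
          -- `D` contains `x`, so `sp_le` leaves room for one more entry on the stack.
          have := card_pos.2 ⟨x, hxD⟩
          omega
      obtain ⟨t, hr, ht⟩ := ok.runs
      have hex' : processEdge.exec s = ⟨Function.update (Function.update (Function.update s.reg 25 u)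
          24 p') 23 (s.reg 23 + 1), Function.update (Function.update (Function.update s.arr 23
          (Function.update (s.arr 23) u 0)) 24 (Function.update (s.arr 24) u 1))
          27 (Function.update (s.arr 27) (s.reg 23) u)⟩ := by
        simp [processEdge, exec, Expr.eval, Op.eval, State.setReg, State.setArr, he, hsrc', hlk, hu0,
          h1]
      have hfit' := hr.fits hfit
      rw [hex'] at hr hfit'
      refine ⟨t, _, hr, ht, by simpa [he, hq, ← hQ] using hcard, ?_⟩
      refine ⟨hfit', ?_, ?_, ?_, h.D_le, ?_, ?_, ?_, ?_, ?_, ?_, ?_, ?_⟩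
      · simpa using h.src
      · simpa using h.heads
      · simpa using h.links
      · intro y hy
        by_cases hyu : y = u
        · simp [hyu]
        · simpa [hyu] using h.bool y hy
      · intro y hy
        by_cases hyu : y = u
        · simp only [hyu]
          simp only [ne_eq, Nat.reduceEqDiff, not_false_eq_true, Function.update_of_ne,
            Function.update_self, true_iff]
          exact Or.inr ⟨s.reg 23, by omega, by simp⟩
        · have := h.marked y hy
          simp only [ne_eq, Nat.reduceEqDiff, not_false_eq_true, Function.update_of_ne,
            Function.update_self, hyu, this]
          refine or_congr_right ⟨?_, ?_⟩
          · rintro ⟨i, hi, hiy⟩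
            exact ⟨i, by omega, by rwa [Function.update_of_ne (by omega)]⟩
          · rintro ⟨i, hi, hiy⟩
            by_cases hi' : i = s.reg 23
            · subst hi'
              simp only [Function.update_self] at hiy
              exact absurd hiy.symm hyu
            · exact ⟨i, by omega, by rwa [Function.update_of_ne hi'] at hiy⟩
      · intro i hi
        simp only [Function.update_self] at hi ⊢
        by_cases hi' : i = s.reg 23
        · subst hi'
          simpa using ⟨huN, huD⟩
        · simpa [hi'] using h.stack i (by omega)
      · intro i hi j hj
        simp only [Function.update_self] at hi hj ⊢
        by_cases hi' : i = s.reg 23 <;> by_cases hj' : j = s.reg 23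
        · omega
        · subst hi'
          simp only [Function.update_self, Function.update_of_ne hj']
          exact fun h' => absurd h'.symm (hust j (by omega))
        · subst hj'
          simp only [Function.update_self, Function.update_of_ne hi']
          exact fun h' => absurd h' (hust i (by omega))
        · simp only [Function.update_of_ne hj', Function.update_of_ne hi']
          exact h.inj i (by omega) j (by omega)
      · intro y hy h0
        by_cases hyu : y = u
        · simp [hyu] at h0
        · have := hcnt y hy (by simpa [hyu] using h0)
          simpa [hyu, hq, hcount, Ne.symm hyu] using this
      · intro y hy h0
        by_cases hyu : y = u
        · subst hyu
          -- The counter was `1`, so the processed edges of `u` together with `e` are exactly `thr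
          -- u` edges. Their targets lie in `D`, thus are marked, thus belong to the closure.
          refine thrClosed_thrClosure u hy ?_
          have h3 := hcount u
          rw [if_pos rfl] at h3
          rw [← hc2, h1, Nat.add_comm, ← h3]
          refine card_le_card fun e' he' => ?_
          simp only [mem_filter, mem_range] at he' ⊢
          obtain ⟨h4, h5⟩ := hQD e' he'.1
          obtain ⟨h6, h7⟩ := hinD _ h5
          exact ⟨h4, he'.2, h.sound _ h6 h7⟩
        · exact h.sound y hy (by simpa [hyu] using h0)
      · simpa using hp'M
      · simpa using hcur
    · have h2 : s.arr 23 u - 1 ≠ 0 := by omega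
      have ok : processEdge.Ok W s := by
        refine ⟨ok1, ?_, ?_⟩
        · simp only [exec, Expr.eval, Op.eval, State.setReg]; exact hfit.2 _ _
        · simp [exec, Expr.eval, Op.eval, State.setReg, State.setArr, he, hsrc', hlk, hu0, h2, Ok,
            skip]
          have := hfit.2 23 u
          have := hfit.1 21
          omega
      obtain ⟨t, hr, ht⟩ := ok.runs
      have hex' : processEdge.exec s = ⟨Function.update (Function.update s.reg 25 u)
          24 p', Function.update s.arr 23 (Function.update (s.arr 23) u (s.arr 23 u - 1))⟩ := by
        simp [processEdge, exec, Expr.eval, Op.eval, State.setReg, State.setArr, he, hsrc', hlk, hu0,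
          h2, skip]
      have hfit' := hr.fits hfit
      rw [hex'] at hr hfit'
      refine ⟨t, _, hr, ht, by simpa [he, hq, ← hQ] using hcard, ?_⟩
      refine ⟨hfit', ?_, ?_, ?_, h.D_le, ?_, ?_, ?_, ?_, ?_, ?_, ?_, ?_⟩
      · simpa using h.src
      · simpa using h.heads
      · simpa using h.links
      · simpa using h.bool
      · simpa using h.marked
      · simpa using h.stack
      · simpa using h.inj
      · intro y hy h0
        have h3 := hcnt y hy (by simpa using h0)
        by_cases hyu : y = u
        · subst hyu
          simp only [Function.update_self, hq, hcount, if_true]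
          omega
        · simpa [hyu, hq, hcount, Ne.symm hyu] using h3
      · simpa using h.sound
      · simpa using hp'M
      · simpa using hcur
  -- A marked source keeps its counter; `count` speaks only of unmarked nodes.
  · have hu2 : s.arr 24 u ≠ 0 := by omega
    have ok : processEdge.Ok W s := by
      refine ⟨ok1, ?_, ?_⟩
      · simp only [exec, Expr.eval, Op.eval, State.setReg]; exact hfit.2 _ _
      · simp [exec, Expr.eval, Op.eval, State.setReg, he, hsrc', hlk, hu2, Ok, skip]
        exact hfit.1 21
    obtain ⟨t, hr, ht⟩ := ok.runs
    have hex' : processEdge.exec s = ⟨Function.update (Function.update s.reg 25 u) 24 p', s.arr⟩ := by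
      simp [processEdge, exec, Expr.eval, Op.eval, State.setReg, he, hsrc', hlk, hu2, skip]
    have hfit' := hr.fits hfit
    rw [hex'] at hr hfit'
    refine ⟨t, _, hr, ht, by simpa [he, hq, ← hQ] using hcard, ?_⟩
    refine ⟨hfit', ?_, ?_, ?_, h.D_le, ?_, ?_, ?_, ?_, ?_, ?_, ?_, ?_⟩
    · simpa using h.src
    · simpa using h.heads
    · simpa using h.links
    · simpa using h.bool
    · simpa using h.marked
    · simpa using h.stack
    · simpa using h.inj
    · intro y hy h0
      have h3 := hcnt y hy (by simpa using h0)
      have hyu : u ≠ y := by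
        rintro rfl
        exact hu2 (by simpa using h0)
      simpa [hq, hcount, hyu] using h3
    · simpa using h.sound
    · simpa using hp'M
    · simpa using hcur

end

-- When the loop ends, the stack and the current list are empty: the marked nodes are `D` and all
-- edges into `D` are processed. An unmarked node has a positive counter, so fewer edges into `D`
-- than its threshold, and `D` is closed; `sound` gives the other inclusion. Each round pops a new
-- node or processes a new edge and costs at most `8 + 2` steps, which explains the factor `10` in
-- the potential.
open Classical in
theorem does_closure {W N M : ℕ} {s : State} (hs : s.Fits W) (hN : s.reg 22 = N)
    (hM : s.reg 20 = M) (hW1 : 1 < W) (hsrc : ∀ e < M, s.arr 21 e < N)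
    (hdst : ∀ e < M, s.arr 22 e < N) :
    closure.Does W s (30 * (N + M) + 20) (fun s' => ∀ y < N, s'.arr 24 y =
      if y ∈ thrClosure N M (s.arr 21) (s.arr 22) (s.arr 23) then 1 else 0) := by
  have hNW : N < W := hN ▸ hs.1 22
  refine ((does_linkEdges hs hN hM hdst).seq (T' := 26 * N + 26 * M + 12) ?_).mono (by omega)
    fun _ _ _ h => h
  intro t1 s1 r1 ⟨h1, h2⟩
  refine ((does_initStack (r1.fits hs) (N := N) ((r1.reg_eq (by decide)).trans hN) hW1).seq
    (T' := 18 * N + 18 * M + 6) ?_).mono (by omega) fun _ _ _ h => h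
  intro t2 s2 r2 ⟨i1, i2, i3, i4⟩
  refine ((Ok.does (c := .set 24 (.lit 0)) (s := s2) (W := W)
    (Q := fun s3 => s3 = s2.setReg 24 0) (by simp only [Ok, Expr.eval]; omega) rfl).seq
      (T' := 10 * N + 10 * M + 1) ?_).mono (by simp [len]; omega) fun _ _ _ h => h
  rintro t3 s3 r3 rfl
  have e21 : s2.arr 21 = s.arr 21 := (r2.arr_eq (by decide)).trans (r1.arr_eq (by decide))
  have e22 : s2.arr 22 = s.arr 22 := (r2.arr_eq (by decide)).trans (r1.arr_eq (by decide))
  have e23 : s2.arr 23 = s.arr 23 := (r2.arr_eq (by decide)).trans (r1.arr_eq (by decide))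
  have e23' : s1.arr 23 = s.arr 23 := r1.arr_eq (by decide)
  have e25 : s2.arr 25 = s1.arr 25 := r2.arr_eq (by decide)
  have e26 : s2.arr 26 = s1.arr 26 := r2.arr_eq (by decide)
  rw [e23'] at i1 i2 i4
  set s3 := s2.setReg 24 0 with hs3
  have hin0 : ∀ y < N, s.arr 23 y = 0 → s2.arr 24 y = 1 := fun y hy h => by simp [i1 y hy, h]
  have hout0 : ∀ y < N, s.arr 23 y ≠ 0 → s2.arr 24 y = 0 := fun y hy h => by simp [i1 y hy, h]
  have inv0 : ClosureInv W N M (s.arr 23) s3 ∅ 0 s3 := by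
    refine ⟨r3.fits (r2.fits (r1.fits hs)), rfl, rfl, rfl, by simp, ?_, ?_, ?_, ?_, ?_, ?_, ?_, ?_⟩
    · intro y hy
      by_cases h : s.arr 23 y = 0
      · exact Or.inr (hin0 y hy h)
      · exact Or.inl (hout0 y hy h)
    · intro y hy
      simp only [hs3, State.setReg, notMem_empty, false_or]
      by_cases h : s.arr 23 y = 0
      · simpa [hin0 y hy h] using i4 y hy h
      · simp only [hout0 y hy h, zero_ne_one, false_iff]
        rintro ⟨i, hi, rfl⟩
        exact h (i2 i (by simpa using hi)).2
    · intro i hi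
      exact ⟨(i2 i (by simpa [hs3, State.setReg] using hi)).1, notMem_empty _⟩
    · intro i hi j hj
      exact i3 i (by simpa [hs3, State.setReg] using hi) j (by simpa [hs3, State.setReg] using hj)
    · intro y hy h
      have h0 : s.arr 23 y ≠ 0 := fun h0 => by
        have := hin0 y hy h0
        simp_all [State.setReg]
      refine ⟨?_, ?_⟩
      · show 0 < s2.arr 23 y
        rw [e23]
        omega
      · show s2.arr 23 y + _ = _
        simp [processedEdges, e23]
    · intro y hy h
      have h0 : s.arr 23 y = 0 := by
        by_contra h0
        have := hout0 y hy h0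
        simp_all [State.setReg]
      exact thrClosed_thrClosure y hy (by omega)
    · simp [hs3, State.setReg]
    · simp [hs3, State.setReg]
  have hlast : ∀ y < N, s3.arr 25 y = lastEdge (s3.arr 22) y M := by
    intro y hy
    show s2.arr 25 y = lastEdge (s2.arr 22) y M
    rw [e25, e22, h1 y hy]
  have hlink : ∀ e < M, s3.arr 26 e = lastEdge (s3.arr 22) (s3.arr 22 e) e := by
    intro e he
    show s2.arr 26 e = lastEdge (s2.arr 22) (s2.arr 22 e) e
    rw [e26, e22, h2 e he]
  have hsrc3 : ∀ e < M, s3.arr 21 e < N := by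
    intro e he
    show s2.arr 21 e < N
    rw [e21]
    exact hsrc e he
  have hQM : ∀ D x p, (processedEdges M (s3.arr 22) D x p).card ≤ M := fun D x p =>
    (card_filter_le _ _).trans (card_range M).le
  have key := does_while (W := W) (e := .bin .add (.var 23) (.var 24))
    (c := .ite (.var 24) processEdge popNode)
    (fun k s' => ∃ D x, ClosureInv W N M (s.arr 23) s3 D x s' ∧
      k = 10 * ((N - D.card) + (M - (processedEdges M (s3.arr 22) D x (s'.reg 24)).card)))
    ?_ (s := s3) ⟨∅, 0, inv0, rfl⟩
  · refine key.mono ?_ ?_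
    · omega
    · rintro t s' - ⟨⟨_, D, x, inv, -⟩, he⟩ y hy
      -- The test is a sum of naturals, so its failure makes both summands vanish.
      simp only [Expr.eval, Op.eval, Nat.add_eq_zero_iff] at he
      obtain ⟨h23, h24⟩ := he
      have hsound := inv.sound y hy
      have hmk : ∀ y < N, s'.arr 24 y = 1 ↔ y ∈ D := fun y hy => by simp [inv.marked y hy, h23]
      have a21 : s3.arr 21 = s.arr 21 := e21
      have a22 : s3.arr 22 = s.arr 22 := e22
      rw [a21, a22] at hsound
      have hcl : ThrClosed N M (s.arr 21) (s.arr 22) (s.arr 23) {y | y ∈ D} := by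
        intro z hz hle
        by_contra hzD
        have hz0 := (inv.bool z hz).resolve_right fun h => hzD ((hmk z hz).1 h)
        obtain ⟨c1, c2⟩ := inv.count z hz hz0
        refine absurd (hle.trans_eq (?_ : _ = #{e ∈ processedEdges M (s3.arr 22) D x (s'.reg 24) |
          s3.arr 21 e = z})) (by omega)
        rw [h24, a21, a22, processedEdges, filter_filter]
        congr 1
        ext e
        simp [and_comm]
      by_cases hy1 : s'.arr 24 y = 1
      · rw [if_pos (hsound hy1), hy1]
      · rw [if_neg fun hmem => hy1 ((hmk y hy).2 (hmem.2 _ hcl)), (inv.bool y hy).resolve_right hy1]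
  · rintro k s' ⟨D, x, inv, rfl⟩ he
    by_cases hp : s'.reg 24 = 0
    · simp only [Expr.eval, Op.eval, hp, add_zero] at he
      obtain ⟨t, s'', hr, ht, x', hx', hQ, inv'⟩ := does_popNode hlast inv hp he
      refine ⟨_, s'', _, .ite_false _ _ _ _ _ _ hp hr, ⟨_, _, inv', rfl⟩, ?_⟩
      rw [hQ, card_insert_of_notMem hx']
      have := inv.sp_le
      omega
    · obtain ⟨t, s'', hr, ht, hQ, inv'⟩ := does_processEdge hsrc3 hlink hW1 hNW inv hp
      refine ⟨_, s'', _, .ite_true _ _ _ _ _ _ hp hr, ⟨_, _, inv', rfl⟩, ?_⟩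
      have := hQM D x (s''.reg 24)
      omega

end Cmd

/-! ### The measure on plays -/

namespace MDP

open Preorder

variable {P : MDP} (σ : P.Strategy) (v₀ : Fin P.n)

instance : IsProbabilityMeasure (P.pr σ v₀) := by
  unfold pr; infer_instance

/-- The trajectory kernel started from the law of the history is projected to one more coordinate.
Both `ae_pr_of_ae_step` and `pr_cyl_inter` rest on this. -/
theorem map_pr_eq_compProd (t : ℕ) :
    (P.pr σ v₀).map (fun ω => ((frestrictLe t ω : P.History t), ω (t + 1))) =
      ((P.pr σ v₀).map (frestrictLe t)) ⊗ₘ (P.stepKernel σ t) := by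
  have h1 := Kernel.partialTraj_compProd_traj (X := fun _ => Fin P.n) (κ := P.stepKernel σ)
    (Nat.zero_le t) (fun _ => v₀)
  have h2 : (P.pr σ v₀).map (frestrictLe t) =
      Kernel.partialTraj (X := fun _ => Fin P.n) (P.stepKernel σ) 0 t (fun _ => v₀) :=
    Kernel.traj_map_frestrictLe_apply (X := fun _ => Fin P.n) (κ := P.stepKernel σ) 0 t _
  rw [h2, ← Kernel.map_traj_succ_self (X := fun _ => Fin P.n) (κ := P.stepKernel σ) (a := t),
    Measure.compProd_map (by fun_prop), h1, Measure.map_map (by fun_prop) (by fun_prop)]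
  rfl

theorem pr_zero : ∀ᵐ ω ∂P.pr σ v₀, ω 0 = v₀ := by
  have h2 : (P.pr σ v₀).map (frestrictLe 0) =
      Kernel.partialTraj (X := fun _ => Fin P.n) (P.stepKernel σ) 0 0 (fun _ => v₀) :=
    Kernel.traj_map_frestrictLe_apply (X := fun _ => Fin P.n) (κ := P.stepKernel σ) 0 0 _
  rw [Kernel.partialTraj_self, Kernel.id_apply] at h2
  have h3 : ∀ᵐ h ∂(P.pr σ v₀).map (frestrictLe 0), h = fun _ => v₀ := by
    rw [h2]
    exact ae_dirac_iff (by exact MeasurableSet.of_discrete) |>.2 rfl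
  have h4 := ae_of_ae_map (by fun_prop) h3
  filter_upwards [h4] with ω h
  exact congrFun h ⟨0, Finset.mem_Iic.2 le_rfl⟩

theorem ae_pr_of_ae_step {t : ℕ} {Q : P.History t → Fin P.n → Prop}
    (hQ : ∀ h, ∀ᵐ w ∂P.stepMeasure σ t h, Q h w) :
    ∀ᵐ ω ∂P.pr σ v₀, Q (frestrictLe t ω) (ω (t + 1)) := by
  have h1 : ∀ᵐ x ∂((P.pr σ v₀).map (frestrictLe t)) ⊗ₘ (P.stepKernel σ t), Q x.1 x.2 :=
    (Measure.ae_compProd_iff (MeasurableSet.of_discrete)).2 (ae_of_all _ hQ)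
  rw [← map_pr_eq_compProd] at h1
  have hm : Measurable fun ω : ℕ → Fin P.n => ((frestrictLe t ω : P.History t), ω (t + 1)) := by
    fun_prop
  exact ae_of_ae_map hm.aemeasurable h1

/-- The plays that agree with `ω` up to the time `t`. -/
def cyl (P : MDP) (ω : ℕ → Fin P.n) (t : ℕ) : Set (ℕ → Fin P.n) := {ω' | ∀ i ≤ t, ω' i = ω i}

theorem cyl_eq_preimage (ω : ℕ → Fin P.n) (t : ℕ) :
    P.cyl ω t = frestrictLe (π := fun _ => Fin P.n) t ⁻¹' {frestrictLe t ω} := by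
  ext ω'
  simp only [cyl, Set.mem_ofPred_eq, Set.mem_preimage, Set.mem_singleton_iff, funext_iff,
    Subtype.forall, Finset.mem_Iic]
  rfl

theorem cyl_subset_cyl {ω ω' : ℕ → Fin P.n} {t t' : ℕ} (h : ω' ∈ P.cyl ω t) (ht : t ≤ t') :
    P.cyl ω' t' ⊆ P.cyl ω t := fun _ h'' i hi => (h'' i (hi.trans ht)).trans (h i hi)

/-- For each `t` there are only finitely many histories, so those of probability zero form a null
set together. -/
theorem ae_cyl_pos : ∀ᵐ ω ∂P.pr σ v₀, ∀ t, 0 < P.pr σ v₀ (P.cyl ω t) := by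
  rw [ae_all_iff]
  intro t
  have h : ∀ᵐ h ∂(P.pr σ v₀).map (frestrictLe t), (P.pr σ v₀).map (frestrictLe t) {h} ≠ 0 := by
    rw [ae_iff_of_countable]
    exact fun x h => h
  filter_upwards [ae_of_ae_map (by fun_prop) h] with ω hω
  rw [Measure.map_apply (by fun_prop) MeasurableSet.of_discrete] at hω
  rw [cyl_eq_preimage]
  exact pos_iff_ne_zero.2 hω

theorem pr_cyl_inter (ω : ℕ → Fin P.n) (t : ℕ) (w : Fin P.n) :
    P.pr σ v₀ (P.cyl ω t ∩ {ω' | ω' (t + 1) = w}) =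
      P.stepMeasure σ t (frestrictLe t ω) {w} * P.pr σ v₀ (P.cyl ω t) := by
  have h := congrArg (fun μ => μ ({(frestrictLe t ω : P.History t)} ×ˢ {w}))
    (map_pr_eq_compProd σ v₀ t)
  rw [Measure.map_apply (by fun_prop) MeasurableSet.of_discrete, Measure.compProd_apply_prod
    MeasurableSet.of_discrete MeasurableSet.of_discrete, lintegral_singleton,
    Measure.map_apply (by fun_prop) MeasurableSet.of_discrete, ← cyl_eq_preimage] at h
  rw [← show P.stepKernel σ t (frestrictLe t ω) = P.stepMeasure σ t (frestrictLe t ω) from rfl, ← h,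
    cyl_eq_preimage]
  rfl

theorem stepMeasure_random {t : ℕ} {h : P.History t} (hv : h.last ∈ P.VR) :
    P.stepMeasure σ t h = (P.δ ⟨h.last, hv⟩).toMeasure := by
  simp [stepMeasure, hv]

theorem stepMeasure_player {t : ℕ} {h : P.History t} (hv : h.last ∉ P.VR) :
    P.stepMeasure σ t h = Measure.dirac (σ.next t h) := by
  simp [stepMeasure, hv]

theorem ae_mem_plays : ∀ᵐ ω ∂P.pr σ v₀, ω ∈ P.plays := by
  simp only [plays, Set.mem_ofPred_eq]
  rw [ae_all_iff]
  intro t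
  refine ae_pr_of_ae_step σ v₀ (Q := fun h w => w ∈ P.succ h.last) fun h => ?_
  by_cases hv : h.last ∈ P.VR
  · rw [stepMeasure_random σ hv, ae_iff_of_countable]
    intro w hw
    rw [PMF.toMeasure_apply_singleton _ _ MeasurableSet.of_discrete] at hw
    exact (P.mem_succ_iff ⟨_, hv⟩ w).2 (pos_iff_ne_zero.2 hw)
  · rw [stepMeasure_player σ hv]
    exact (ae_dirac_iff MeasurableSet.of_discrete).2 (σ.legal t h hv)

theorem ae_follows : ∀ᵐ ω ∂P.pr σ v₀, ∀ t, ω t ∉ P.VR →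
    ω (t + 1) = σ.next t (frestrictLe t ω) := by
  rw [ae_all_iff]
  intro t
  refine ae_pr_of_ae_step σ v₀ (Q := fun h w => h.last ∉ P.VR → w = σ.next t h) fun h => ?_
  by_cases hv : h.last ∈ P.VR
  · exact ae_of_all _ fun w hw => absurd hv hw
  · rw [stepMeasure_player σ hv]
    exact (ae_dirac_iff MeasurableSet.of_discrete).2 fun _ => rfl

/-- Almost surely, all successors of a random vertex that occurs infinitely often occur infinitely
often. -/
theorem ae_succ_mem_inf (v w : Fin P.n) (hv : v ∈ P.VR) (hw : w ∈ P.succ v) :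
    ∀ᵐ ω ∂P.pr σ v₀, v ∈ P.inf ω → w ∈ P.inf ω := by
  -- The event that the edge from `v` to `w` is taken just before time `t`. The truncated `t - 1` at
  -- `t = 0` is harmless: only the events `s (k + 1)` enter the sums, and only infinite recurrence
  -- matters.
  set s : ℕ → Set (ℕ → Fin P.n) := fun t => {ω | ω (t - 1) = v ∧ ω t = w} with hs
  have hmeas : ∀ t, MeasurableSet[Filtration.piLE (X := fun _ : ℕ => Fin P.n) t] (s t) := by
    intro t
    have h : s t = restrictLe (π := fun _ => Fin P.n) t ⁻¹'
        {h | h ⟨t - 1, by simp⟩ = v ∧ h ⟨t, by simp⟩ = w} := rfl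
    rw [h]
    exact ⟨_, MeasurableSet.of_discrete, rfl⟩
  set p : ℝ := (P.δ ⟨v, hv⟩ w).toReal with hp
  have hp0 : 0 < p :=
    ENNReal.toReal_pos ((P.mem_succ_iff ⟨v, hv⟩ w).1 hw).ne' (PMF.apply_ne_top _ _)
  -- Given the first `k` steps, the edge is taken next with probability `p` if the play is at `v`,
  -- and with probability `0` otherwise.
  have hcond : ∀ᵐ ω ∂P.pr σ v₀, ∀ k, ((P.pr σ v₀)[(s (k + 1)).indicator (1 : (ℕ → Fin P.n) → ℝ) |
      Filtration.piLE (X := fun _ : ℕ => Fin P.n) k]) ω = if ω k = v then p else 0 := by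
    rw [ae_all_iff]
    intro k
    have hm : MeasurableSet (s (k + 1)) := Filtration.le _ _ _ (hmeas (k + 1))
    have hint : Integrable ((s (k + 1)).indicator (1 : (ℕ → Fin P.n) → ℝ)) (P.pr σ v₀) :=
      (integrable_const 1).indicator hm
    have h1 := Kernel.condExp_traj (X := fun _ => Fin P.n) (κ := P.stepKernel σ) (Nat.zero_le k)
      (x₀ := fun _ => v₀) hint
    filter_upwards [h1] with ω hω
    refine hω.trans ?_
    rw [integral_indicator_one hm]
    have h2 : ∀ᵐ ω' ∂Kernel.traj (X := fun _ => Fin P.n) (P.stepKernel σ) k (frestrictLe k ω),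
        ω' k = ω k := by
      have h3 := Kernel.traj_map_frestrictLe_apply (X := fun _ => Fin P.n) (κ := P.stepKernel σ) k k
        (frestrictLe k ω)
      rw [Kernel.partialTraj_self, Kernel.id_apply] at h3
      have h4 : ∀ᵐ h ∂(Kernel.traj (X := fun _ => Fin P.n) (P.stepKernel σ) k
          (frestrictLe k ω)).map (frestrictLe k), h = frestrictLe k ω := by
        rw [h3]
        exact (ae_dirac_iff (by exact MeasurableSet.of_discrete)).2 rfl
      filter_upwards [ae_of_ae_map (by fun_prop) h4] with ω' h
      exact congrFun h ⟨k, Finset.mem_Iic.2 le_rfl⟩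
    by_cases hk : ω k = v
    · rw [if_pos hk]
      have h5 : Kernel.traj (X := fun _ => Fin P.n) (P.stepKernel σ) k (frestrictLe k ω) (s (k + 1)) =
          P.stepKernel σ k (frestrictLe k ω) {w} := by
        conv_rhs => rw [← Kernel.map_traj_succ_self (X := fun _ => Fin P.n) (κ := P.stepKernel σ)
          (a := k)]
        rw [Kernel.map_apply' _ (by fun_prop) _ MeasurableSet.of_discrete]
        refine measure_congr ?_
        filter_upwards [h2] with ω' h
        apply propext
        simp only [hs]
        exact ⟨fun h' => h'.2, fun h' => ⟨h.trans hk, h'⟩⟩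
      have hl : History.last (P := P) (frestrictLe k ω) ∈ P.VR := by
        show ω k ∈ P.VR
        rwa [hk]
      rw [Measure.real, h5, show P.stepKernel σ k (frestrictLe k ω) =
        P.stepMeasure σ k (frestrictLe k ω) from rfl, stepMeasure_random σ hl,
        PMF.toMeasure_apply_singleton _ _ MeasurableSet.of_discrete, hp]
      congr 4
    · rw [if_neg hk, Measure.real]
      have h5 : Kernel.traj (X := fun _ => Fin P.n) (P.stepKernel σ) k (frestrictLe k ω) (s (k + 1)) =
          0 := by
        rw [measure_eq_zero_iff_ae_notMem]
        filter_upwards [h2] with ω' h h'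
        exact hk (h.symm.trans h'.1)
      rw [h5, ENNReal.toReal_zero]
  filter_upwards [hcond, ae_mem_limsup_atTop_iff (P.pr σ v₀) hmeas] with ω h1 h2 hinf
  -- Each of the infinitely many visits of `v` contributes `p`, so the conditional probabilities
  -- have a divergent sum and Lévy's form of Borel–Cantelli applies.
  have h3 : Tendsto (fun n => ∑ k ∈ Finset.range n, (if ω k = v then p else 0)) atTop atTop := by
    rw [← not_summable_iff_tendsto_nat_atTop_of_nonneg fun k => by split_ifs <;> [exact hp0.le; rfl]]
    intro hsum
    have h4 := hsum.tendsto_atTop_zero.eventually (gt_mem_nhds hp0)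
    obtain ⟨k, hk1, hk2⟩ := (hinf.and_eventually h4).exists
    simp [hk1] at hk2
  have h4 : ω ∈ limsup s atTop := by
    rw [h2]
    simpa only [h1] using h3
  rw [mem_limsup_iff_frequently_mem] at h4
  exact h4.mono fun t ht => ht.2

/-! ### Measurability of objectives -/

theorem measurableSet_plays : MeasurableSet P.plays := by
  simp only [plays, Set.ofPred_forall]
  refine MeasurableSet.iInter fun i => ?_
  have : {ω : ℕ → Fin P.n | ω (i + 1) ∈ P.succ (ω i)} =
    (fun ω => (ω i, ω (i + 1))) ⁻¹' {x | x.2 ∈ P.succ x.1} := rfl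
  rw [this]
  exact (by fun_prop : Measurable fun ω : ℕ → Fin P.n => (ω i, ω (i + 1))) MeasurableSet.of_discrete

theorem measurableSet_mem_inf (v : Fin P.n) : MeasurableSet {ω | v ∈ P.inf ω} := by
  have : {ω | v ∈ P.inf ω} = limsup (fun i => {ω : ℕ → Fin P.n | ω i = v}) atTop := by
    ext ω
    rw [mem_limsup_iff_frequently_mem]
    rfl
  rw [this]
  refine MeasurableSet.measurableSet_limsup fun i => ?_
  exact (measurable_pi_apply i : Measurable fun ω : ℕ → Fin P.n => ω i)
    (MeasurableSet.of_discrete (s := {v}))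

/-- There are finitely many possible values of `inf ω`, so every condition on it is a countable
union of events that prescribe the value. -/
theorem measurableSet_inf (Q : Set (Fin P.n) → Prop) : MeasurableSet {ω | Q (P.inf ω)} := by
  have : {ω | Q (P.inf ω)} = ⋃ X ∈ {X | Q X}, ⋂ v, {ω | v ∈ P.inf ω ↔ v ∈ X} := by
    ext ω
    simp only [Set.mem_ofPred_eq, Set.mem_iUnion, Set.mem_iInter, exists_prop]
    exact ⟨fun h => ⟨_, h, fun _ => Iff.rfl⟩, fun ⟨X, h, h'⟩ => by rwa [Set.ext h']⟩
  rw [this]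
  refine MeasurableSet.biUnion (Set.to_countable _) fun X _ => MeasurableSet.iInter fun v => ?_
  by_cases hv : v ∈ X
  · simpa [hv] using measurableSet_mem_inf v
  · have : {ω | v ∈ P.inf ω ↔ v ∈ X} = {ω | v ∈ P.inf ω}ᶜ := by
      ext ω
      simp [hv]
    rw [this]
    exact (measurableSet_mem_inf v).compl

end MDP

/-! ### End-components -/

namespace MDP

variable {P : MDP}

/-- `b` is a successor of `a` and both belong to `X`. -/
def EdgeIn (P : MDP) (X : Finset (Fin P.n)) (a b : Fin P.n) : Prop := a ∈ X ∧ b ∈ X ∧ b ∈ P.succ a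

theorem IsEndComponent.nonempty {X : Finset (Fin P.n)} (h : P.IsEndComponent X) : X.Nonempty := by
  obtain ⟨u, hu, -⟩ := h.2.2
  exact ⟨u, hu⟩

theorem mem_of_reflTransGen {α : Type*} {r : α → α → Prop} {p : α → Prop} {a b : α}
    (h : Relation.ReflTransGen r a b) (hp : ∀ x y, p x → r x y → p y) (ha : p a) : p b := by
  induction h with
  | refl => exact ha
  | tail _ h ih => exact hp _ _ ih h

theorem IsEndComponent.exists_succ_mem {X : Finset (Fin P.n)} (h : P.IsEndComponent X)
    {v : Fin P.n} (hv : v ∈ X) : ∃ w ∈ X, w ∈ P.succ v := by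
  obtain ⟨u, hu, w, hw, huw⟩ := h.2.2
  rcases (h.1 v hv u hu).cases_head with rfl | ⟨c, hc, -⟩
  · exact ⟨w, hw, huw⟩
  · exact ⟨c, hc.2.1, hc.2.2⟩

/-- All connections are routed through the common vertex. This is why distinct MECs are disjoint. -/
theorem IsEndComponent.union {X Y : Finset (Fin P.n)} (hX : P.IsEndComponent X)
    (hY : P.IsEndComponent Y) {v : Fin P.n} (hvX : v ∈ X) (hvY : v ∈ Y) :
    P.IsEndComponent (X ∪ Y) := by
  have key : ∀ a ∈ X ∪ Y, Relation.ReflTransGen (P.EdgeIn (X ∪ Y)) a v ∧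
      Relation.ReflTransGen (P.EdgeIn (X ∪ Y)) v a := by
    have mono : ∀ {Z : Finset (Fin P.n)} {a b}, Z ⊆ X ∪ Y → Relation.ReflTransGen (P.EdgeIn Z) a b →
        Relation.ReflTransGen (P.EdgeIn (X ∪ Y)) a b := fun hZ h =>
      Relation.ReflTransGen.mono (fun a b hab => ⟨hZ hab.1, hZ hab.2.1, hab.2.2⟩) _ _ h
    intro a ha
    rcases mem_union.1 ha with h | h
    · exact ⟨mono subset_union_left (hX.1 a h v hvX), mono subset_union_left (hX.1 v hvX a h)⟩
    · exact ⟨mono subset_union_right (hY.1 a h v hvY), mono subset_union_right (hY.1 v hvY a h)⟩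
  refine ⟨fun a ha b hb => (key a ha).1.trans (key b hb).2, fun a ha haR => ?_, ?_⟩
  · rcases mem_union.1 ha with h | h
    · exact (hX.2.1 a h haR).trans subset_union_left
    · exact (hY.2.1 a h haR).trans subset_union_right
  · obtain ⟨a, ha, b, hb, hab⟩ := hX.2.2
    exact ⟨a, mem_union_left _ ha, b, mem_union_left _ hb, hab⟩

theorem IsEndComponent.exists_isMEC {X : Finset (Fin P.n)} (hX : P.IsEndComponent X) :
    ∃ M, P.IsMEC M ∧ X ⊆ M := by
  obtain ⟨M, h1, h2⟩ := (Set.toFinite {X | P.IsEndComponent X}).exists_le_maximal hX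
  exact ⟨M, h2, h1⟩

theorem IsMEC.subset_of_mem {M X : Finset (Fin P.n)} (hM : P.IsMEC M) (hX : P.IsEndComponent X)
    {v : Fin P.n} (hv : v ∈ M) (hv' : v ∈ X) : X ⊆ M :=
  subset_union_right.trans (hM.2 (hM.1.union hX hv hv') subset_union_left)

theorem IsMEC.eq_of_mem {M M' : Finset (Fin P.n)} (hM : P.IsMEC M) (hM' : P.IsMEC M')
    {v : Fin P.n} (hv : v ∈ M) (hv' : v ∈ M') : M = M' :=
  (hM'.subset_of_mem hM.1 hv' hv).antisymm (hM.subset_of_mem hM'.1 hv hv')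

/-- A nonempty set that player 1 can stay in contains an end-component. -/
theorem exists_isEndComponent_subset {X : Finset (Fin P.n)} (hne : X.Nonempty)
    (hR : ∀ v ∈ X, v ∈ P.VR → P.succ v ⊆ X) (hX : ∀ v ∈ X, ∃ w ∈ X, w ∈ P.succ v) :
    ∃ Y ⊆ X, P.IsEndComponent Y := by
  classical
  let R : Fin P.n → Finset (Fin P.n) := fun v =>
    {w | w ∈ X ∧ Relation.ReflTransGen (P.EdgeIn X) v w}
  have hRdef : ∀ v w, w ∈ R v ↔ w ∈ X ∧ Relation.ReflTransGen (P.EdgeIn X) v w := by simp [R]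
  -- A smallest set of reachable vertices is a bottom strongly connected component.
  obtain ⟨v, hv, hmin⟩ := X.exists_min_image (fun v => (R v).card) hne
  have hback : ∀ u ∈ R v, R u = R v := fun u hu => by
    refine eq_of_subset_of_card_le (fun w hw => ?_) (hmin u ((hRdef _ _).1 hu).1)
    rw [hRdef] at hu hw ⊢
    exact ⟨hw.1, hu.2.trans hw.2⟩
  have hself : ∀ u ∈ X, u ∈ R u := fun u hu => (hRdef _ _).2 ⟨hu, .refl⟩
  have hstep : ∀ u ∈ R v, ∀ w ∈ X, w ∈ P.succ u → w ∈ R v := fun u hu w hw huw => by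
    rw [hRdef] at hu ⊢
    exact ⟨hw, hu.2.tail ⟨hu.1, hw, huw⟩⟩
  refine ⟨R v, fun w hw => ((hRdef _ _).1 hw).1, fun a ha b hb => ?_, fun a ha haR w hw => ?_, ?_⟩
  · rw [← hback a ha, hRdef] at hb
    have key : ∀ b, Relation.ReflTransGen (P.EdgeIn X) a b → b ∈ R v ∧
        Relation.ReflTransGen (P.EdgeIn (R v)) a b := by
      intro b h
      induction h with
      | refl => exact ⟨ha, .refl⟩
      | tail _ h ih =>
        have := hstep _ ih.1 _ h.2.1 h.2.2
        exact ⟨this, ih.2.tail ⟨ih.1, this, h.2.2⟩⟩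
    exact (key b hb.2).2
  · exact hstep a ha w (hR a ((hRdef _ _).1 ha).1 haR hw) hw
  · obtain ⟨w, hw, hvw⟩ := hX v hv
    exact ⟨v, hself v hv, w, hstep v (hself v hv) w hw hvw, hvw⟩

/-! #### The vertices that occur infinitely often -/

theorem inf_nonempty (ω : ℕ → Fin P.n) : (P.inf ω).Nonempty := by
  obtain ⟨v, hv⟩ := Finite.exists_infinite_fiber ω
  exact ⟨v, Nat.frequently_atTop_iff_infinite.2 (Set.infinite_coe_iff.1 hv)⟩

theorem eventually_mem_inf (ω : ℕ → Fin P.n) : ∀ᶠ t in atTop, ω t ∈ P.inf ω := by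
  have h : ∀ v, ∀ᶠ t in atTop, v ∉ P.inf ω → ω t ≠ v := fun v => by
    by_cases hv : v ∈ P.inf ω
    · exact Eventually.of_forall fun t h => absurd hv h
    · filter_upwards [not_frequently.1 hv] with t ht _ using ht
  filter_upwards [eventually_all.2 h] with t ht
  by_contra hc
  exact ht _ hc rfl

/-- Between any two vertices that occur infinitely often there is a path through such vertices that
uses only edges with a property that all edges of the play eventually have. -/
theorem reflTransGen_inf {ω : ℕ → Fin P.n} {r : Fin P.n → Fin P.n → Prop}
    (hr : ∀ t, r (ω t) (ω (t + 1))) {u v : Fin P.n} (hu : u ∈ P.inf ω) (hv : v ∈ P.inf ω) :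
    Relation.ReflTransGen (fun a b => a ∈ P.inf ω ∧ b ∈ P.inf ω ∧ r a b) u v := by
  obtain ⟨T, hT⟩ := eventually_atTop.1 (eventually_mem_inf ω)
  obtain ⟨t, ht, rfl⟩ := frequently_atTop.1 hu T
  obtain ⟨t', ht', rfl⟩ := frequently_atTop.1 hv t
  clear hu hv
  induction t', ht' using Nat.le_induction with
  | base => exact .refl
  | succ k hk ih => exact ih.tail ⟨hT _ (by omega), hT _ (by omega), hr k⟩

/-- Strong connectivity holds for every single play. Closure under the edges of random vertices is
the part that holds only almost surely. -/
theorem ae_isEndComponent_inf (σ : P.Strategy) (v₀ : Fin P.n) :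
    ∀ᵐ ω ∂P.pr σ v₀, ∃ X : Finset (Fin P.n), ↑X = P.inf ω ∧ P.IsEndComponent X := by
  have h : ∀ᵐ ω ∂P.pr σ v₀, ∀ v w, v ∈ P.VR → w ∈ P.succ v → v ∈ P.inf ω → w ∈ P.inf ω := by
    simp only [ae_all_iff]
    exact ae_succ_mem_inf σ v₀
  filter_upwards [h, ae_mem_plays σ v₀] with ω h1 h2
  classical
  have hmem : ∀ v, v ∈ (P.inf ω).toFinset ↔ v ∈ P.inf ω := fun v => Set.mem_toFinset
  refine ⟨(P.inf ω).toFinset, by simp, fun u hu v hv => ?_, fun v hv hR w hw => ?_, ?_⟩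
  · rw [hmem] at hu hv
    simp only [hmem]
    exact reflTransGen_inf (r := fun a b => b ∈ P.succ a) h2 hu hv
  · rw [hmem] at hv ⊢
    exact h1 v w hR hw hv
  · obtain ⟨T, hT⟩ := eventually_atTop.1 (eventually_mem_inf ω)
    exact ⟨ω T, (hmem _).2 (hT T le_rfl), ω (T + 1), (hmem _).2 (hT _ (by omega)), h2 T⟩

/-! ### The losing vertices -/

/-- A set of vertices is closed if player 1 cannot avoid it outside of it; in a maximal
end-component `M` player 1 is able to stay forever, and this does not avoid the set if `M` is
bad. -/
structure LoseClosed (P : MDP) (bad : Finset (Fin P.n) → Prop) (S : Set (Fin P.n)) : Prop where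
  random : ∀ v ∈ P.VR, ∀ w ∈ P.succ v, w ∈ S → v ∈ S
  player : ∀ v ∉ P.VR, (∀ M, P.IsMEC M → v ∉ M) → (∀ w ∈ P.succ v, w ∈ S) → v ∈ S
  mec : ∀ M, P.IsMEC M → bad M → (∀ u ∈ M, ∀ w ∈ P.succ u, w ∉ M → w ∈ S) → ∀ u ∈ M, u ∈ S

/-- The least closed set. -/
def lose (P : MDP) (bad : Finset (Fin P.n) → Prop) : Set (Fin P.n) :=
  {v | ∀ S, P.LoseClosed bad S → v ∈ S}

variable {bad : Finset (Fin P.n) → Prop}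

theorem loseClosed_lose : P.LoseClosed bad (P.lose bad) :=
  ⟨fun v hv w hw h S hS => hS.random v hv w hw (h S hS),
    fun v hv hM h S hS => hS.player v hv hM fun w hw => h w hw S hS,
    fun M hM hb h u hu S hS => hS.mec M hM hb (fun u hu w hw hwM => h u hu w hw hwM S hS) u hu⟩

/-- The losing vertices whose MEC is entirely losing already form a closed set: edges of random
vertices do not leave a MEC, the player rule skips MECs, and the MEC rule adds a MEC as a whole. -/
theorem IsMEC.mem_lose {M : Finset (Fin P.n)} (hM : P.IsMEC M) {u v : Fin P.n} (hu : u ∈ M)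
    (hv : v ∈ M) (h : u ∈ P.lose bad) : v ∈ P.lose bad := by
  suffices hS : P.LoseClosed bad {x | x ∈ P.lose bad ∧
      ∀ M, P.IsMEC M → x ∈ M → ∀ y ∈ M, y ∈ P.lose bad} from (h _ hS).2 M hM hu v hv
  refine ⟨?_, ?_, ?_⟩
  · rintro x hx w hw ⟨h1, h2⟩
    exact ⟨loseClosed_lose.random x hx w hw h1, fun M hM hxM =>
      h2 M hM (hM.1.2.1 x hxM hx hw)⟩
  · intro x hx hxM h
    exact ⟨loseClosed_lose.player x hx hxM fun w hw => (h w hw).1, fun M hM h => absurd h (hxM M hM)⟩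
  · intro M hM hb h x hx
    have := loseClosed_lose.mec M hM hb fun u hu w hw hwM => (h u hu w hw hwM).1
    refine ⟨this x hx, fun M' hM' hx' => ?_⟩
    rw [← hM.eq_of_mem hM' hx hx']
    exact this

/-- The complement of a good MEC is closed: its random vertices have no exits, and neither of the
other two rules applies to it. -/
theorem IsMEC.notMem_lose {M : Finset (Fin P.n)} (hM : P.IsMEC M) (hb : ¬bad M) {v : Fin P.n}
    (hv : v ∈ M) : v ∉ P.lose bad := by
  intro h
  suffices hS : P.LoseClosed bad {x | x ∉ M} from h _ hS hv
  refine ⟨?_, ?_, ?_⟩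
  · exact fun x hx w hw hwM hxM => hwM (hM.1.2.1 x hxM hx hw)
  · exact fun x hx hxM h => hxM M hM
  · intro M' hM' hb' h x hx hxM
    exact hb (hM'.eq_of_mem hM hx hxM ▸ hb')

/-- The end-components that are marked as good may be replaced by those that meet a set `G`. -/
theorem lose_congr {bad' : Finset (Fin P.n) → Prop}
    (h1 : ∀ M, P.IsMEC M → bad' M → bad M)
    (h2 : ∀ M, P.IsMEC M → ¬bad' M → ∃ v ∈ M, v ∉ P.lose bad) : P.lose bad' = P.lose bad := by
  refine Set.Subset.antisymm (fun v hv => hv _ ?_) fun v hv S hS => ?_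
  · exact ⟨loseClosed_lose.random, loseClosed_lose.player, fun M hM hb =>
      loseClosed_lose.mec M hM (h1 M hM hb)⟩
  -- Intersecting with `lose bad` makes the MEC rule usable: a bad MEC whose exits lie in the
  -- intersection is contained in `lose bad`, which `h2` forbids unless it satisfies `bad'`; and
  -- then the closedness of `S` applies.
  · suffices hS' : P.LoseClosed bad {x | x ∈ S ∧ x ∈ P.lose bad} from (hv _ hS').1
    refine ⟨?_, ?_, ?_⟩
    · exact fun x hx w hw h => ⟨hS.random x hx w hw h.1, loseClosed_lose.random x hx w hw h.2⟩
    · exact fun x hx hxM h => ⟨hS.player x hx hxM fun w hw => (h w hw).1,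
        loseClosed_lose.player x hx hxM fun w hw => (h w hw).2⟩
    · intro M hM hb h x hx
      have hl := loseClosed_lose.mec M hM hb fun u hu w hw hwM => (h u hu w hw hwM).2
      refine ⟨hS.mec M hM ?_ (fun u hu w hw hwM => (h u hu w hw hwM).1) x hx, hl x hx⟩
      by_contra hb'
      obtain ⟨v, hv, hv'⟩ := h2 M hM hb'
      exact hv' (hl v hv)

/-! ### Objectives that depend on the vertices that occur infinitely often -/

/-- The plays `ω` such that `good` holds for the set `inf ω`. -/
def infObjective (P : MDP) (good : Set (Fin P.n) → Prop) : Set (ℕ → Fin P.n) :=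
  {ω ∈ P.plays | good (P.inf ω)}

/-- No end-component inside `M` is good. -/
def NoGood (P : MDP) (good : Set (Fin P.n) → Prop) (M : Finset (Fin P.n)) : Prop :=
  ∀ X ⊆ M, P.IsEndComponent X → ¬good ↑X

theorem measurableSet_infObjective (good : Set (Fin P.n) → Prop) :
    MeasurableSet (P.infObjective good) :=
  measurableSet_plays.inter (measurableSet_inf good)

section Losing

variable (σ : P.Strategy) (v₀ : Fin P.n) (good : Set (Fin P.n) → Prop)

/-- Whenever the play reaches the vertex with positive probability, it is lost with positive
probability from there. -/
def riskSet : Set (Fin P.n) :=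
  {v | ∀ ω t, ω t = v → 0 < P.pr σ v₀ (P.cyl ω t) →
    0 < P.pr σ v₀ (P.cyl ω t \ P.infObjective good)}

theorem risk_of_step {ω : ℕ → Fin P.n} {t : ℕ} {w : Fin P.n} (hw : w ∈ riskSet σ v₀ good)
    (hpos : 0 < P.pr σ v₀ (P.cyl ω t))
    (hstep : P.stepMeasure σ t (Preorder.frestrictLe t ω) {w} ≠ 0) :
    0 < P.pr σ v₀ (P.cyl ω t \ P.infObjective good) := by
  -- The play modified at time `t + 1` represents the history prolonged by `w`.
  have hcyl : P.cyl (Function.update ω (t + 1) w) (t + 1) =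
      P.cyl ω t ∩ {ω' | ω' (t + 1) = w} := by
    ext ω'
    simp only [cyl, Set.mem_inter_iff, Set.mem_ofPred_eq]
    constructor
    · intro h
      refine ⟨fun i hi => ?_, ?_⟩
      · rw [h i (by omega), Function.update_of_ne (by omega)]
      · rw [h (t + 1) le_rfl, Function.update_self]
    · rintro ⟨h1, h2⟩ i hi
      rcases Nat.le_succ_iff.1 hi with h | rfl
      · rw [Function.update_of_ne (by omega), h1 i h]
      · rw [Function.update_self, h2]
  have h1 : 0 < P.pr σ v₀ (P.cyl (Function.update ω (t + 1) w) (t + 1)) := by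
    rw [hcyl, pr_cyl_inter]
    exact ENNReal.mul_pos hstep hpos.ne'
  refine (hw _ _ (by simp) h1).trans_le (measure_mono (Set.sdiff_subset_sdiff_left ?_))
  rw [hcyl]
  exact Set.inter_subset_left

/-- The first two rules hold because some step of positive probability enters the set. In a bad MEC,
either the play stays forever with positive probability and fails its objective, or it leaves and
must exit into the set. -/
theorem loseClosed_riskSet : P.LoseClosed (P.NoGood good) (riskSet σ v₀ good) := by
  refine ⟨?_, ?_, ?_⟩
  · rintro v hv w hw hwS ω t rfl hpos
    refine risk_of_step σ v₀ good hwS hpos ?_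
    have hl : History.last (P := P) (Preorder.frestrictLe t ω) ∈ P.VR := hv
    rw [stepMeasure_random σ hl, PMF.toMeasure_apply_singleton _ _ MeasurableSet.of_discrete]
    exact ((P.mem_succ_iff ⟨_, hv⟩ w).1 hw).ne'
  · rintro v hv - hS ω t rfl hpos
    have hl : History.last (P := P) (Preorder.frestrictLe t ω) ∉ P.VR := hv
    refine risk_of_step σ v₀ good (hS _ (σ.legal t _ hl)) hpos ?_
    rw [stepMeasure_player σ hl]
    simp
  · rintro M hM hbad hS v hv ω t rfl hpos
    by_cases hE : P.pr σ v₀ (P.cyl ω t ∩ {ω' | ∀ i, t ≤ i → ω' i ∈ M}) = 0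
    -- Almost every play of the cylinder leaves `M`. One is chosen all of whose prefixes have
    -- positive probability; its first vertex outside `M` is the end of an exit, hence risky.
    · have h1 : ∃ᵐ ω' ∂P.pr σ v₀, ω' ∈ P.cyl ω t := frequently_ae_mem_iff.2 hpos.ne'
      have h2 := (measure_eq_zero_iff_ae_notMem.1 hE).and
        ((ae_cyl_pos σ v₀).and (ae_mem_plays σ v₀))
      obtain ⟨ω', hcyl, hexit, hcpos, hplay⟩ := (h1.and_eventually h2).exists
      have hex : ∃ s, t ≤ s ∧ ω' s ∉ M := by
        by_contra hc
        push Not at hc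
        exact hexit ⟨hcyl, hc⟩
      classical
      obtain ⟨hs1, hs2⟩ := Nat.find_spec hex
      have hmin := fun i => Nat.find_min hex (m := i)
      set s := Nat.find hex
      have hst : t < s := by
        rcases hs1.lt_or_eq with h | h
        · exact h
        · exact absurd (h ▸ (hcyl t le_rfl ▸ hv : ω' t ∈ M)) hs2
      obtain ⟨s', hs'⟩ : ∃ s', s = s' + 1 := ⟨s - 1, by omega⟩
      have hs'M : ω' s' ∈ M := by
        have := hmin s' (by omega)
        push Not at this
        exact this (by omega)
      have hrisk : ω' s ∈ riskSet σ v₀ good :=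
        hS (ω' s') hs'M (ω' s) (hs' ▸ hplay s') hs2
      exact (hrisk ω' s rfl (hcpos s)).trans_le
        (measure_mono (Set.sdiff_subset_sdiff_left (cyl_subset_cyl hcyl hst.le)))
    -- On the plays that stay in `M`, `inf ω` is almost surely an end-component inside `M`, which is
    -- not good.
    · refine (pos_iff_ne_zero.2 hE).trans_le (measure_mono_ae ?_)
      filter_upwards [ae_isEndComponent_inf σ v₀] with ω' ⟨X, hX, hEC⟩ h
      refine ⟨h.1, fun hgood => hbad X (fun x hx => ?_) hEC (hX ▸ hgood.2)⟩
      have hx' : x ∈ P.inf ω' := hX ▸ hx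
      obtain ⟨i, hi, rfl⟩ := frequently_atTop.1 hx' t
      exact h.2 i hi

end Losing

theorem almostSure_subset (good : Set (Fin P.n) → Prop) :
    P.almostSure (P.infObjective good) ⊆ (P.lose (P.NoGood good))ᶜ := by
  rintro v ⟨σ, hσ⟩ hv
  have h1 : 0 < P.pr σ v (P.cyl (fun _ => v) 0) := by
    rw [pos_iff_ne_zero, ← frequently_ae_mem_iff]
    refine Eventually.frequently ?_
    filter_upwards [pr_zero σ v] with ω h i hi
    rw [Nat.le_zero.1 hi, h]
  have h2 := (hv _ (loseClosed_riskSet σ v good) (fun _ => v) 0 rfl h1).trans_le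
    (measure_mono (fun ω hω => hω.2 : _ ⊆ (P.infObjective good)ᶜ))
  rw [(prob_compl_eq_zero_iff (measurableSet_infObjective good)).2 hσ] at h2
  exact h2.false

/-! #### A strategy for the other vertices -/

open Classical in
/-- The number of visits of the last vertex of a history. -/
noncomputable def History.visits {t : ℕ} (h : P.History t) : ℕ := #{i | h i = h.last}

/-- Use the edges to the sets `A v` in turn. -/
noncomputable def roundRobin (A : Fin P.n → Finset (Fin P.n)) (hA : ∀ v, (A v).Nonempty)
    (hsub : ∀ v, A v ⊆ P.succ v) : P.Strategy where
  next _ h := (A h.last).orderEmbOfFin rfl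
    ⟨h.visits % (A h.last).card, Nat.mod_lt _ (card_pos.2 (hA _))⟩
  legal _ _ _ := hsub _ (Finset.orderEmbOfFin_mem _ _ _)

theorem visits_frestrictLe (ω : ℕ → Fin P.n) (t : ℕ) [DecidablePred (fun i => ω i = ω t)] :
    History.visits (P := P) (Preorder.frestrictLe t ω) = Nat.count (fun i => ω i = ω t) (t + 1) := by
  rw [Nat.count_eq_card_filter_range, History.visits]
  refine card_bij (fun i _ => i.1) (fun i hi => ?_) (fun i _ j _ h => Subtype.ext h) fun i hi => ?_
  · simp only [mem_filter, mem_univ, true_and, mem_range] at hi ⊢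
    exact ⟨Nat.lt_succ_of_le (mem_Iic.1 i.2), hi⟩
  · simp only [mem_filter, mem_range] at hi
    exact ⟨⟨i, mem_Iic.2 (by omega)⟩, mem_filter.2 ⟨mem_univ _, hi.2⟩, rfl⟩

/-- The successor with index `j` is chosen at every visit of `v` whose number is congruent to `j`
modulo the number of choices, and such visits occur arbitrarily late. -/
theorem mem_inf_of_roundRobin {A : Fin P.n → Finset (Fin P.n)} {hA : ∀ v, (A v).Nonempty}
    {hsub : ∀ v, A v ⊆ P.succ v} {ω : ℕ → Fin P.n}
    (hω : ∀ t, ω t ∉ P.VR → ω (t + 1) = (roundRobin A hA hsub).next t (Preorder.frestrictLe t ω))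
    {v w : Fin P.n} (hv : v ∈ P.inf ω) (hvR : v ∉ P.VR) (hw : w ∈ A v) : w ∈ P.inf ω := by
  classical
  have hinf : {i | ω i = v}.Infinite := Nat.frequently_atTop_iff_infinite.1 hv
  obtain ⟨j, hj⟩ : ∃ j, (A v).orderEmbOfFin rfl j = w := by
    have := (A v).range_orderEmbOfFin rfl
    rw [Set.ext_iff] at this
    exact (this w).2 hw
  refine frequently_atTop.2 fun N => ?_
  -- `visits` includes the current visit, while `Nat.nth` counts from `0`, so `m + 1` has to be
  -- congruent to `j`. The factor `N + 1` gives `N ≤ m` and keeps the subtraction from being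
  -- truncated.
  set m := (A v).card * (N + 1) + j - 1 with hm
  have hcard : 0 < (A v).card := card_pos.2 (hA v)
  have hmN : N ≤ m := by
    have : N + 1 ≤ (A v).card * (N + 1) := Nat.le_mul_of_pos_left _ hcard
    omega
  have hm1 : m + 1 = (A v).card * (N + 1) + j := by
    have : N + 1 ≤ (A v).card * (N + 1) := Nat.le_mul_of_pos_left _ hcard
    omega
  set t := Nat.nth (fun i => ω i = v) m with ht
  have htv : ω t = v := Nat.nth_mem_of_infinite hinf m
  have htm : m ≤ t := (Nat.nth_strictMono hinf).le_apply
  refine ⟨t + 1, by omega, ?_⟩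
  rw [hω t (htv ▸ hvR)]
  have hc : History.visits (P := P) (Preorder.frestrictLe t ω) % (A v).card = j := by
    rw [visits_frestrictLe, htv, ht, Nat.count_nth_succ_of_infinite hinf, hm1, Nat.mul_add_mod,
      Nat.mod_eq_of_lt j.2]
  have hl : History.last (P := P) (Preorder.frestrictLe t ω) = v := htv
  have key : ∀ u (h : History.visits (P := P) (Preorder.frestrictLe t ω) % (A u).card < (A u).card),
      u = v → (A u).orderEmbOfFin rfl ⟨_, h⟩ = w := by
    rintro u h rfl
    rw [← hj]
    congr 1
    exact Fin.ext hc
  exact key _ _ hl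

end MDP

namespace MDP

variable {P : MDP}

open Classical in
/-- A good end-component inside `M`, if there is one. -/
noncomputable def core (P : MDP) (good : Set (Fin P.n) → Prop) (M : Finset (Fin P.n)) :
    Finset (Fin P.n) :=
  if h : ∃ X ⊆ M, P.IsEndComponent X ∧ good ↑X then h.choose else ∅

theorem core_spec {good : Set (Fin P.n) → Prop} {M : Finset (Fin P.n)} (h : ¬P.NoGood good M) :
    P.core good M ⊆ M ∧ P.IsEndComponent (P.core good M) ∧ good ↑(P.core good M) := by
  have h' : ∃ X ⊆ M, P.IsEndComponent X ∧ good ↑X := by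
    by_contra hc
    push Not at hc
    exact h hc
  rw [core, dif_pos h']
  exact h'.choose_spec

/-- The vertex is in the core of the good maximal end-component `M`. -/
def InCore (P : MDP) (good : Set (Fin P.n) → Prop) (M : Finset (Fin P.n)) (v : Fin P.n) : Prop :=
  P.IsMEC M ∧ ¬P.NoGood good M ∧ v ∈ P.core good M

/-- Stay in the cores, and avoid the losing vertices. -/
def Safe (P : MDP) (good : Set (Fin P.n) → Prop) (v w : Fin P.n) : Prop :=
  v ∈ P.VR ∨ (∃ M, P.InCore good M v ∧ w ∈ P.core good M) ∨
    (v ∈ P.lose (P.NoGood good) ∨ ((∀ M, ¬P.InCore good M v) ∧ w ∉ P.lose (P.NoGood good)))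

open Classical in
/-- The edges to be used. -/
noncomputable def allowed (P : MDP) (good : Set (Fin P.n) → Prop) (v : Fin P.n) :
    Finset (Fin P.n) := {w ∈ P.succ v | P.Safe good v w}

variable {good : Set (Fin P.n) → Prop}

theorem allowed_subset (v : Fin P.n) : P.allowed good v ⊆ P.succ v := by
  classical
  exact fun w hw => (mem_filter.1 hw).1

theorem InCore.mem {M : Finset (Fin P.n)} {v : Fin P.n} (h : P.InCore good M v) : v ∈ M :=
  (core_spec h.2.1).1 h.2.2

theorem InCore.notMem_lose {M : Finset (Fin P.n)} {v : Fin P.n} (h : P.InCore good M v) :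
    v ∉ P.lose (P.NoGood good) := h.1.notMem_lose h.2.1 h.mem

/-- A player vertex that is not losing has a successor that is not losing: inside its MEC by
`mem_lose`, or by the player rule if it has no MEC. -/
theorem allowed_nonempty (v : Fin P.n) : (P.allowed good v).Nonempty := by
  classical
  by_cases hR : v ∈ P.VR
  · obtain ⟨w, hw⟩ := P.succ_nonempty v
    exact ⟨w, mem_filter.2 ⟨hw, Or.inl hR⟩⟩
  by_cases hl : v ∈ P.lose (P.NoGood good)
  · obtain ⟨w, hw⟩ := P.succ_nonempty v
    exact ⟨w, mem_filter.2 ⟨hw, Or.inr (Or.inr (Or.inl hl))⟩⟩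
  by_cases hc : ∃ M, P.InCore good M v
  · obtain ⟨M, hM⟩ := hc
    obtain ⟨w, hw, hvw⟩ := (core_spec hM.2.1).2.1.exists_succ_mem hM.2.2
    exact ⟨w, mem_filter.2 ⟨hvw, Or.inr (Or.inl ⟨M, hM, hw⟩)⟩⟩
  push Not at hc
  suffices h : ∃ w ∈ P.succ v, w ∉ P.lose (P.NoGood good) by
    obtain ⟨w, hw, hw'⟩ := h
    exact ⟨w, mem_filter.2 ⟨hw, Or.inr (Or.inr (Or.inr ⟨hc, hw'⟩))⟩⟩
  by_cases hM : ∃ M, P.IsMEC M ∧ v ∈ M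
  · obtain ⟨M, hM, hv⟩ := hM
    obtain ⟨w, hw, hvw⟩ := hM.1.exists_succ_mem hv
    exact ⟨w, hvw, fun h => hl (hM.mem_lose hw hv h)⟩
  · by_contra h
    push Not at h hM
    exact hl (loseClosed_lose.player v hR hM h)

theorem notMem_lose_of_allowed {v w : Fin P.n} (hv : v ∉ P.lose (P.NoGood good))
    (hw : w ∈ P.allowed good v) : w ∉ P.lose (P.NoGood good) := by
  classical
  obtain ⟨h1, h2⟩ := mem_filter.1 hw
  rcases h2 with h | ⟨M, hM, hwM⟩ | h | h
  · exact fun h' => hv (loseClosed_lose.random v h w h1 h')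
  · exact InCore.notMem_lose ⟨hM.1, hM.2.1, hwM⟩
  · exact absurd h hv
  · exact h.2

theorem mem_core_of_allowed {M : Finset (Fin P.n)} {v w : Fin P.n} (hM : P.InCore good M v)
    (hw : w ∈ P.allowed good v) : w ∈ P.core good M := by
  classical
  obtain ⟨h1, h2⟩ := mem_filter.1 hw
  rcases h2 with h | ⟨M', hM', hwM⟩ | h | h
  · exact (core_spec hM.2.1).2.1.2.1 v hM.2.2 h h1
  · rwa [hM.1.eq_of_mem hM'.1 hM.mem hM'.mem]
  · exact absurd h hM.notMem_lose
  · exact absurd hM (h.1 M)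

/-- A strongly connected set that is closed under allowed edges and avoids the losing vertices is
good. -/
theorem good_of_closed {C : Finset (Fin P.n)} (hne : C.Nonempty)
    (hl : ∀ v ∈ C, v ∉ P.lose (P.NoGood good)) (hcl : ∀ v ∈ C, P.allowed good v ⊆ C)
    (hconn : ∀ u ∈ C, ∀ v ∈ C, Relation.ReflTransGen
      (fun a b => a ∈ C ∧ b ∈ C ∧ b ∈ P.allowed good a) u v) : good ↑C := by
  classical
  -- Allowed edges do not leave a core, and all edges inside a core are allowed. Thus a set `C` that
  -- meets a core coincides with it.
  by_cases hc : ∃ M x, x ∈ C ∧ P.InCore good M x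
  · obtain ⟨M, x, hx, hM⟩ := hc
    obtain ⟨h1, h2, h3⟩ := core_spec hM.2.1
    suffices h : C = P.core good M by rwa [h]
    ext y
    constructor
    · intro hy
      exact mem_of_reflTransGen (p := fun z => z ∈ P.core good M) (hconn x hx y hy)
        (fun a b ha hab => mem_core_of_allowed ⟨hM.1, hM.2.1, ha⟩ hab.2.2) hM.2.2
    · intro hy
      refine mem_of_reflTransGen (p := fun z => z ∈ C) (h2.1 x hM.2.2 y hy)
        (fun a b ha hab => hcl a ha ?_) hx
      exact mem_filter.2 ⟨hab.2.2, Or.inr (Or.inl ⟨M, ⟨hM.1, hM.2.1, hab.1⟩, hab.2.1⟩)⟩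
  · push Not at hc
    -- Without core vertices `C` is an end-component, and its MEC `M` lies in `C` because every move
    -- to a non-losing vertex is allowed. A good `M` would bring its core into `C`; a bad `M` that
    -- is not losing has an exit to a non-losing vertex, which would then lie in `C ⊆ M`.
    exfalso
    have hEC : P.IsEndComponent C := by
      refine ⟨fun u hu v hv => Relation.ReflTransGen.mono (fun a b hab =>
        ⟨hab.1, hab.2.1, allowed_subset a hab.2.2⟩) _ _ (hconn u hu v hv), fun v hv hR w hw => ?_, ?_⟩
      · exact hcl v hv (mem_filter.2 ⟨hw, Or.inl hR⟩)
      · obtain ⟨v, hv⟩ := hne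
        obtain ⟨w, hw⟩ := P.allowed_nonempty (good := good) v
        exact ⟨v, hv, w, hcl v hv hw, allowed_subset v hw⟩
    obtain ⟨M, hM, hCM⟩ := hEC.exists_isMEC
    obtain ⟨x, hx⟩ := hne
    have hMl : ∀ y ∈ M, y ∉ P.lose (P.NoGood good) := fun y hy h =>
      hl x hx (hM.mem_lose hy (hCM hx) h)
    have hallow : ∀ a ∈ C, ∀ b ∈ P.succ a, b ∉ P.lose (P.NoGood good) → b ∈ C :=
      fun a ha b hb hbl => hcl a ha
        (mem_filter.2 ⟨hb, Or.inr (Or.inr (Or.inr ⟨fun M => hc M a ha, hbl⟩))⟩)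
    have hMC : M ⊆ C := fun y hy =>
      mem_of_reflTransGen (p := fun z => z ∈ C) (hM.1.1 x (hCM hx) y hy)
        (fun a b ha hab => hallow a ha b hab.2.2 (hMl b hab.2.1)) hx
    by_cases hbad : P.NoGood good M
    · have hleave : ∃ u ∈ M, ∃ w ∈ P.succ u, w ∉ M ∧ w ∉ P.lose (P.NoGood good) := by
        by_contra h
        push Not at h
        exact hMl x (hCM hx) (loseClosed_lose.mec M hM hbad h x (hCM hx))
      obtain ⟨u, hu, w, hw, hwM, hwl⟩ := hleave
      exact hwM (hCM (hallow u (hMC hu) w hw hwl))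
    · obtain ⟨h1, h2, -⟩ := core_spec hbad
      obtain ⟨y, hy⟩ := h2.nonempty
      exact hc M y (hMC (h1 hy)) ⟨hM, hbad, hy⟩

/-- Almost-sure winning is decided by the closure that defines the losing vertices. -/
theorem almostSure_infObjective (good : Set (Fin P.n) → Prop) :
    P.almostSure (P.infObjective good) = (P.lose (P.NoGood good))ᶜ := by
  refine (almostSure_subset good).antisymm fun v hv => ?_
  -- Using the allowed edges in turn makes `inf ω` closed under them, as `good_of_closed` demands.
  set σ := roundRobin (P.allowed good) allowed_nonempty allowed_subset with hσ
  refine ⟨σ, ?_⟩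
  suffices h : ∀ᵐ ω ∂P.pr σ v, ω ∈ P.infObjective good by
    rw [measure_congr (eventuallyEq_univ.2 h : P.infObjective good =ᵐ[P.pr σ v] Set.univ),
      measure_univ]
  have h : ∀ᵐ ω ∂P.pr σ v, ∀ v w, v ∈ P.VR → w ∈ P.succ v → v ∈ P.inf ω → w ∈ P.inf ω := by
    simp only [ae_all_iff]
    exact ae_succ_mem_inf σ v
  filter_upwards [h, ae_mem_plays σ v, pr_zero σ v, ae_follows σ v] with ω h1 h2 h3 h4
  refine ⟨h2, ?_⟩
  classical
  have hstep : ∀ t, ω (t + 1) ∈ P.allowed good (ω t) := by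
    intro t
    by_cases hR : ω t ∈ P.VR
    · exact mem_filter.2 ⟨h2 t, Or.inl hR⟩
    · rw [h4 t hR]
      exact Finset.orderEmbOfFin_mem _ _ _
  have hwin : ∀ t, ω t ∉ P.lose (P.NoGood good) := by
    intro t
    induction t with
    | zero => rwa [h3]
    | succ t ih => exact notMem_lose_of_allowed ih (hstep t)
  have hmem : ∀ v, v ∈ (P.inf ω).toFinset ↔ v ∈ P.inf ω := fun v => Set.mem_toFinset
  rw [← Set.coe_toFinset (P.inf ω)]
  refine good_of_closed ?_ ?_ ?_ ?_
  · obtain ⟨x, hx⟩ := inf_nonempty ω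
    exact ⟨x, (hmem x).2 hx⟩
  · intro x hx
    rw [hmem] at hx
    obtain ⟨t, ht⟩ := hx.exists
    exact ht ▸ hwin t
  · intro x hx w hw
    rw [hmem] at hx ⊢
    by_cases hR : x ∈ P.VR
    · exact h1 x w hR (allowed_subset x hw) hx
    · exact mem_inf_of_roundRobin h4 hx hR hw
  · intro x hx y hy
    rw [hmem] at hx hy
    simp only [hmem]
    exact reflTransGen_inf (r := fun a b => b ∈ P.allowed good a) hstep hx hy

/-! ### Attractors and restrictions -/

/-- Player 1 cannot avoid `S` outside of `S`. -/
structure AttrClosed (P : MDP) (S : Set (Fin P.n)) : Prop where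
  random : ∀ v ∈ P.VR, ∀ w ∈ P.succ v, w ∈ S → v ∈ S
  player : ∀ v ∉ P.VR, (∀ w ∈ P.succ v, w ∈ S) → v ∈ S

/-- The random attractor of `U`. -/
def attr (P : MDP) (U : Set (Fin P.n)) : Set (Fin P.n) :=
  {v | ∀ S, U ⊆ S → P.AttrClosed S → v ∈ S}

theorem subset_attr (U : Set (Fin P.n)) : U ⊆ P.attr U := fun _ hv _ hS _ => hS hv

theorem attrClosed_attr (U : Set (Fin P.n)) : P.AttrClosed (P.attr U) :=
  ⟨fun v hv w hw h S hU hS => hS.random v hv w hw (h S hU hS),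
    fun v hv h S hU hS => hS.player v hv fun w hw => h w hw S hU hS⟩

/-- The complement of `X` contains `U` and is attractor-closed, since random vertices cannot leave
`X` and player 1 need not. -/
theorem IsEndComponent.disjoint_attr {X : Finset (Fin P.n)} (hX : P.IsEndComponent X)
    {U : Set (Fin P.n)} (hU : ∀ v ∈ X, v ∉ U) {v : Fin P.n} (hv : v ∈ X) : v ∉ P.attr U := by
  intro h
  refine h {v | v ∉ X} (fun w hw hwX => hU w hwX hw) ⟨?_, ?_⟩ hv
  · exact fun x hx w hw hwX hxX => hwX (hX.2.1 x hxX hx hw)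
  · intro x hx h hxX
    obtain ⟨w, hw, hxw⟩ := hX.exists_succ_mem hxX
    exact h w hxw hw

/-- The objective `good` holds for all sets that avoid `U`, for which player 1 may stay outside of
the attractor. -/
theorem notMem_lose_of_notMem_attr {U : Set (Fin P.n)}
    (hgood : ∀ X : Finset (Fin P.n), (∀ v ∈ X, v ∉ U) → good ↑X) {v : Fin P.n}
    (hv : v ∉ P.attr U) : v ∉ P.lose (P.NoGood good) := by
  classical
  intro h
  have hA := P.attrClosed_attr U
  -- The attractor itself satisfies the rules that define `lose`. For the MEC rule: if all exits of
  -- `M` lead to the attractor but `M` is not contained in it, then player 1 can stay in the rest of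
  -- `M`, which contains an end-component that avoids `U` and is therefore good.
  refine hv (h _ ⟨hA.random, fun v hv _ h => hA.player v hv h, fun M hM hbad hleave u hu => ?_⟩)
  by_contra huA
  have h1 : ∀ x ∈ ({x ∈ M | x ∉ P.attr U} : Finset _), x ∈ P.VR →
      P.succ x ⊆ {x ∈ M | x ∉ P.attr U} := fun x hx hxR w hw => by
    obtain ⟨hx1, hx2⟩ := mem_filter.1 hx
    exact mem_filter.2 ⟨hM.1.2.1 x hx1 hxR hw, fun hwA => hx2 (hA.random x hxR w hw hwA)⟩
  have h2 : ∀ x ∈ ({x ∈ M | x ∉ P.attr U} : Finset _),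
      ∃ w ∈ ({x ∈ M | x ∉ P.attr U} : Finset _), w ∈ P.succ x := fun x hx => by
    obtain ⟨hx1, hx2⟩ := mem_filter.1 hx
    by_contra hno
    push Not at hno
    have hallA : ∀ w ∈ P.succ x, w ∈ P.attr U := fun w hw => by
      by_cases hwM : w ∈ M
      · by_contra hwA
        exact hno w (mem_filter.2 ⟨hwM, hwA⟩) hw
      · exact hleave x hx1 w hw hwM
    by_cases hxR : x ∈ P.VR
    · obtain ⟨w, hw⟩ := P.succ_nonempty x
      exact hx2 (hA.random x hxR w hw (hallA w hw))
    · exact hx2 (hA.player x hxR hallA)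
  obtain ⟨Y, hY, hEC⟩ := exists_isEndComponent_subset ⟨u, mem_filter.2 ⟨hu, huA⟩⟩ h1 h2
  exact hbad Y (fun y hy => (mem_filter.1 (hY hy)).1) hEC (hgood Y fun y hy hyU =>
      (mem_filter.1 (hY hy)).2 (subset_attr U hyU))

open Classical in
/-- The complement of a set as a finite set. -/
noncomputable def outside (P : MDP) (R : Set (Fin P.n)) : Finset (Fin P.n) := Rᶜ.toFinset

theorem mem_outside {R : Set (Fin P.n)} {v : Fin P.n} : v ∈ P.outside R ↔ v ∉ R := by
  simp [outside]

open Classical in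
/-- The vertices of an attractor are turned into player 1 vertices with only a self-loop. -/
noncomputable def restrict (P : MDP) (R : Set (Fin P.n)) (hR : P.AttrClosed R) : MDP where
  n := P.n
  n_pos := P.n_pos
  succ v := if v ∈ R then {v} else P.succ v ∩ P.outside R
  VR := P.VR ∩ P.outside R
  -- By `hR.random` a random vertex outside `R` has no successor in `R`, so its distribution needs
  -- no change.
  δ v := P.δ ⟨v.1, (mem_inter.1 v.2).1⟩
  mem_succ_iff := by
    rintro ⟨v, hv⟩ w
    obtain ⟨h1, h2⟩ := mem_inter.1 hv
    rw [mem_outside] at h2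
    rw [if_neg h2, ← P.mem_succ_iff ⟨v, h1⟩ w, mem_inter, and_iff_left_iff_imp, mem_outside]
    exact fun hw hwR => h2 (hR.random v h1 w hw hwR)
  succ_nonempty v := by
    split_ifs with hv
    · exact singleton_nonempty v
    · by_contra h
      have h1 : ∀ w ∈ P.succ v, w ∈ R := fun w hw => by
        by_contra hwR
        exact h ⟨w, mem_inter.2 ⟨hw, mem_outside.2 hwR⟩⟩
      by_cases hvR : v ∈ P.VR
      · obtain ⟨w, hw⟩ := P.succ_nonempty v
        exact hv (hR.random v hvR w hw (h1 w hw))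
      · exact hv (hR.player v hvR h1)

section

variable {R : Set (Fin P.n)} (hR : P.AttrClosed R)

theorem succ_restrict_of_mem {v : Fin P.n} (hv : v ∈ R) :
    ((P.restrict R hR).succ v : Finset (Fin P.n)) = {v} := if_pos hv

theorem mem_succ_restrict {v : Fin P.n} (hv : v ∉ R) {w : Fin P.n} :
    w ∈ ((P.restrict R hR).succ v : Finset (Fin P.n)) ↔ w ∈ P.succ v ∧ w ∉ R := by
  have h : ((P.restrict R hR).succ v : Finset (Fin P.n)) = P.succ v ∩ P.outside R := if_neg hv
  exact ((Finset.ext_iff.1 h w).trans mem_inter).trans (and_congr_right fun _ => mem_outside)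

theorem mem_VR_restrict {v : Fin P.n} :
    v ∈ ((P.restrict R hR).VR : Finset (Fin P.n)) ↔ v ∈ P.VR ∧ v ∉ R :=
  mem_inter.trans (and_congr_right fun _ => mem_outside)

/-- A new loop replaces at least one edge, so the time bound for `P` also covers decompositions of
its restrictions. -/
theorem m_restrict_le : (P.restrict R hR).m ≤ P.m := by
  refine sum_le_sum fun (v : Fin P.n) _ => ?_
  by_cases hv : v ∈ R
  · have h1 : 0 < (P.succ v).card := card_pos.2 (P.succ_nonempty v)
    have h2 : ((P.restrict R hR).succ v : Finset (Fin P.n)).card = 1 :=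
      (congrArg card (succ_restrict_of_mem hR hv)).trans (card_singleton v)
    exact h2.trans_le h1
  · exact card_le_card fun (w : Fin P.n) hw => ((mem_succ_restrict hR hv).1 hw).1

/-- The end-components outside of the attractor are those of the restriction. -/
theorem isEndComponent_restrict {X : Finset (Fin P.n)}
    (hX : ∀ v ∈ X, v ∉ R) : (P.restrict R hR).IsEndComponent X ↔ P.IsEndComponent X := by
  have hsucc : ∀ v ∈ X, ∀ w ∈ X, w ∈ ((P.restrict R hR).succ v : Finset (Fin P.n)) ↔
      w ∈ P.succ v := fun v hv w hw => by
    rw [mem_succ_restrict hR (hX v hv), and_iff_left (hX w hw)]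
  unfold IsEndComponent
  refine and_congr (forall₂_congr fun u _ => forall₂_congr fun v _ => ?_) (and_congr
    (forall₂_congr fun (v : Fin P.n) hv => ?_) ?_)
  · have h : (fun a b => a ∈ X ∧ b ∈ X ∧ b ∈ (P.restrict R hR).succ a) =
        fun a b => a ∈ X ∧ b ∈ X ∧ b ∈ P.succ a := by
      ext a b
      exact and_congr_right fun ha => and_congr_right fun hb => hsucc a ha b hb
    exact Eq.to_iff (congrArg (fun r => Relation.ReflTransGen r u v) h)
  · constructor
    · intro h hvR w hw
      have hwR : w ∉ R := fun hwR => hX v hv (hR.random v hvR w hw hwR)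
      exact h ((mem_VR_restrict hR).2 ⟨hvR, hX v hv⟩) ((mem_succ_restrict hR (hX v hv)).2 ⟨hw, hwR⟩)
    · intro h hvR w hw
      exact h ((mem_VR_restrict hR).1 hvR).1 ((mem_succ_restrict hR (hX v hv)).1 hw).1
  · exact exists_congr fun u => and_congr_right fun hu => exists_congr fun v =>
      and_congr_right fun hv => hsucc u hu v hv

end

/-- An end-component of the restriction with a vertex outside of the attractor is disjoint from
the attractor. -/
theorem notMem_of_isEndComponent_restrict {R : Set (Fin P.n)} (hR : P.AttrClosed R)
    {X : Finset (Fin P.n)} (hX : (P.restrict R hR).IsEndComponent X) {u : Fin P.n} (hu : u ∈ X)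
    (huR : u ∉ R) {v : Fin P.n} (hv : v ∈ X) : v ∉ R := by
  classical
  intro hvR
  refine huR (mem_of_reflTransGen (p := fun z => z ∈ R) (hX.1 v hv u hu) (fun a b ha hab => ?_) hvR)
  have h : b ∈ ({a} : Finset (Fin P.n)) := succ_restrict_of_mem hR ha ▸ hab.2.2
  rwa [mem_singleton.1 h]

/-! ### The five objectives -/

/-- The condition of the Rabin pairs. -/
def RabinGood {k : ℕ} (L U : Fin k → Finset (Fin P.n)) (S : Set (Fin P.n)) : Prop :=
  ∃ i, (↑(L i) ∩ S).Nonempty ∧ ↑(U i) ∩ S = ∅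

theorem rabin_eq {k : ℕ} (L U : Fin k → Finset (Fin P.n)) :
    P.rabin L U = P.infObjective (RabinGood L U) := rfl

theorem iUnion_buchi {k : ℕ} (T : Fin k → Finset (Fin P.n)) :
    ⋃ i, P.buchi (T i) = P.infObjective (fun S => ∃ i, (S ∩ ↑(T i)).Nonempty) := by
  ext ω
  simp [buchi, infObjective]

theorem buchi_eq (T : Finset (Fin P.n)) :
    P.buchi T = P.infObjective (fun S => (S ∩ ↑T).Nonempty) := rfl

theorem iUnion_coBuchi {k : ℕ} (T : Fin k → Finset (Fin P.n)) :
    ⋃ i, P.coBuchi (T i) = P.infObjective (fun S => ∃ i, S ∩ ↑(T i) = ∅) := by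
  ext ω
  simp [coBuchi, infObjective]

theorem coBuchi_eq (T : Finset (Fin P.n)) :
    P.coBuchi T = P.infObjective (fun S => S ∩ ↑T = ∅) := rfl

/-- The vertices that are not losing if the maximal end-components that meet `G` are good. -/
def winOf (P : MDP) (G : Set (Fin P.n)) : Set (Fin P.n) := (P.lose fun M => ∀ v ∈ M, v ∉ G)ᶜ

/-- The second hypothesis permits an overestimate: a MEC that meets `G` need not contain a good
end-component, provided that winning is possible from it in some way. -/
theorem almostSure_eq_winOf {G : Set (Fin P.n)}
    (h1 : ∀ X, P.IsEndComponent X → good ↑X → ∃ v ∈ X, v ∈ G)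
    (h2 : ∀ M, P.IsMEC M → ∀ v ∈ M, v ∈ G → v ∉ P.lose (P.NoGood good)) :
    P.almostSure (P.infObjective good) = P.winOf G := by
  rw [almostSure_infObjective, winOf, lose_congr (bad := P.NoGood good)
    (bad' := fun M => ∀ v ∈ M, v ∉ G)]
  · intro M hM hb X hXM hX hgood
    obtain ⟨v, hv, hvG⟩ := h1 X hX hgood
    exact hb v (hXM hv) hvG
  · intro M hM hb
    push Not at hb
    obtain ⟨v, hv, hvG⟩ := hb
    exact ⟨v, hv, h2 M hM v hv hvG⟩

theorem almostSure_buchi_eq_winOf (T : Finset (Fin P.n)) :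
    P.almostSure (P.buchi T) = P.winOf ↑T := by
  rw [buchi_eq]
  refine almostSure_eq_winOf (fun X _ h => ?_) fun M hM v hv hvT => hM.notMem_lose ?_ hv
  · obtain ⟨v, hv, hvT⟩ := h
    exact ⟨v, hv, hvT⟩
  · exact fun h => h M subset_rfl hM.1 ⟨v, hv, hvT⟩

theorem almostSure_iUnion_buchi_eq_winOf {k : ℕ} (T : Fin k → Finset (Fin P.n)) :
    P.almostSure (⋃ i, P.buchi (T i)) = P.winOf {v | ∃ i, v ∈ T i} := by
  rw [iUnion_buchi]
  refine almostSure_eq_winOf (fun X _ h => ?_) fun M hM v hv hvT => hM.notMem_lose ?_ hv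
  · obtain ⟨i, v, hv, hvT⟩ := h
    exact ⟨v, hv, i, hvT⟩
  · obtain ⟨i, hvT⟩ := hvT
    exact fun h => h M subset_rfl hM.1 ⟨i, v, hv, hvT⟩

/-- The overestimate is used here: a MEC may meet the complement of the attractor although player 1
has to leave the MEC in order to avoid `T`. So no decomposition of the restriction is needed. -/
theorem almostSure_coBuchi_eq_winOf (T : Finset (Fin P.n)) :
    P.almostSure (P.coBuchi T) = P.winOf (P.attr ↑T)ᶜ := by
  rw [coBuchi_eq]
  refine almostSure_eq_winOf (fun X hX h => ?_) fun M hM v hv hvT =>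
    notMem_lose_of_notMem_attr (fun X hX => ?_) hvT
  · obtain ⟨v, hv⟩ := hX.nonempty
    exact ⟨v, hv, hX.disjoint_attr (fun w hw hwT => (Set.ext_iff.1 h w).1 ⟨hw, hwT⟩) hv⟩
  · exact Set.eq_empty_of_forall_notMem fun w hw => hX w hw.1 hw.2

theorem almostSure_iUnion_coBuchi_eq_winOf {k : ℕ} (T : Fin k → Finset (Fin P.n)) :
    P.almostSure (⋃ i, P.coBuchi (T i)) = P.winOf {v | ∃ i, v ∉ P.attr ↑(T i)} := by
  rw [iUnion_coBuchi]
  refine almostSure_eq_winOf (fun X hX h => ?_) fun M hM v hv hvT => ?_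
  · obtain ⟨i, h⟩ := h
    obtain ⟨v, hv⟩ := hX.nonempty
    exact ⟨v, hv, i, hX.disjoint_attr (fun w hw hwT => (Set.ext_iff.1 h w).1 ⟨hw, hwT⟩) hv⟩
  · obtain ⟨i, hvT⟩ := hvT
    exact notMem_lose_of_notMem_attr (fun X hX =>
      ⟨i, Set.eq_empty_of_forall_notMem fun w hw => hX w hw.1 hw.2⟩) hvT

/-- The vertices that are in a maximal end-component outside of the attractor of `U` that meets
`L`. -/
def rabinCore (P : MDP) (L U : Finset (Fin P.n)) : Set (Fin P.n) :=
  {v | v ∉ P.attr ↑U ∧ ∃ X, (P.restrict (P.attr ↑U) (P.attrClosed_attr _)).IsMEC X ∧ v ∈ X ∧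
    ∃ u ∈ X, u ∈ L ∧ u ∉ P.attr ↑U}

/-- Avoiding `U` is not enough for a Rabin pair, since `L` has to be visited again and again; hence
the MECs of the restriction. Each of them outside the attractor is an end-component of `P` and makes
the MEC around it good. -/
theorem almostSure_rabin_eq_winOf {k : ℕ} (L U : Fin k → Finset (Fin P.n)) :
    P.almostSure (P.rabin L U) = P.winOf {v | ∃ i, v ∈ P.rabinCore (L i) (U i)} := by
  rw [rabin_eq]
  refine almostSure_eq_winOf (fun X hX h => ?_) fun M hM v hv hvT => hM.notMem_lose ?_ hv
  · obtain ⟨i, ⟨v, hvL, hv⟩, hU⟩ := h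
    have hd : ∀ w ∈ X, w ∉ P.attr ↑(U i) := fun w => hX.disjoint_attr
      (fun w hw hwT => (Set.ext_iff.1 hU w).1 ⟨hwT, hw⟩)
    obtain ⟨Y, hY, hXY⟩ := ((isEndComponent_restrict (P.attrClosed_attr _) hd).2 hX).exists_isMEC
    exact ⟨v, hv, i, hd v hv, Y, hY, hXY hv, v, hXY hv, hvL, hd v hv⟩
  · obtain ⟨i, hvA, X, hX, hvX, u, huX, huL, -⟩ := hvT
    have hd : ∀ w ∈ X, w ∉ P.attr ↑(U i) := fun w =>
      notMem_of_isEndComponent_restrict _ hX.1 hvX hvA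
    have hEC := (isEndComponent_restrict (P.attrClosed_attr _) hd).1 hX.1
    exact fun h => h X (hM.subset_of_mem hEC hv hvX) hEC ⟨i, ⟨u, huL, huX⟩,
      Set.eq_empty_of_forall_notMem fun w hw => hd w hw.2 (subset_attr _ hw.1)⟩

/-- All maximal end-components of an MDP, from those of the restriction by the empty set. -/
theorem attrClosed_empty : P.AttrClosed ∅ := by
  refine ⟨fun _ _ _ _ h => h, fun v _ h => ?_⟩
  obtain ⟨w, hw⟩ := P.succ_nonempty v
  exact h w hw

/-- With this, `P` itself is decomposed by the same subroutine as its restrictions. -/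
theorem isMEC_restrict_empty {X : Finset (Fin P.n)} :
    (P.restrict ∅ attrClosed_empty).IsMEC X ↔ P.IsMEC X := by
  have h : ∀ X : Finset (Fin P.n), (P.restrict ∅ attrClosed_empty).IsEndComponent X ↔
      P.IsEndComponent X := fun X => isEndComponent_restrict _ (fun _ _ h => h)
  exact ⟨fun hX => ⟨(h X).1 hX.1, fun Y hY => hX.2 ((h Y).2 hY)⟩,
    fun hX => ⟨(h X).2 hX.1, fun Y hY => hX.2 ((h Y).1 hY)⟩⟩

end MDP

/-! ### Encodings of set families and graphs -/

namespace ListsFamily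

variable {n k : ℕ} {off elt : ℕ → ℕ} {F : Fin k → Finset (Fin n)}

theorem card_eq (h : ListsFamily off elt F) (i : Fin k) :
    (F i).card = off ((i : ℕ) + 1) - off i := by
  have h1 := (h.2 i).2.image_eq
  have h2 := congrArg Set.ncard h1
  rw [(h.2 i).2.injOn.ncard_image, Set.ncard_image_of_injective _ Fin.val_injective,
    Set.ncard_coe_finset, ← coe_Ico, Set.ncard_coe_finset, Nat.card_Ico] at h2
  exact h2.symm

theorem off_eq_sum (h : ListsFamily off elt F) : off k = ∑ i, (F i).card := by
  induction k with
  | zero => simpa using h.1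
  | succ k ih =>
    have h' : ListsFamily off elt (fun i : Fin k => F i.castSucc) :=
      ⟨h.1, fun i => h.2 i.castSucc⟩
    have h1 := h.card_eq (Fin.last k)
    have h2 := (h.2 (Fin.last k)).1
    rw [Fin.val_last] at h1 h2
    rw [Fin.sum_univ_castSucc, ← ih h', h1]
    omega

theorem off_mono (h : ListsFamily off elt F) {i j : ℕ} (hij : i ≤ j) (hj : j ≤ k) :
    off i ≤ off j := by
  induction j, hij using Nat.le_induction with
  | base => rfl
  | succ j _ ih => exact (ih (by omega)).trans (h.2 ⟨j, hj⟩).1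

theorem exists_index (h : ListsFamily off elt F) {e : ℕ} (he : e < off k) :
    ∃ i : Fin k, off i ≤ e ∧ e < off ((i : ℕ) + 1) := by
  have key : ∀ j ≤ k, e < off j → ∃ i : Fin k, off i ≤ e ∧ e < off ((i : ℕ) + 1) := by
    intro j
    induction j with
    | zero =>
      intro _ h0
      rw [h.1] at h0
      omega
    | succ j ih =>
      intro hj hlt
      by_cases hej : e < off j
      · exact ih (by omega) hej
      · exact ⟨⟨j, hj⟩, by simpa using hej, hlt⟩
  exact key k le_rfl he

theorem exists_elt (h : ListsFamily off elt F) {i : Fin k} {e : ℕ} (h1 : off i ≤ e)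
    (h2 : e < off ((i : ℕ) + 1)) : ∃ w ∈ F i, elt e = w := by
  obtain ⟨w, hw, hwe⟩ := (h.2 i).2.mapsTo ⟨h1, h2⟩
  exact ⟨w, hw, hwe.symm⟩

theorem exists_pos (h : ListsFamily off elt F) {i : Fin k} {w : Fin n} (hw : w ∈ F i) :
    ∃ e, off i ≤ e ∧ e < off ((i : ℕ) + 1) ∧ elt e = w := by
  obtain ⟨e, he, hwe⟩ := (h.2 i).2.surjOn ⟨w, hw, rfl⟩
  exact ⟨e, he.1, he.2, hwe⟩

end ListsFamily

/-! ### Attractors, losing sets and restrictions in terms of edge lists -/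

namespace MDP

variable {P : MDP}

/-- Absorbs all costs that are linear in the number of vertices. -/
theorem n_le_m (P : MDP) : P.n ≤ P.m := by
  have h : ∑ _v : Fin P.n, 1 ≤ P.m :=
    Finset.sum_le_sum fun v _ => card_pos.2 (P.succ_nonempty v)
  simpa using h

/-- The edges are numbered, the edge `e < m` goes from `src e` to `dst e`. -/
structure EdgeList (P : MDP) (src dst : ℕ → ℕ) : Prop where
  edge : ∀ e < P.m, ∃ v w : Fin P.n, src e = v ∧ dst e = w ∧ w ∈ P.succ v
  exists_edge : ∀ v, ∀ w ∈ P.succ v, ∃ e < P.m, src e = (v : ℕ) ∧ dst e = (w : ℕ)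

theorem edgeList_of_listsFamily {off elt src : ℕ → ℕ} (h : ListsFamily off elt P.succ)
    (hsrc : ∀ v : Fin P.n, ∀ e, off v ≤ e → e < off ((v : ℕ) + 1) → src e = v) :
    P.EdgeList src elt := by
  have hm : off P.n = P.m := h.off_eq_sum
  refine ⟨fun e he => ?_, fun v w hw => ?_⟩
  · obtain ⟨v, h1, h2⟩ := h.exists_index (hm ▸ he)
    obtain ⟨w, hw, hwe⟩ := h.exists_elt h1 h2
    exact ⟨v, w, hsrc v e h1 h2, hwe, hw⟩
  · obtain ⟨e, h1, h2, h3⟩ := h.exists_pos hw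
    exact ⟨e, h2.trans_le (hm ▸ h.off_mono (Nat.succ_le_of_lt v.2) le_rfl), hsrc v e h1 h2, h3⟩

open Classical in
/-- The attractor is computed by the threshold closure. -/
theorem mem_thrClosure_iff_mem_attr {src dst thr : ℕ → ℕ} (hE : P.EdgeList src dst)
    {U : Set (Fin P.n)}
    (hthr : ∀ v : Fin P.n, thr v = if v ∈ U then 0 else if v ∈ P.VR then 1 else
      #{e ∈ range P.m | src e = v}) (v : Fin P.n) :
    (v : ℕ) ∈ thrClosure P.n P.m src dst thr ↔ v ∈ P.attr U := by
  constructor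
  · intro h
    have hA := P.attrClosed_attr U
    obtain ⟨T, hT⟩ : ∃ T : Set ℕ, ∀ y, y ∈ T ↔ ∃ h : y < P.n, (⟨y, h⟩ : Fin P.n) ∈ P.attr U :=
      ⟨{y | ∃ h : y < P.n, (⟨y, h⟩ : Fin P.n) ∈ P.attr U}, fun _ => Iff.rfl⟩
    suffices hcl : ThrClosed P.n P.m src dst thr T from ((hT _).1 (h.2 T hcl)).2
    intro y hy hle
    refine (hT y).2 ⟨hy, ?_⟩
    rw [hthr ⟨y, hy⟩] at hle
    split_ifs at hle with h1 h2
    · exact subset_attr U h1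
    · obtain ⟨e, he⟩ := card_pos.1 (Nat.lt_of_lt_of_le Nat.zero_lt_one hle)
      obtain ⟨he, hes, hdT⟩ := mem_filter.1 he
      obtain ⟨hw, hwA⟩ := (hT _).1 hdT
      obtain ⟨v, w, h3, h4, h5⟩ := hE.edge e (mem_range.1 he)
      have hv : v = ⟨y, hy⟩ := Fin.ext (h3.symm.trans hes)
      have hw' : w = ⟨dst e, hw⟩ := Fin.ext h4.symm
      exact hA.random _ h2 w (hv ▸ h5) (hw' ▸ hwA)
    · refine hA.player _ h2 fun w hw => ?_
      -- The threshold is the full out-degree, so equality of cardinalities forces every edge of `y`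
      -- to lead into `T`.
      have hsub : ({e ∈ range P.m | src e = y ∧ dst e ∈ T} : Finset ℕ) ⊆
          {e ∈ range P.m | src e = y} := fun e he => by
        obtain ⟨h3, h4, -⟩ := mem_filter.1 he
        exact mem_filter.2 ⟨h3, h4⟩
      obtain ⟨e, he, h3, h4⟩ := hE.exists_edge _ w hw
      have hmem : e ∈ ({e ∈ range P.m | src e = y} : Finset ℕ) :=
        mem_filter.2 ⟨mem_range.2 he, h3⟩
      rw [← eq_of_subset_of_card_le hsub hle] at hmem
      obtain ⟨hlt, hwA⟩ := (hT _).1 (mem_filter.1 hmem).2.2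
      have hw' : w = ⟨dst e, hlt⟩ := Fin.ext h4.symm
      exact hw' ▸ hwA
  · intro h
    refine h {v | (v : ℕ) ∈ thrClosure P.n P.m src dst thr} (fun u hu => ?_) ⟨?_, ?_⟩
    · refine thrClosed_thrClosure _ u.2 ?_
      rw [hthr u, if_pos hu]
      exact Nat.zero_le _
    · intro x hx w hw hwC
      refine thrClosed_thrClosure _ x.2 ?_
      obtain ⟨e, he, h3, h4⟩ := hE.exists_edge _ w hw
      have h1 : thr x ≤ 1 := by
        rw [hthr x]
        split_ifs <;> simp
      refine h1.trans (card_pos.2 ⟨e, mem_filter.2 ⟨mem_range.2 he, h3, ?_⟩⟩)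
      rw [h4]
      exact hwC
    · intro x hx hall
      refine thrClosed_thrClosure _ x.2 ?_
      have h1 : thr x ≤ #{e ∈ range P.m | src e = x} := by
        rw [hthr x, if_neg hx]
        split_ifs
        · exact Nat.zero_le _
        · exact le_rfl
      refine h1.trans (card_le_card fun e he => ?_)
      obtain ⟨h2, h3⟩ := mem_filter.1 he
      obtain ⟨v, w, h4, h5, h6⟩ := hE.edge e (mem_range.1 h2)
      have hv : v = x := Fin.ext (h4.symm.trans h3)
      refine mem_filter.2 ⟨h2, h3, ?_⟩
      rw [h5]
      exact hall w (hv ▸ h6)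

/-- The labels of a MEC-decomposition. -/
def IsLabelling (P : MDP) (lab : ℕ → ℕ) : Prop :=
  (∀ v : Fin P.n, lab v ≤ P.n) ∧
    ∀ u v : Fin P.n, (lab u ≠ 0 ∧ lab u = lab v) ↔ ∃ X, P.IsMEC X ∧ u ∈ X ∧ v ∈ X

/-- The node of a vertex after the contraction of the maximal end-components. -/
def quotientNode (n : ℕ) (lab : ℕ → ℕ) (v : ℕ) : ℕ := if lab v = 0 then n + 1 + v else lab v

namespace IsLabelling

variable {lab : ℕ → ℕ}

theorem notMem (h : P.IsLabelling lab) {v : Fin P.n} (hv : lab v = 0) {M : Finset (Fin P.n)}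
    (hM : P.IsMEC M) : v ∉ M := fun hvM => ((h.2 v v).2 ⟨M, hM, hvM, hvM⟩).1 hv

theorem exists_isMEC (h : P.IsLabelling lab) {v : Fin P.n} (hv : lab v ≠ 0) :
    ∃ M, P.IsMEC M ∧ v ∈ M ∧ ∀ u : Fin P.n, u ∈ M ↔ lab u = lab v := by
  obtain ⟨M, hM, hvM, -⟩ := (h.2 v v).1 ⟨hv, rfl⟩
  refine ⟨M, hM, hvM, fun u => ⟨fun hu => (((h.2 v u).2 ⟨M, hM, hvM, hu⟩).2).symm, fun hu => ?_⟩⟩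
  obtain ⟨M', hM', hvM', huM'⟩ := (h.2 v u).1 ⟨hv, hu.symm⟩
  rwa [hM.eq_of_mem hM' hvM hvM']

/-- Contracted MECs occupy nodes among `1, …, n`, and vertices in no MEC occupy `n + 1, …, 2n`. -/
theorem quotientNode_lt (h : P.IsLabelling lab) (v : Fin P.n) :
    quotientNode P.n lab v < 2 * P.n + 1 := by
  have := h.1 v
  unfold quotientNode
  split_ifs <;> omega

theorem eq_of_quotientNode_eq (h : P.IsLabelling lab) {u v : Fin P.n} (hv : lab v = 0)
    (huv : quotientNode P.n lab u = quotientNode P.n lab v) : u = v := by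
  have := h.1 u
  unfold quotientNode at huv
  rw [if_pos hv] at huv
  split_ifs at huv with hu
  · exact Fin.ext (by omega)
  · omega

theorem quotientNode_eq_iff (h : P.IsLabelling lab) {u v : Fin P.n} (hv : lab v ≠ 0) :
    quotientNode P.n lab u = quotientNode P.n lab v ↔ lab u = lab v := by
  have := h.1 v
  unfold quotientNode
  rw [if_neg hv]
  split_ifs with hu
  · constructor <;> intro <;> omega
  · rfl

open Classical in
/-- The losing set is computed by the threshold closure of the contracted graph. -/
theorem mem_thrClosure_iff_mem_lose (h : P.IsLabelling lab) {src dst thr : ℕ → ℕ}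
    (hE : P.EdgeList src dst) {G : Set (Fin P.n)} {es ed : ℕ → ℕ}
    (hes : ∀ e < P.m, es e = quotientNode P.n lab (src e))
    (hed : ∀ e < P.m, ed e = quotientNode P.n lab (dst e))
    (hthr : ∀ v : Fin P.n, thr (quotientNode P.n lab v) =
      if ∃ u : Fin P.n, lab u ≠ 0 ∧ u ∈ G ∧ lab u = quotientNode P.n lab v then P.m + 1 else
      if v ∈ P.VR ∧ lab v = 0 then 1 else
        #{e ∈ range P.m | es e = quotientNode P.n lab v ∧ es e ≠ ed e}) (v : Fin P.n) :
    quotientNode P.n lab v ∈ thrClosure (2 * P.n + 1) P.m es ed thr ↔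
      v ∈ P.lose (fun M => ∀ v ∈ M, v ∉ G) := by
  set bad : Finset (Fin P.n) → Prop := fun M => ∀ v ∈ M, v ∉ G with hbad
  have hl := loseClosed_lose (P := P) (bad := bad)
  have hthr0 : ∀ v : Fin P.n, lab v = 0 → thr (quotientNode P.n lab v) =
      if v ∈ P.VR then 1 else #{e ∈ range P.m | es e = quotientNode P.n lab v ∧ es e ≠ ed e} := by
    intro v hv
    rw [hthr v, if_neg]
    · simp only [hv, and_true]
    · rintro ⟨u, hu, -, huv⟩
      have := h.1 u
      rw [quotientNode, if_pos hv] at huv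
      omega
  constructor
  · intro hmem
    -- Nodes that represent no vertex belong to `T` vacuously, so their thresholds do not matter.
    obtain ⟨T, hT⟩ : ∃ T : Set ℕ, ∀ y, y ∈ T ↔
        ∀ v : Fin P.n, quotientNode P.n lab v = y → v ∈ P.lose bad :=
      ⟨{y | ∀ v : Fin P.n, quotientNode P.n lab v = y → v ∈ P.lose bad}, fun _ => Iff.rfl⟩
    suffices hcl : ThrClosed (2 * P.n + 1) P.m es ed thr T from (hT _).1 (hmem.2 T hcl) v rfl
    intro y hy hle
    rw [hT]
    rintro v rfl
    by_contra hvl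
    -- As `v` is not losing, a loop at its node does not lead into `T`. So a threshold that counts
    -- the non-loop edges is reached only if all of them lead into `T`.
    have hsub : ({e ∈ range P.m | es e = quotientNode P.n lab v ∧ ed e ∈ T} : Finset ℕ) ⊆
        {e ∈ range P.m | es e = quotientNode P.n lab v ∧ es e ≠ ed e} := fun e he => by
      obtain ⟨h3, h4, h6⟩ := mem_filter.1 he
      refine mem_filter.2 ⟨h3, h4, fun h7 => hvl ?_⟩
      exact (hT _).1 h6 v (by rw [← h7, h4])
    by_cases hv : lab v = 0
    · rw [hthr0 v hv] at hle
      split_ifs at hle with hR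
      · obtain ⟨e, he⟩ := card_pos.1 (Nat.lt_of_lt_of_le Nat.zero_lt_one hle)
        obtain ⟨he, h1, h2⟩ := mem_filter.1 he
        rw [mem_range] at he
        obtain ⟨x, w, h3, h4, h5⟩ := hE.edge e he
        rw [hes e he, h3] at h1
        rw [hed e he, h4] at h2
        have hx := h.eq_of_quotientNode_eq hv h1
        exact hvl (hl.random v hR w (hx ▸ h5) ((hT _).1 h2 w rfl))
      · refine hvl (hl.player v hR (fun M hM => h.notMem hv hM) fun w hw => ?_)
        obtain ⟨e, he, h3, h4⟩ := hE.exists_edge _ w hw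
        have hmem : e ∈ ({e ∈ range P.m | es e = quotientNode P.n lab v ∧ es e ≠ ed e} :
            Finset ℕ) := by
          refine mem_filter.2 ⟨mem_range.2 he, by rw [hes e he, h3], ?_⟩
          rw [hes e he, hed e he, h3, h4]
          intro heq
          have hwv : w = v := h.eq_of_quotientNode_eq hv heq.symm
          -- A player vertex with a self-loop is an end-component by itself. Hence a player vertex
          -- in no MEC has no loop, and all its edges are counted.
          have hEC : P.IsEndComponent {v} := by
            refine ⟨fun a ha b hb => ?_, fun a ha haR => ?_, v, mem_singleton_self v, v,
              mem_singleton_self v, hwv ▸ hw⟩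
            · rw [mem_singleton.1 ha, mem_singleton.1 hb]
            · exact absurd (mem_singleton.1 ha ▸ haR) hR
          obtain ⟨M, hM, hvM⟩ := hEC.exists_isMEC
          exact h.notMem hv hM (hvM (mem_singleton_self v))
        rw [← eq_of_subset_of_card_le hsub hle] at hmem
        exact (hT _).1 (mem_filter.1 hmem).2.2 w (by rw [hed e he, h4])
    · obtain ⟨M, hM, hvM, hMlab⟩ := h.exists_isMEC hv
      have hMl : ∀ u ∈ M, u ∉ P.lose bad := fun u hu hul => hvl (hM.mem_lose hu hvM hul)
      have hnode : ∀ u : Fin P.n, quotientNode P.n lab u = quotientNode P.n lab v ↔ u ∈ M :=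
        fun u => (h.quotientNode_eq_iff hv).trans (hMlab u).symm
      have hvq : quotientNode P.n lab v = lab v := if_neg hv
      rw [hthr v] at hle
      by_cases hG : ∃ u : Fin P.n, lab u ≠ 0 ∧ u ∈ G ∧ lab u = quotientNode P.n lab v
      -- There are only `m` edges, so the threshold `m + 1` of a MEC that meets `G` is never
      -- reached.
      · rw [if_pos hG] at hle
        exact absurd (hle.trans ((card_filter_le _ _).trans (card_range _).le))
          (Nat.not_succ_le_self _)
      · rw [if_neg hG, if_neg (fun h => hv h.2)] at hle
        refine hvl (hl.mec M hM (fun u hu huG => hG ⟨u, ?_, huG, ?_⟩) (fun u hu w hw hwM => ?_) v hvM)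
        · rw [(hMlab u).1 hu]
          exact hv
        · rw [hvq, (hMlab u).1 hu]
        obtain ⟨e, he, h3, h4⟩ := hE.exists_edge _ w hw
        have hmem : e ∈ ({e ∈ range P.m | es e = quotientNode P.n lab v ∧ es e ≠ ed e} :
            Finset ℕ) := by
          have h5 : es e = quotientNode P.n lab v := by
            rw [hes e he, h3]
            exact (hnode u).2 hu
          refine mem_filter.2 ⟨mem_range.2 he, h5, fun h6 => hwM ((hnode w).1 ?_)⟩
          rw [← h5, h6, hed e he, h4]
        rw [← eq_of_subset_of_card_le hsub hle] at hmem
        exact (hT _).1 (mem_filter.1 hmem).2.2 w (by rw [hed e he, h4])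
  · intro hmem
    have hC := thrClosed_thrClosure (N := 2 * P.n + 1) (M := P.m) (src := es) (dst := ed) (thr := thr)
    refine hmem {v | quotientNode P.n lab v ∈ thrClosure (2 * P.n + 1) P.m es ed thr} ⟨?_, ?_, ?_⟩
    · intro x hx w hw hwC
      by_cases hx0 : lab x = 0
      · refine hC _ (h.quotientNode_lt x) ?_
        rw [hthr0 x hx0, if_pos hx]
        obtain ⟨e, he, h3, h4⟩ := hE.exists_edge _ w hw
        refine card_pos.2 ⟨e, mem_filter.2 ⟨mem_range.2 he, by rw [hes e he, h3], ?_⟩⟩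
        rw [hed e he, h4]
        exact hwC
      · obtain ⟨M, hM, hxM, hMlab⟩ := h.exists_isMEC hx0
        have hwM := hM.1.2.1 x hxM hx hw
        show quotientNode P.n lab x ∈ thrClosure (2 * P.n + 1) P.m es ed thr
        rw [← (h.quotientNode_eq_iff hx0).2 ((hMlab w).1 hwM)]
        exact hwC
    · intro x hx hxM hall
      have hx0 : lab x = 0 := by
        by_contra hx0
        obtain ⟨M, hM, hxM', -⟩ := h.exists_isMEC hx0
        exact hxM M hM hxM'
      refine hC _ (h.quotientNode_lt x) ?_
      rw [hthr0 x hx0, if_neg hx]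
      refine card_le_card fun e he => ?_
      obtain ⟨h1, h2, -⟩ := mem_filter.1 he
      obtain ⟨y, w, h4, h5, h6⟩ := hE.edge e (mem_range.1 h1)
      refine mem_filter.2 ⟨h1, h2, ?_⟩
      rw [hes e (mem_range.1 h1), h4] at h2
      have hy := h.eq_of_quotientNode_eq hx0 h2
      rw [hed e (mem_range.1 h1), h5]
      exact hall w (hy ▸ h6)
    · intro M hM hb hall x hx
      have hx0 : lab x ≠ 0 := fun h0 => h.notMem h0 hM hx
      obtain ⟨M', hM', hxM', hMlab⟩ := h.exists_isMEC hx0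
      obtain rfl := hM.eq_of_mem hM' hx hxM'
      refine hC _ (h.quotientNode_lt x) ?_
      rw [hthr x, if_neg, if_neg (fun h => hx0 h.2)]
      · refine card_le_card fun e he => ?_
        obtain ⟨h1, h2, h3⟩ := mem_filter.1 he
        obtain ⟨y, w, h4, h5, h6⟩ := hE.edge e (mem_range.1 h1)
        refine mem_filter.2 ⟨h1, h2, ?_⟩
        have h2' := h2
        rw [hes e (mem_range.1 h1), h4, h.quotientNode_eq_iff hx0] at h2'
        rw [hed e (mem_range.1 h1), h5]
        refine hall y ((hMlab y).2 h2') w h6 fun hwM => h3 ?_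
        rw [h2, hed e (mem_range.1 h1), h5]
        exact ((h.quotientNode_eq_iff hx0).2 ((hMlab w).1 hwM)).symm
      · rintro ⟨u, hu0, huG, hux⟩
        rw [quotientNode, if_neg hx0] at hux
        exact hb u ((hMlab u).2 hux) huG

end IsLabelling

theorem exists_count_eq {p : ℕ → Prop} [DecidablePred p] {i b : ℕ} (h : i < Nat.count p b) :
    ∃ e < b, p e ∧ Nat.count p e = i := by
  induction b with
  | zero => simp at h
  | succ b ih =>
    rw [Nat.count_succ] at h
    by_cases hb : i < Nat.count p b
    · obtain ⟨e, he, h1⟩ := ih hb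
      exact ⟨e, by omega, h1⟩
    · split_ifs at h with hp
      · exact ⟨b, by omega, hp, by omega⟩
      · omega

/-- The adjacency lists of the restriction are obtained by selecting edges. -/
theorem listsFamily_restrict {off elt off' elt' : ℕ → ℕ} (h : ListsFamily off elt P.succ)
    {R : Set (Fin P.n)} (hR : P.AttrClosed R) {keep : ℕ → Prop} [DecidablePred keep]
    (hkeep : ∀ v : Fin P.n, ∀ e, off v ≤ e → e < off ((v : ℕ) + 1) →
      (v ∈ R → (keep e ↔ e = off v) ∧ elt' (Nat.count keep (off v)) = v) ∧
      (v ∉ R → ∀ w : Fin P.n, elt e = w → (keep e ↔ w ∉ R) ∧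
        (keep e → elt' (Nat.count keep e) = w)))
    (hoff : ∀ v ≤ P.n, off' v = Nat.count keep (off v)) :
    ListsFamily off' elt' (P.restrict R hR).succ := by
  refine ⟨by rw [hoff 0 (Nat.zero_le _), h.1, Nat.count_zero], fun (v : Fin P.n) => ?_⟩
  rw [hoff v v.2.le, hoff (v + 1) v.2]
  refine ⟨Nat.count_monotone _ (h.2 v).1, ?_⟩
  -- `Nat.count keep` is the bijection from kept edges to new positions.
  have hpos : ∀ i ∈ Set.Ico (Nat.count keep (off v)) (Nat.count keep (off ((v : ℕ) + 1))),
      ∃ e, off v ≤ e ∧ e < off ((v : ℕ) + 1) ∧ keep e ∧ Nat.count keep e = i := by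
    rintro i ⟨h1, h2⟩
    obtain ⟨e, he, hk, hc⟩ := exists_count_eq h2
    refine ⟨e, ?_, he, hk, hc⟩
    by_contra hlt
    have h3 := Nat.count_monotone keep (Nat.succ_le_of_lt (not_le.1 hlt))
    rw [Nat.succ_eq_add_one, Nat.count_succ, if_pos hk] at h3
    omega
  have hmem : ∀ e, off v ≤ e → e < off ((v : ℕ) + 1) → keep e → Nat.count keep e ∈
      Set.Ico (Nat.count keep (off v)) (Nat.count keep (off ((v : ℕ) + 1))) := by
    intro e h1 h2 hk
    refine ⟨Nat.count_monotone _ h1, ?_⟩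
    have h3 := Nat.count_monotone keep (Nat.succ_le_of_lt h2)
    rw [Nat.succ_eq_add_one, Nat.count_succ, if_pos hk] at h3
    omega
  have hne : off v < off ((v : ℕ) + 1) := by
    have h1 := h.card_eq v
    have h2 := card_pos.2 (P.succ_nonempty v)
    omega
  by_cases hv : v ∈ R
  · rw [succ_restrict_of_mem hR hv]
    -- Of the edges of `v` only the first position survives, and its target becomes `v`.
    obtain ⟨-, helt⟩ := (hkeep v (off v) le_rfl hne).1 hv
    refine ⟨fun i hi => ?_, fun i hi j hj _ => ?_, ?_⟩
    · obtain ⟨e, h1, h2, hk, rfl⟩ := hpos i hi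
      rw [(((hkeep v e h1 h2).1 hv).1).1 hk, helt]
      exact ⟨v, mem_singleton_self v, rfl⟩
    · obtain ⟨e, h1, h2, hk, rfl⟩ := hpos i hi
      obtain ⟨e', h1', h2', hk', rfl⟩ := hpos j hj
      rw [(((hkeep v e h1 h2).1 hv).1).1 hk, (((hkeep v e' h1' h2').1 hv).1).1 hk']
    · rintro _ ⟨w, hw, rfl⟩
      have hwv : w = v := mem_singleton.1 hw
      rw [hwv]
      exact ⟨_, hmem (off v) le_rfl hne ((((hkeep v _ le_rfl hne).1 hv).1).2 rfl), helt⟩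
  · refine ⟨fun i hi => ?_, fun i hi j hj hij => ?_, ?_⟩
    · obtain ⟨e, h1, h2, hk, rfl⟩ := hpos i hi
      obtain ⟨w, hw, hwe⟩ := h.exists_elt h1 h2
      obtain ⟨h3, h4⟩ := (hkeep v e h1 h2).2 hv w hwe
      rw [h4 hk]
      exact ⟨w, (mem_succ_restrict hR hv).2 ⟨hw, h3.1 hk⟩, rfl⟩
    · obtain ⟨e, h1, h2, hk, rfl⟩ := hpos i hi
      obtain ⟨e', h1', h2', hk', rfl⟩ := hpos j hj
      obtain ⟨w, hw, hwe⟩ := h.exists_elt h1 h2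
      obtain ⟨w', hw', hwe'⟩ := h.exists_elt h1' h2'
      rw [((hkeep v e h1 h2).2 hv w hwe).2 hk, ((hkeep v e' h1' h2').2 hv w' hwe').2 hk'] at hij
      rw [(h.2 v).2.injOn ⟨h1, h2⟩ ⟨h1', h2'⟩ (by rw [hwe, hwe', hij])]
    · rintro _ ⟨w, hw, rfl⟩
      obtain ⟨hw1, hw2⟩ := (mem_succ_restrict hR hv).1 hw
      obtain ⟨e, h1, h2, h3⟩ := h.exists_pos hw1
      obtain ⟨h4, h5⟩ := (hkeep v e h1 h2).2 hv w h3
      exact ⟨_, hmem e h1 h2 (h4.2 hw2), h5 (h4.2 hw2)⟩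

end MDP

/-! ### The subroutines -/

theorem ListsFamily.index_unique {n k : ℕ} {off elt : ℕ → ℕ} {F : Fin k → Finset (Fin n)}
    (h : ListsFamily off elt F) {u v : Fin k} {e : ℕ} (h1 : off u ≤ e) (h2 : e < off ((u : ℕ) + 1))
    (h3 : off v ≤ e) (h4 : e < off ((v : ℕ) + 1)) : u = v := by
  rcases lt_trichotomy u v with huv | huv | huv
  · have : off ((u : ℕ) + 1) ≤ off v := h.off_mono (Nat.succ_le_of_lt (Fin.lt_def.1 huv)) v.2.le
    omega
  · exact huv
  · have : off ((v : ℕ) + 1) ≤ off u := h.off_mono (Nat.succ_le_of_lt (Fin.lt_def.1 huv)) u.2.le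
    omega

theorem MDP.EdgeList.congr {P : MDP} {src dst src' dst' : ℕ → ℕ} (h : P.EdgeList src dst)
    (h1 : ∀ e < P.m, src' e = src e) (h2 : ∀ e < P.m, dst' e = dst e) : P.EdgeList src' dst' := by
  refine ⟨fun e he => ?_, fun v w hw => ?_⟩
  · rw [h1 e he, h2 e he]
    exact h.edge e he
  · obtain ⟨e, he, h3⟩ := h.exists_edge v w hw
    exact ⟨e, he, by rw [h1 e he, h2 e he]; exact h3⟩

/-- The memory contains the MDP, its number of edges and the list of the sources of its edges. -/
structure MDP.Loaded (P : MDP) (s : State) : Prop where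
  input : P.Input s
  m_eq : s.reg 20 = P.m
  src : ∀ v : Fin P.n, ∀ e, s.arr 1 v ≤ e → e < s.arr 1 ((v : ℕ) + 1) → s.arr 20 e = v

namespace MDP.Loaded

variable {P : MDP} {s : State}

theorem of_eq (h : P.Loaded s) {s' : State} (h1 : ∀ x ∈ [0, 20], s'.reg x = s.reg x)
    (h2 : ∀ a ∈ [0, 1, 2, 20], s'.arr a = s.arr a) : P.Loaded s' := by
  have a1 : s'.arr 1 = s.arr 1 := h2 1 (by decide)
  refine ⟨?_, (h1 20 (by decide)).trans h.m_eq, ?_⟩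
  · unfold MDP.Input
    rw [h1 0 (by decide), h2 0 (by decide), a1, h2 2 (by decide)]
    exact h.input
  · rw [a1, h2 20 (by decide)]
    exact h.src

theorem of_runs (h : P.Loaded s) {W t : ℕ} {c : Cmd} {s' : State} (hr : Runs W c s t s')
    (h1 : ∀ x ∈ [0, 20], x ∉ c.wr) (h2 : ∀ a ∈ [0, 1, 2, 20], a ∉ c.wa) : P.Loaded s' :=
  h.of_eq (fun x hx => hr.reg_eq (h1 x hx)) (fun a ha => hr.arr_eq (h2 a ha))

theorem n_eq (h : P.Loaded s) : s.reg 0 = P.n := h.input.1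

theorem edgeList (h : P.Loaded s) : P.EdgeList (s.arr 20) (s.arr 2) :=
  edgeList_of_listsFamily h.input.2.2 h.src

theorem src_lt (h : P.Loaded s) {e : ℕ} (he : e < P.m) : s.arr 20 e < P.n := by
  obtain ⟨v, w, h1, -⟩ := h.edgeList.edge e he
  rw [h1]
  exact v.2

theorem dst_lt (h : P.Loaded s) {e : ℕ} (he : e < P.m) : s.arr 2 e < P.n := by
  obtain ⟨v, w, -, h1, -⟩ := h.edgeList.edge e he
  rw [h1]
  exact w.2

theorem m_lt (h : P.Loaded s) {W : ℕ} (hs : s.Fits W) : P.m < W := h.m_eq ▸ hs.1 20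

theorem n_lt (h : P.Loaded s) {W : ℕ} (hs : s.Fits W) : P.n < W := h.n_eq ▸ hs.1 0

end MDP.Loaded

theorem MDP.m_pos (P : MDP) : 0 < P.m := P.n_pos.trans_le P.n_le_m

/-! ### Programs for loading, indicators, attractors and restrictions -/

namespace Cmd

/-- Store the source of the edge `reg 21`; the source of the previous edge is in `reg 25`. -/
def loadStep : Cmd :=
  .seq (.ite (.bin .eq (.var 21) (.get 1 (.bin .add (.var 25) (.lit 1))))
    (.set 25 (.bin .add (.var 25) (.lit 1))) skip) (.put 20 (.var 21) (.var 25))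

/-- Compute the number of edges and the sources of the edges. -/
def load : Cmd :=
  .seq (.set 20 (.get 1 (.var 0))) (.seq (.set 25 (.lit 0))
    (loadStep.forLoop 21 (.lit 0) (.var 20)))

/-- Since every vertex has an outgoing edge, the source advances by at most one from an edge to the
next, so one pass over the edges suffices. -/
theorem does_load {W : ℕ} {P : MDP} {s : State} (hs : s.Fits W) (hin : P.Input s) :
    load.Does W s (10 * P.m) (fun s' => P.Loaded s') := by
  obtain ⟨hn, hVR, hL⟩ := hin
  have hm : s.arr 1 P.n = P.m := hL.off_eq_sum
  have hnW : P.n < W := hn ▸ hs.1 0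
  have hmW : P.m < W := hm ▸ hs.2 1 P.n
  have hm0 := P.m_pos
  have hn0 := P.n_pos
  have r1 := Runs.set (W := W) 20 (.get 1 (.var 0)) s (hs.2 _ _)
  have v1 : (Expr.get 1 (.var 0)).eval s = P.m := by simp [Expr.eval, hn, hm]
  rw [v1] at r1
  have r2 := Runs.set (W := W) 25 (.lit 0) (s.setReg 20 P.m) (by simp only [Expr.eval]; omega)
  rw [show (Expr.lit 0).eval (s.setReg 20 P.m) = 0 from rfl] at r2
  set s2 := (s.setReg 20 P.m).setReg 25 0 with hs2
  have hlt : ∀ v : Fin P.n, s.arr 1 v < s.arr 1 ((v : ℕ) + 1) := fun v => by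
    have h1 := hL.card_eq v
    have h2 := card_pos.2 (P.succ_nonempty v)
    omega
  have key : (loadStep.forLoop 21 (.lit 0) (.var 20)).Does W s2 ((P.m - 0) * (3 + 2) + 2)
      (fun s' => ∀ v : Fin P.n, ∀ e < P.m, s.arr 1 v ≤ e → e < s.arr 1 ((v : ℕ) + 1) →
        s'.arr 20 e = v) := by
    refine (does_forLoop (W := W) (lo := 0) (b := P.m) (K := 3)
      (fun j s' => s'.reg 25 < P.n ∧ s.arr 1 (s'.reg 25) ≤ j ∧ j ≤ s.arr 1 (s'.reg 25 + 1) ∧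
        ∀ v : Fin P.n, ∀ e < j, s.arr 1 v ≤ e → e < s.arr 1 ((v : ℕ) + 1) → s'.arr 20 e = v)
      rfl (Nat.zero_le _) ⟨by simpa [State.setReg, hs2] using hn0, by
        simp [State.setReg, hs2, hL.1], by simp, by simp⟩ (r2.fits (r1.fits hs))
        (fun j s' hf _ => by
          simp only [Expr.eval]
          rw [hf.1 20 (by decide)]
          simp [hs2, State.setReg]) hmW ?_).mono le_rfl (fun t s' _ h => h.2.1.2.2.2)
    rintro j s' - hj hf hW hr ⟨i1, i2, i3, i4⟩
    have e1 : s'.arr 1 = s.arr 1 := hf.2 1 (by decide)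
    -- The edge `j` begins the list of the next vertex; there is one, since otherwise `j` would be
    -- `m`.
    by_cases hc : j = s.arr 1 (s'.reg 25 + 1)
    · have hv1 : s'.reg 25 + 1 < P.n := by
        rcases Nat.lt_or_ge (s'.reg 25 + 1) P.n with h | h
        · exact h
        · have : s'.reg 25 + 1 = P.n := by omega
          rw [this, hm] at hc
          omega
      have hlt1 := hlt ⟨s'.reg 25 + 1, hv1⟩
      have hex : ∀ c : Cmd, exec (.seq (.ite (.bin .eq (.var 21) (.get 1 (.bin .add (.var 25)
          (.lit 1)))) (.set 25 (.bin .add (.var 25) (.lit 1))) skip) c) s' =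
          exec c (s'.setReg 25 (s'.reg 25 + 1)) := by
        intro c
        simp [exec, Expr.eval, Op.eval, hr, e1, ← hc]
      refine Ok.does ⟨?_, ?_⟩ ⟨?_, ?_⟩
      · simp only [Ok, Expr.eval, Op.eval, hr, e1, ← hc]
        simp only [if_true, one_ne_zero, if_false]
        omega
      · simp only [Ok, exec, Expr.eval, Op.eval, hr, e1, ← hc]
        simp [State.setReg, hr]
        omega
      · rw [loadStep, hex]
        simpa [exec, State.setArr, State.setReg] using hr
      · rw [loadStep, hex]
        simp only [exec, Expr.eval, State.setArr, State.setReg, Function.update_self, ne_eq,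
          Nat.reduceEqDiff, not_false_eq_true, Function.update_of_ne, hr]
        refine ⟨hv1, hc ▸ Nat.le_succ _, ?_, fun v e he h5 h6 => ?_⟩
        · rw [hc]
          exact hlt1
        · rcases Nat.lt_succ_iff_lt_or_eq.1 he with h | rfl
          · rw [Function.update_of_ne h.ne]
            exact i4 v e h h5 h6
          · rw [Function.update_self]
            exact congrArg Fin.val (hL.index_unique (u := ⟨s'.reg 25 + 1, hv1⟩) (v := v)
              (hc ▸ le_rfl) (hc.trans_lt hlt1) h5 h6)
    · have hex : ∀ c : Cmd, exec (.seq (.ite (.bin .eq (.var 21) (.get 1 (.bin .add (.var 25)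
          (.lit 1)))) (.set 25 (.bin .add (.var 25) (.lit 1))) skip) c) s' =
          exec c (s'.setReg 21 j) := by
        intro c
        simp [exec, Expr.eval, Op.eval, hr, e1, hc, skip]
      refine Ok.does ⟨?_, ?_⟩ ⟨?_, ?_⟩
      · simp only [Ok, Expr.eval, Op.eval, hr, e1, hc, if_false, if_true, skip]
        omega
      · simp only [Ok, exec, Expr.eval, Op.eval, hr, e1, hc, if_false, if_true, skip]
        simp [State.setReg]
        omega
      · rw [loadStep, hex]
        simp [exec, State.setArr, State.setReg]
      · rw [loadStep, hex]
        simp only [exec, Expr.eval, State.setArr, State.setReg, Function.update_self, ne_eq,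
          Nat.reduceEqDiff, not_false_eq_true, Function.update_of_ne]
        refine ⟨i1, by omega, by omega, fun v e he h5 h6 => ?_⟩
        · rcases Nat.lt_succ_iff_lt_or_eq.1 he with h | rfl
          · rw [Function.update_of_ne h.ne]
            exact i4 v e h h5 h6
          · rw [Function.update_self]
            exact congrArg Fin.val (hL.index_unique (u := ⟨s'.reg 25, i1⟩) (v := v)
              i2 (by simp only; omega) h5 h6)
  obtain ⟨t, s3, r3, b3, h3⟩ := key
  have e1 : s3.arr 1 = s.arr 1 := r3.arr_eq (by decide)
  refine ⟨_, s3, .seq _ _ _ _ _ _ _ r1 (.seq _ _ _ _ _ _ _ r2 r3), by omega, ⟨?_, ?_, ?_⟩⟩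
  · refine ⟨(r3.reg_eq (by decide)).trans hn, ?_, ?_⟩
    · intro v
      rw [r3.arr_eq (by decide)]
      exact hVR v
    · rw [e1, r3.arr_eq (by decide)]
      exact hL
  · rw [r3.reg_eq (by decide)]
    simp [hs2, State.setReg]
  · intro v e he1 he2
    rw [e1] at he1 he2
    refine h3 v e ?_ he1 he2
    exact he2.trans_le (hm ▸ hL.off_mono (Nat.succ_le_of_lt v.2) le_rfl)

/-- The indicator in `arr x` of the set with the number `reg 26` of the family in the arrays `o`
and `l`. -/
def indicator (x o l : ℕ) : Cmd :=
  .seq (fill x 21 (.var 0) (.lit 0)) (scatter x 21 (.get o (.var 26))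
    (.get o (.bin .add (.var 26) (.lit 1))) (.lit 1) (.get l (.var 21)) (.lit 1))

/-- `f` is the indicator of `S` on the vertices. -/
def _root_.MDP.IsIndicator (P : MDP) (f : ℕ → ℕ) (S : Set (Fin P.n)) : Prop :=
  ∀ v : Fin P.n, (v ∈ S → f v = 1) ∧ (v ∉ S → f v = 0)

theorem does_indicator {W k : ℕ} {P : MDP} {s : State} {x o l : ℕ} (hs : s.Fits W)
    (hn : s.reg 0 = P.n) (hW : 1 < W) {F : Fin k → Finset (Fin P.n)}
    (hF : ListsFamily (s.arr o) (s.arr l) F) (hxo : o ≠ x) (hxl : l ≠ x) {i : Fin k}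
    (hi : s.reg 26 = i) :
    (indicator x o l).Does W s (7 * P.n + 4) (fun s' => P.IsIndicator (s'.arr x) ↑(F i)) := by
  classical
  have hnW : P.n < W := hn ▸ hs.1 0
  obtain ⟨t1, s1, r1, b1, -, h1, -⟩ := does_fill (W := W) (a := x) (r := 21) (b := P.n)
    (hi := .var 0) (e := .lit 0) (fun _ => 0) hs hnW (fun s' h1 _ => by simpa [Expr.eval, h1] using hn)
    (fun s' _ _ v _ _ _ _ => ⟨rfl, by omega⟩)
  have eo : s1.arr o = s.arr o := r1.arr_eq (by simp [fill, forLoop, loop, wa, hxo])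
  have el : s1.arr l = s.arr l := r1.arr_eq (by simp [fill, forLoop, loop, wa, hxl])
  have e26 : s1.reg 26 = i := (r1.reg_eq (by simp [fill, forLoop, loop, wr])).trans hi
  obtain ⟨t2, s2, r2, b2, -, h2⟩ := does_scatter (W := W) (a := x) (r := 21)
    (elo := .get o (.var 26)) (hi := .get o (.bin .add (.var 26) (.lit 1))) (p := .lit 1)
    (i := .get l (.var 21)) (e := .lit 1) (s := s1) (lo := s.arr o i) (b := s.arr o ((i : ℕ) + 1))
    (v := 1) (fun _ => True) (s.arr l) (r1.fits hs) (hs.2 _ _) (by simp [Expr.eval, eo, e26])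
    (hF.2 i).1 hW (fun s' h1 h2 => by simp [Expr.eval, Op.eval, h1, h2 o hxo, eo, e26])
    (fun s' h1 h2 j h3 h4 hf hj => ⟨by simp [Expr.eval], fun _ => ⟨by
      simp [Expr.eval, h2 l hxl, el, hj], hs.2 _ _, rfl⟩⟩)
  have hcard : (F i).card ≤ P.n := by simpa using card_le_univ (F i)
  have hce := hF.card_eq i
  refine ⟨_, s2, .seq _ _ _ _ _ _ _ r1 r2, by omega, fun v => ⟨fun hv => ?_, fun hv => ?_⟩⟩
  · obtain ⟨e, h3, h4, h5⟩ := hF.exists_pos hv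
    rw [h2, if_pos ⟨e, h3, h4, trivial, h5⟩]
  · rw [h2, if_neg, h1 v v.2]
    rintro ⟨e, h3, h4, -, h5⟩
    obtain ⟨w, hw, hwe⟩ := hF.exists_elt h3 h4
    have : w = v := Fin.ext (hwe.symm.trans h5)
    exact hv (this ▸ hw)

/-- The indicator in `arr 24` of the attractor of the set with the indicator `arr 31`. -/
def attractor : Cmd :=
  .seq (fill 21 21 (.var 20) (.get 20 (.var 21))) (.seq (fill 22 21 (.var 20) (.get 2 (.var 21)))
    (.seq (.set 22 (.var 0)) (.seq (fill 23 21 (.var 0) (.lit 0))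
      (.seq (accum 23 21 (.var 20) (.get 20 (.var 21)) (.lit 1))
        (.seq (fill 23 21 (.var 0) (.bin .mul (.bin .sub (.lit 1) (.get 31 (.var 21)))
          (.bin .add (.get 0 (.var 21)) (.bin .mul (.bin .sub (.lit 1) (.get 0 (.var 21)))
            (.get 23 (.var 21)))))) closure)))))

/-- The arithmetic expression stored in array `23` is the threshold from
`mem_thrClosure_iff_mem_attr`: `0` on `U`, `1` at the other random vertices, and the out-degree
elsewhere. -/
theorem does_attractor {W : ℕ} {P : MDP} {s : State} (hs : s.Fits W) (h : P.Loaded s) (hW : 1 < W)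
    {U : Set (Fin P.n)} (hU : P.IsIndicator (s.arr 31) U) :
    attractor.Does W s (110 * P.m) (fun s' => P.IsIndicator (s'.arr 24) (P.attr U)) := by
  classical
  have hnW := h.n_lt hs
  have hmW := h.m_lt hs
  have hnm := P.n_le_m
  have hm0 := P.m_pos
  obtain ⟨t1, s1, r1, b1, -, h1, -⟩ := does_fill (W := W) (a := 21) (r := 21) (b := P.m)
    (hi := .var 20) (e := .get 20 (.var 21)) (s.arr 20) hs hmW
    (fun s' h1 _ => by simpa [Expr.eval, h1] using h.m_eq)
    (fun s' _ h2 v _ _ hr _ => ⟨by simp [Expr.eval, hr, h2], hs.2 _ _⟩)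
  have H1 := h.of_runs r1 (by decide) (by decide)
  obtain ⟨t2, s2, r2, b2, -, h2, -⟩ := does_fill (W := W) (a := 22) (r := 21) (b := P.m)
    (hi := .var 20) (e := .get 2 (.var 21)) (s1.arr 2) (r1.fits hs) hmW
    (fun s' h1 _ => by simpa [Expr.eval, h1] using H1.m_eq)
    (fun s' _ h2 v _ _ hr _ => ⟨by simp [Expr.eval, hr, h2], (r1.fits hs).2 _ _⟩)
  have H2 := H1.of_runs r2 (by decide) (by decide)
  have F2 := r2.fits (r1.fits hs)
  have r3 := Runs.set (W := W) 22 (.var 0) s2 (F2.1 _)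
  have H3 := H2.of_runs r3 (by decide) (by decide)
  have F3 := r3.fits F2
  set s3 := s2.setReg 22 ((Expr.var 0).eval s2) with hs3
  obtain ⟨t4, s4, r4, b4, -, h4, -⟩ := does_fill (W := W) (a := 23) (r := 21) (b := P.n)
    (hi := .var 0) (e := .lit 0) (fun _ => 0) F3 hnW
    (fun s' h1 _ => by simpa [Expr.eval, h1] using H3.n_eq) (fun s' _ _ v _ _ _ _ => ⟨rfl, by omega⟩)
  have H4 := H3.of_runs r4 (by decide) (by decide)
  have F4 := r4.fits F3
  obtain ⟨t5, s5, r5, b5, -, h5⟩ := does_accum (W := W) (a := 23) (r := 21) (b := P.m)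
    (hi := .var 20) (i := .get 20 (.var 21)) (e := .lit 1) (s4.arr 20) (fun _ => 1) F4 hmW
    (fun s' h1 _ => by simpa [Expr.eval, h1] using H4.m_eq)
    (fun s' _ h2 j _ _ hr => ⟨by simp [Expr.eval, hr, h2], rfl, F4.2 _ _⟩)
    (fun j hj => by
      rw [h4 _ (H4.src_lt hj), zero_add, ← card_eq_sum_ones]
      exact ((card_filter_le _ _).trans (card_range _).le).trans_lt hmW)
  have H5 := H4.of_runs r5 (by decide) (by decide)
  have F5 := r5.fits F4
  have a31 : s5.arr 31 = s.arr 31 := by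
    rw [r5.arr_eq (by decide), r4.arr_eq (by decide), r3.arr_eq (by decide), r2.arr_eq (by decide),
      r1.arr_eq (by decide)]
  have a0 : ∀ v : Fin P.n, (v ∈ P.VR → s5.arr 0 v = 1) ∧ (v ∉ P.VR → s5.arr 0 v = 0) := by
    intro v
    have := H5.input.2.1 v
    exact ⟨fun hv => by simpa [hv] using this, fun hv => by simpa [hv] using this⟩
  obtain ⟨t6, s6, r6, b6, -, h6, -⟩ := does_fill (W := W) (a := 23) (r := 21) (b := P.n)
    (hi := .var 0) (e := .bin .mul (.bin .sub (.lit 1) (.get 31 (.var 21)))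
          (.bin .add (.get 0 (.var 21)) (.bin .mul (.bin .sub (.lit 1) (.get 0 (.var 21)))
            (.get 23 (.var 21))))) (s := s5)
    (fun v => (1 - s5.arr 31 v) * (s5.arr 0 v + (1 - s5.arr 0 v) * s5.arr 23 v)) F5 hnW
    (fun s' h1 _ => by simpa [Expr.eval, h1] using H5.n_eq)
    (fun s' _ h2 v hv _ hr he => by
      refine ⟨by simp [Expr.eval, Op.eval, hr, h2, he], ?_⟩
      have hf := F5.2 23 v
      by_cases hU' : (⟨v, hv⟩ : Fin P.n) ∈ U
      · have := (hU ⟨v, hv⟩).1 hU'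
        rw [a31]
        simp only at this
        simp [this]
        omega
      · have := (hU ⟨v, hv⟩).2 hU'
        rw [a31]
        simp only at this
        by_cases hR : (⟨v, hv⟩ : Fin P.n) ∈ P.VR
        · have h0 := (a0 ⟨v, hv⟩).1 hR
          simp only at h0
          simp [this, h0, hW]
        · have h0 := (a0 ⟨v, hv⟩).2 hR
          simp only at h0
          simp [this, h0, hf])
  have H6 := H5.of_runs r6 (by decide) (by decide)
  have F6 := r6.fits F5
  have e21 : ∀ e < P.m, s6.arr 21 e = s6.arr 20 e := by
    intro e he
    rw [r6.arr_eq (by decide), r5.arr_eq (by decide), r4.arr_eq (by decide), r3.arr_eq (by decide),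
      r2.arr_eq (by decide), h1 e he, r6.arr_eq (by decide), r5.arr_eq (by decide),
      r4.arr_eq (by decide), r3.arr_eq (by decide), r2.arr_eq (by decide), r1.arr_eq (by decide)]
  have e22 : ∀ e < P.m, s6.arr 22 e = s6.arr 2 e := by
    intro e he
    rw [r6.arr_eq (by decide), r5.arr_eq (by decide), r4.arr_eq (by decide), r3.arr_eq (by decide),
      h2 e he, r6.arr_eq (by decide), r5.arr_eq (by decide),
      r4.arr_eq (by decide), r3.arr_eq (by decide), r2.arr_eq (by decide)]
  have N22 : s6.reg 22 = P.n := by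
    rw [r6.reg_eq (by decide), r5.reg_eq (by decide), r4.reg_eq (by decide)]
    simpa [hs3, State.setReg, Expr.eval] using H2.n_eq
  obtain ⟨t7, s7, r7, b7, h7⟩ := does_closure F6 N22 H6.m_eq hW
    (fun e he => e21 e he ▸ H6.src_lt he) (fun e he => e22 e he ▸ H6.dst_lt he)
  refine ⟨_, s7, .seq _ _ _ _ _ _ _ r1 (.seq _ _ _ _ _ _ _ r2 (.seq _ _ _ _ _ _ _ r3
    (.seq _ _ _ _ _ _ _ r4 (.seq _ _ _ _ _ _ _ r5 (.seq _ _ _ _ _ _ _ r6 r7))))), by omega, ?_⟩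
  intro v
  rw [h7 v v.2, MDP.mem_thrClosure_iff_mem_attr (H6.edgeList.congr e21 e22) (U := U)]
  · exact ⟨fun h => if_pos h, fun h => if_neg h⟩
  intro v
  rw [h6 v v.2, a31]
  have hcnt : s5.arr 23 v = #{e ∈ range P.m | s6.arr 21 e = v} := by
    rw [h5, h4 v v.2, zero_add, ← card_eq_sum_ones]
    congr 1
    refine filter_congr fun e he => ?_
    rw [e21 e (mem_range.1 he), r6.arr_eq (by decide), r5.arr_eq (by decide)]
  rw [hcnt]
  split_ifs with h8 h9
  · simp [(hU v).1 h8]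
  · simp [(hU v).2 h8, (a0 v).1 h9]
  · simp [(hU v).2 h8, (a0 v).2 h9]

/-- The new position of the edge `reg 21` is `reg 27`; it is kept iff the value of this expression
is positive. The set of the vertices whose edges are replaced by loops has the indicator `arr 24`. -/
def keepExpr : Expr :=
  .bin .add (.bin .mul (.get 24 (.get 20 (.var 21))) (.bin .eq (.var 21) (.get 1 (.get 20 (.var 21)))))
    (.bin .mul (.bin .sub (.lit 1) (.get 24 (.get 20 (.var 21))))
      (.bin .sub (.lit 1) (.get 24 (.get 2 (.var 21)))))

/-- The new target of the edge `reg 21`. -/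
def targetExpr : Expr :=
  .bin .add (.bin .mul (.get 24 (.get 20 (.var 21))) (.get 20 (.var 21)))
    (.bin .mul (.bin .sub (.lit 1) (.get 24 (.get 20 (.var 21)))) (.get 2 (.var 21)))

def restrictStep : Cmd :=
  .seq (.put 34 (.var 21) (.var 27)) (.ite keepExpr (.seq (.put 102 (.var 27) targetExpr)
    (.set 27 (.bin .add (.var 27) (.lit 1)))) skip)

/-- Write the restriction of the MDP to the complement of the set with the indicator `arr 24` into
the memory from `100` on. -/
def restrict : Cmd :=
  .seq (fill 100 21 (.var 0) (.bin .mul (.get 0 (.var 21)) (.bin .sub (.lit 1) (.get 24 (.var 21)))))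
    (.seq (.set 27 (.lit 0)) (.seq (restrictStep.forLoop 21 (.lit 0) (.var 20))
      (.seq (.put 34 (.var 20) (.var 27))
        (.seq (fill 101 21 (.bin .add (.var 0) (.lit 1)) (.get 34 (.get 1 (.var 21))))
          (.set 100 (.var 0))))))

/-- The value of `keepExpr`. -/
def keepVal (s : State) (e : ℕ) : ℕ :=
  s.arr 24 (s.arr 20 e) * (if e = s.arr 1 (s.arr 20 e) then 1 else 0) +
    (1 - s.arr 24 (s.arr 20 e)) * (1 - s.arr 24 (s.arr 2 e))

/-- The value of `targetExpr`. -/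
def targetVal (s : State) (e : ℕ) : ℕ :=
  s.arr 24 (s.arr 20 e) * s.arr 20 e + (1 - s.arr 24 (s.arr 20 e)) * s.arr 2 e

/-- Array `34` receives the number of kept edges before each edge; the new offset of a vertex is
this number at its old offset. -/
theorem does_restrictStep {W b : ℕ} {s : State} (hs : s.Fits W) (hb : b < W) (h20 : s.reg 20 = b)
    (ht : ∀ e < b, targetVal s e < W) :
    (restrictStep.forLoop 21 (.lit 0) (.var 20)).Does W (s.setReg 27 0) (6 * b + 2) (fun s' =>
      s'.reg 27 = Nat.count (fun e => keepVal s e ≠ 0) b ∧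
      (∀ e < b, s'.arr 34 e = Nat.count (fun e => keepVal s e ≠ 0) e) ∧
      ∀ e < b, keepVal s e ≠ 0 →
        s'.arr 102 (Nat.count (fun e => keepVal s e ≠ 0) e) = targetVal s e) := by
  have hset : Runs W (.set 27 (.lit 0)) s 1 (s.setReg 27 0) :=
    .set 27 (.lit 0) s (by simp only [Expr.eval]; omega)
  refine (does_forLoop (W := W) (lo := 0) (b := b) (K := 4)
    (fun j s' => s'.reg 27 = Nat.count (fun e => keepVal s e ≠ 0) j ∧
      (∀ e < j, s'.arr 34 e = Nat.count (fun e => keepVal s e ≠ 0) e) ∧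
      ∀ e < j, keepVal s e ≠ 0 →
        s'.arr 102 (Nat.count (fun e => keepVal s e ≠ 0) e) = targetVal s e)
    rfl (Nat.zero_le _) ⟨by simp [State.setReg], by simp, by simp⟩ (hset.fits hs)
    (fun j s' hf _ => by
      simp only [Expr.eval]
      rw [hf.1 20 (by decide)]
      simpa [State.setReg] using h20) hb ?_).mono (by omega) (fun t s' _ h => h.2.1)
  rintro j s' - hj hf hW hr ⟨i1, i2, i3⟩
  have hle : Nat.count (fun e => keepVal s e ≠ 0) j ≤ j := Nat.count_le _
  have a1 : s'.arr 1 = s.arr 1 := hf.2 1 (by decide)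
  have a2 : s'.arr 2 = s.arr 2 := hf.2 2 (by decide)
  have a20 : s'.arr 20 = s.arr 20 := hf.2 20 (by decide)
  have a24 : s'.arr 24 = s.arr 24 := hf.2 24 (by decide)
  set c := Nat.count (fun e => keepVal s e ≠ 0) with hc
  set s1 := s'.setArr 34 j (c j) with hs1
  have hk : keepExpr.eval s1 = keepVal s j := by
    simp [keepExpr, Expr.eval, Op.eval, keepVal, hs1, State.setArr, hr, a1, a2, a20, a24]
  have htg : targetExpr.eval s1 = targetVal s j := by
    simp [targetExpr, Expr.eval, Op.eval, targetVal, hs1, State.setArr, hr, a2, a20, a24]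
  have hex : (Cmd.put 34 (.var 21) (.var 27)).exec s' = s1 := by
    simp [exec, Expr.eval, hr, i1, hs1]
  have r27 : s1.reg 27 = c j := i1
  have r21 : s1.reg 21 = j := hr
  have hsucc : c (j + 1) = c j + if keepVal s j ≠ 0 then 1 else 0 := Nat.count_succ _ _
  have h34 : ∀ e < j + 1, s1.arr 34 e = c e := by
    intro e he
    rcases Nat.lt_succ_iff_lt_or_eq.1 he with h | rfl
    · simp [hs1, State.setArr, Function.update_of_ne h.ne, i2 e h]
    · simp [hs1, State.setArr]
  have h102 : s1.arr 102 = s'.arr 102 := by simp [hs1, State.setArr]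
  by_cases hkeep : keepVal s j = 0
  · refine Ok.does ⟨?_, ?_⟩ ?_
    · simp only [Ok, Expr.eval, hr, i1]
      omega
    · rw [hex]
      simp only [Ok, hk, if_pos hkeep, skip, Expr.eval]
      exact hs1 ▸ hW.1 21
    · have h2 : restrictStep.exec s' = s1.setReg 21 j := by
        rw [restrictStep, exec, hex]
        simp [exec, hk, hkeep, skip, Expr.eval, r21]
      rw [h2]
      rw [if_neg (not_not.2 hkeep), add_zero] at hsucc
      refine ⟨by simp [State.setReg], by simpa [State.setReg, hsucc] using r27, h34, ?_⟩
      intro e he hek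
      rcases Nat.lt_succ_iff_lt_or_eq.1 he with h | rfl
      · exact (congrFun h102 _).trans (i3 e h hek)
      · exact absurd hkeep hek
  · refine Ok.does ⟨?_, ?_⟩ ?_
    · simp only [Ok, Expr.eval, hr, i1]
      omega
    · rw [hex]
      simp only [Ok, hk, if_neg hkeep]
      refine ⟨⟨?_, htg ▸ ht j hj⟩, ?_⟩
      · simp only [Expr.eval, r27]
        omega
      · simp only [exec, Expr.eval, Op.eval, State.setArr, r27]
        omega
    · have h2 : restrictStep.exec s' =
          (s1.setArr 102 (c j) (targetVal s j)).setReg 27 (c j + 1) := by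
        rw [restrictStep, exec, hex]
        have h3 : (s1.setArr 102 (c j) (targetVal s j)).reg 27 = c j := r27
        simp [exec, hk, hkeep, Expr.eval, Op.eval, htg, r27, h3]
      rw [h2]
      rw [if_pos hkeep] at hsucc
      refine ⟨?_, by simp [State.setReg, hsucc], fun e he => ?_,
        fun e he hek => ?_⟩
      · simp only [State.setReg, ne_eq, Nat.reduceEqDiff, not_false_eq_true, Function.update_of_ne]
        exact r21
      · simpa [State.setReg, State.setArr] using h34 e he
      · simp only [State.setReg, State.setArr, Function.update_self]
        rcases Nat.lt_succ_iff_lt_or_eq.1 he with h | rfl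
        -- The count grows at each kept edge, so earlier entries are not overwritten.
        · have : c e < c j := Nat.count_strict_mono hek h
          rw [Function.update_of_ne this.ne]
          exact (congrFun h102 _).trans (i3 e h hek)
        · rw [Function.update_self]

theorem does_restrict {W : ℕ} {P : MDP} {s : State} (hs : s.Fits W) (h : P.Loaded s)
    (hW : P.n + 1 < W) {R : Set (Fin P.n)} (hR : P.AttrClosed R)
    (hI : P.IsIndicator (s.arr 24) R) :
    restrict.Does W s (25 * P.m) (fun s' => (P.restrict R hR).Input s'.pull) := by
  classical
  have hmW := h.m_lt hs
  have hnm := P.n_le_m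
  have hm0 := P.m_pos
  have hI' : ∀ v : Fin P.n, s.arr 24 v = if v ∈ R then 1 else 0 := by
    intro v
    split_ifs with hv
    · exact (hI v).1 hv
    · exact (hI v).2 hv
  obtain ⟨t1, s1, r1, b1, -, h1, -⟩ := does_fill (W := W) (a := 100) (r := 21) (b := P.n)
    (hi := .var 0) (e := .bin .mul (.get 0 (.var 21)) (.bin .sub (.lit 1) (.get 24 (.var 21))))
    (s := s) (fun v => s.arr 0 v * (1 - s.arr 24 v)) hs (by omega)
    (fun s' h1 _ => by simpa [Expr.eval, h1] using h.n_eq)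
    (fun s' _ h2 v _ _ hr _ => ⟨by simp [Expr.eval, Op.eval, hr, h2], 
      ((Nat.mul_le_mul_left _ (Nat.sub_le 1 _)).trans_eq (mul_one _)).trans_lt (hs.2 0 v)⟩)
  have H1 := h.of_runs r1 (by decide) (by decide)
  have F1 := r1.fits hs
  have ha1 : s1.arr 24 = s.arr 24 := r1.arr_eq (by decide)
  have r2 : Runs W (.set 27 (.lit 0)) s1 1 (s1.setReg 27 0) :=
    .set 27 (.lit 0) s1 (by simp only [Expr.eval]; omega)
  have hsrc : ∀ e < P.m, ∃ v w : Fin P.n, s1.arr 20 e = v ∧ s1.arr 2 e = w := fun e he =>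
    let ⟨v, w, h1, h2, _⟩ := H1.edgeList.edge e he
    ⟨v, w, h1, h2⟩
  have hkv : ∀ e < P.m, ∀ v w : Fin P.n, s1.arr 20 e = v → s1.arr 2 e = w →
      (v ∈ R → keepVal s1 e = (if e = s1.arr 1 v then 1 else 0) ∧ targetVal s1 e = v) ∧
      (v ∉ R → keepVal s1 e = (if w ∈ R then 0 else 1) ∧ targetVal s1 e = w) := by
    intro e _ v w hv hw
    refine ⟨fun hvR => ?_, fun hvR => ?_⟩
    · simp [keepVal, targetVal, hv, ha1, (hI v).1 hvR]
    · simp only [keepVal, targetVal, hv, hw, ha1, (hI v).2 hvR, hI' w]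
      split_ifs <;> simp
  obtain ⟨t3, s3, r3, b3, c1, c2, c3⟩ := does_restrictStep (W := W) (b := P.m) F1 hmW H1.m_eq
    (fun e he => by
      obtain ⟨v, w, hv, hw⟩ := hsrc e he
      obtain ⟨k1, k2⟩ := hkv e he v w hv hw
      have hv' := v.2
      have hw' := w.2
      by_cases hvR : v ∈ R
      · rw [(k1 hvR).2]; omega
      · rw [(k2 hvR).2]; omega)
  set c := Nat.count (fun e => keepVal s1 e ≠ 0) with hc
  have F3 := r3.fits (r2.fits F1)
  have hcm : c P.m ≤ P.m := Nat.count_le _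
  have H3 : P.Loaded s3 := (H1.of_runs r2 (by decide) (by decide)).of_runs r3 (by decide) (by decide)
  -- The entry at position `m` is needed for the final offset, which belongs to the index `n`.
  have r4 := Runs.put (W := W) 34 (.var 20) (.var 27) s3 (F3.1 _) (F3.1 _)
  have F4 := r4.fits F3
  have H4 := H3.of_runs r4 (by decide) (by decide)
  set s4 := s3.setArr 34 ((Expr.var 20).eval s3) ((Expr.var 27).eval s3) with hs4
  have h34 : ∀ e ≤ P.m, s4.arr 34 e = c e := by
    intro e he
    simp only [hs4, State.setArr, Expr.eval, H3.m_eq, c1, Function.update_self]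
    rcases he.lt_or_eq with he | rfl
    · rw [Function.update_of_ne he.ne, c2 e he]
    · rw [Function.update_self]
  obtain ⟨t5, s5, r5, b5, -, h5, -⟩ := does_fill (W := W) (a := 101) (r := 21) (b := P.n + 1)
    (hi := .bin .add (.var 0) (.lit 1)) (e := .get 34 (.get 1 (.var 21))) (s := s4)
    (fun v => s4.arr 34 (s4.arr 1 v)) F4 hW
    (fun s' h1 _ => by simpa [Expr.eval, Op.eval, h1] using H4.n_eq)
    (fun s' _ h2 v _ _ hr _ => ⟨by simp [Expr.eval, hr, h2], F4.2 _ _⟩)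
  have H5 := H4.of_runs r5 (by decide) (by decide)
  have F5 := r5.fits F4
  have r6 := Runs.set (W := W) 100 (.var 0) s5 (F5.1 _)
  refine ⟨_, _, .seq _ _ _ _ _ _ _ r1 (.seq _ _ _ _ _ _ _ r2 (.seq _ _ _ _ _ _ _ r3
    (.seq _ _ _ _ _ _ _ r4 (.seq _ _ _ _ _ _ _ r5 r6)))), by omega, ?_, ?_, ?_⟩
  · have e0 : (s5.setReg 100 ((Expr.var 0).eval s5)).pull.reg 0 = s5.reg 0 := by
      simp [State.pull, State.setReg, Expr.eval]
    exact e0.trans H5.n_eq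
  · intro (v : Fin P.n)
    have e100 : s5.arr 100 = s1.arr 100 := by
      rw [r5.arr_eq (by decide), r4.arr_eq (by decide), r3.arr_eq (by decide),
        r2.arr_eq (by decide)]
    have hv := h.input.2.1 v
    have key : s5.arr 100 v = if v ∈ P.VR ∧ v ∉ R then 1 else 0 := by
      rw [e100, h1 v v.2, hv, hI' v]
      split_ifs <;> simp_all
    refine key.trans ?_
    have := MDP.mem_VR_restrict hR (v := v)
    by_cases h6 : v ∈ P.VR ∧ v ∉ R
    · exact (if_pos h6).trans (if_pos (this.2 h6)).symm
    · exact (if_neg h6).trans (if_neg (fun h => h6 (this.1 h))).symm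
  · have hL1 : ListsFamily (s1.arr 1) (s1.arr 2) P.succ := H1.input.2.2
    have e102 : s5.arr 102 = s3.arr 102 := by
      rw [r5.arr_eq (by decide), r4.arr_eq (by decide)]
    have e1 : s4.arr 1 = s1.arr 1 := by
      rw [r4.arr_eq (by decide), r3.arr_eq (by decide), r2.arr_eq (by decide)]
    have hm : s1.arr 1 P.n = P.m := hL1.off_eq_sum
    have hlt : ∀ v : Fin P.n, s1.arr 1 v < s1.arr 1 ((v : ℕ) + 1) := fun v => by
      have h1 := hL1.card_eq v
      have h2 := card_pos.2 (P.succ_nonempty v)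
      omega
    have hle : ∀ v : Fin P.n, s1.arr 1 ((v : ℕ) + 1) ≤ P.m := fun v =>
      hm ▸ hL1.off_mono (Nat.succ_le_of_lt v.2) le_rfl
    have hmem : ∀ v : Fin P.n, ∀ e, s1.arr 1 v ≤ e → e < s1.arr 1 ((v : ℕ) + 1) →
        e < P.m ∧ s1.arr 20 e = v := fun v e he1 he2 =>
      ⟨he2.trans_le (hle v), H1.src v e he1 he2⟩
    refine MDP.listsFamily_restrict hL1 hR (keep := fun e => keepVal s1 e ≠ 0) ?_ ?_
    · intro v e he1 he2
      obtain ⟨hem, hv⟩ := hmem v e he1 he2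
      obtain ⟨-, w, -, hw⟩ := hsrc e hem
      obtain ⟨k1, k2⟩ := hkv e hem v w hv hw
      refine ⟨fun hvR => ⟨?_, ?_⟩, fun hvR w' hw' => ?_⟩
      · rw [(k1 hvR).1]
        simp
      · obtain ⟨hom, hov⟩ := hmem v _ le_rfl (hlt v)
        obtain ⟨-, w0, -, hw0⟩ := hsrc _ hom
        obtain ⟨k3, -⟩ := hkv _ hom v w0 hov hw0
        change s5.arr 102 (c (s1.arr 1 v)) = v
        rw [e102, c3 _ hom (by rw [(k3 hvR).1]; simp), (k3 hvR).2]
      · have : w' = w := Fin.ext (hw'.symm.trans hw)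
        subst this
        refine ⟨?_, fun hk => ?_⟩
        · rw [(k2 hvR).1]
          simp
        · change s5.arr 102 (c e) = w'
          rw [e102, c3 _ hem hk, (k2 hvR).2]
    · intro v hv
      change s5.arr 101 v = c (s1.arr 1 v)
      rw [h5 v (by omega), h34 _ (by rw [e1, ← hm]; exact hL1.off_mono hv le_rfl), e1]

end Cmd

/-- With the word bound `W`, the program `A` computes the decomposition of every MDP that is not
larger than `P` within `T` steps. -/
def Cmd.Decomposes (A : Cmd) (P : MDP) (W T : ℕ) : Prop :=
  ∀ Q : MDP, Q.n ≤ P.n → Q.m ≤ P.m → ∀ s : State, s.Fits W → Q.Input s →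
    A.Does W s T Q.OutputsMECs

/-! ### Decomposition, marking of Rabin cores, almost-sure reachability -/

namespace Cmd

variable {W T : ℕ} {A : Cmd} {P : MDP} {s : State}

/-- Compute the decomposition of the restriction of the MDP to the complement of the set with the
indicator `arr 24`; the result is in `arr 107`. -/
def decompose (A : Cmd) : Cmd := .seq restrict A.shift

theorem wr_decompose {x : ℕ} (h : x ∈ (decompose A).wr) : x ∈ [21, 27] ∨ 100 ≤ x :=
  (List.mem_append.1 h).elim
    ((show ∀ x ∈ restrict.wr, x ∈ [21, 27] ∨ 100 ≤ x by decide) x)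
    fun h => .inr (le_of_mem_wr_shift h)

theorem wa_decompose {x : ℕ} (h : x ∈ (decompose A).wa) : x ∈ [34] ∨ 100 ≤ x :=
  (List.mem_append.1 h).elim
    ((show ∀ x ∈ restrict.wa, x ∈ [34] ∨ 100 ≤ x by decide) x)
    fun h => .inr (le_of_mem_wa_shift h)

/-- The decomposition program tolerates arbitrary contents outside its input, so its memory is not
cleaned between calls. -/
theorem does_decompose (hs : s.Fits W) (h : P.Loaded s) (hW : P.n + 1 < W)
    (hA : A.Decomposes P W T) {R : Set (Fin P.n)} (hR : P.AttrClosed R)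
    (hI : P.IsIndicator (s.arr 24) R) :
    (decompose A).Does W s (25 * P.m + T)
      (fun s' => (P.restrict R hR).IsLabelling (s'.arr 107)) := by
  obtain ⟨t1, s1, r1, b1, h1⟩ := does_restrict hs h hW hR hI
  have F1 := r1.fits hs
  obtain ⟨t2, s2, r2, b2, h2⟩ := hA (P.restrict R hR) le_rfl (MDP.m_restrict_le hR) s1.pull
    ⟨fun x => F1.1 _, fun a i => F1.2 _ _⟩ h1
  obtain ⟨s3, r3, h3⟩ := r2.shift rfl
  refine ⟨_, s3, .seq _ _ _ _ _ _ _ r1 r3, by omega, ?_⟩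
  subst h3
  exact h2

/-- Load the MDP and compute its decomposition, which is stored in `arr 29`. -/
def prepare (A : Cmd) : Cmd :=
  .seq load (.seq (fill 24 21 (.var 0) (.lit 0)) (.seq (decompose A)
    (fill 29 21 (.var 0) (.get 107 (.var 21)))))

theorem wr_prepare {x : ℕ} (h : x ∈ (prepare A).wr) : x ∈ [20, 21, 25, 27] ∨ 100 ≤ x := by
  simp only [prepare, wr, List.mem_append] at h
  rcases h with h | h | h | h
  · exact .inl ((show ∀ x ∈ load.wr, x ∈ [20, 21, 25, 27] by decide) x h)
  · exact .inl ((show ∀ x ∈ (fill 24 21 (.var 0) (.lit 0)).wr, x ∈ [20, 21, 25, 27] by decide) x h)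
  · exact (wr_decompose h).imp_left ((show ∀ x ∈ [21, 27], x ∈ [20, 21, 25, 27] by decide) x)
  · exact .inl ((show ∀ x ∈ (fill 29 21 (.var 0) (.get 107 (.var 21))).wr,
      x ∈ [20, 21, 25, 27] by decide) x h)

theorem wa_prepare {x : ℕ} (h : x ∈ (prepare A).wa) : x ∈ [20, 24, 29, 34] ∨ 100 ≤ x := by
  simp only [prepare, wa, List.mem_append] at h
  rcases h with h | h | h | h
  · exact .inl ((show ∀ x ∈ load.wa, x ∈ [20, 24, 29, 34] by decide) x h)
  · exact .inl ((show ∀ x ∈ (fill 24 21 (.var 0) (.lit 0)).wa, x ∈ [20, 24, 29, 34] by decide) x h)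
  · exact (wa_decompose h).imp_left ((show ∀ x ∈ [34], x ∈ [20, 24, 29, 34] by decide) x)
  · exact .inl ((show ∀ x ∈ (fill 29 21 (.var 0) (.get 107 (.var 21))).wa,
      x ∈ [20, 24, 29, 34] by decide) x h)

theorem loaded_decompose {s' : State} {t : ℕ} (h : P.Loaded s) (hr : Runs W (decompose A) s t s') :
    P.Loaded s' := by
  refine h.of_runs hr (fun x hx hx' => ?_) (fun x hx hx' => ?_)
  · rcases wr_decompose hx' with h | h <;> simp at hx h <;> omega
  · rcases wa_decompose hx' with h | h <;> simp at hx h <;> omega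

theorem does_prepare (hs : s.Fits W) (h : P.Input s) (hW : P.n + 1 < W)
    (hA : A.Decomposes P W T) :
    (prepare A).Does W s (50 * P.m + T)
      (fun s' => P.Loaded s' ∧ P.IsLabelling (s'.arr 29)) := by
  have hnm := P.n_le_m
  have hm0 := P.m_pos
  obtain ⟨t1, s1, r1, b1, h1⟩ := does_load hs h
  have F1 := r1.fits hs
  obtain ⟨t2, s2, r2, b2, -, h2, -⟩ := does_fill (W := W) (a := 24) (r := 21) (b := P.n)
    (hi := .var 0) (e := .lit 0) (fun _ => 0) F1 (by omega)
    (fun s' e1 _ => by simpa [Expr.eval, e1] using h1.n_eq)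
    (fun s' _ _ v _ _ _ _ => ⟨rfl, by omega⟩)
  have H2 := h1.of_runs r2 (by decide) (by decide)
  have F2 := r2.fits F1
  obtain ⟨t3, s3, r3, b3, h3⟩ := does_decompose F2 H2 hW hA P.attrClosed_empty
    (fun v => ⟨fun h => absurd h (Set.notMem_empty v), fun _ => h2 v v.2⟩)
  have H3 := loaded_decompose H2 r3
  have F3 := r3.fits F2
  -- The labels of `P` are copied, because later calls of `A` overwrite array `107`.
  obtain ⟨t4, s4, r4, b4, -, h4, -⟩ := does_fill (W := W) (a := 29) (r := 21) (b := P.n)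
    (hi := .var 0) (e := .get 107 (.var 21)) (s3.arr 107) F3 (by omega)
    (fun s' e1 _ => by simpa [Expr.eval, e1] using H3.n_eq)
    (fun s' _ e2 v _ _ hr _ => ⟨by simp [Expr.eval, hr, e2], F3.2 _ _⟩)
  refine ⟨_, s4, .seq _ _ _ _ _ _ _ r1 (.seq _ _ _ _ _ _ _ r2 (.seq _ _ _ _ _ _ _ r3 r4)),
    by omega, H3.of_runs r4 (by decide) (by decide), ?_, ?_⟩
  · intro v
    rw [h4 v v.2]
    exact h3.1 v
  · intro u v
    rw [h4 u u.2, h4 v v.2]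
    refine (h3.2 u v).trans (exists_congr fun X => and_congr_left' ?_)
    exact MDP.isMEC_restrict_empty

/-- Given the labelling `arr 107` of the complement of the set with the indicator `arr 24`, add the
vertices in the maximal end-components that meet the set with the indicator `arr 32` to the set with
the indicator `arr 30`. -/
def mark : Cmd :=
  .seq (fill 33 21 (.bin .add (.var 0) (.lit 1)) (.lit 0))
    (.seq (scatter 33 21 (.lit 0) (.var 0)
      (.bin .mul (.bin .sub (.lit 1) (.get 24 (.var 21))) (.get 32 (.var 21)))
      (.get 107 (.var 21)) (.lit 1))
    (fill 30 21 (.var 0) (.bin .lt (.lit 0) (.bin .add (.get 30 (.var 21))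
      (.bin .mul (.bin .mul (.bin .sub (.lit 1) (.get 24 (.var 21)))
        (.bin .lt (.lit 0) (.get 107 (.var 21)))) (.get 33 (.get 107 (.var 21))))))))

theorem does_mark (hs : s.Fits W) (h : P.Loaded s) (hW : P.n + 1 < W) {G : Set (Fin P.n)}
    {L U : Finset (Fin P.n)} (hL : P.IsIndicator (s.arr 32) ↑L)
    (hU : P.IsIndicator (s.arr 24) (P.attr ↑U)) (hG : P.IsIndicator (s.arr 30) G)
    (hlab : (P.restrict (P.attr ↑U) (P.attrClosed_attr _)).IsLabelling (s.arr 107)) :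
    mark.Does W s (20 * P.m) (fun s' => P.IsIndicator (s'.arr 30) (G ∪ P.rabinCore L U)) := by
  classical
  have hnm := P.n_le_m
  have hm0 := P.m_pos
  have hlab1 : ∀ v : Fin P.n, s.arr 107 v ≤ P.n := hlab.1
  have hlab2 : ∀ u v : Fin P.n, (s.arr 107 u ≠ 0 ∧ s.arr 107 u = s.arr 107 v) ↔ ∃ X,
    (P.restrict (P.attr ↑U) (P.attrClosed_attr _)).IsMEC X ∧ u ∈ X ∧ v ∈ X := hlab.2
  -- Array `33` is indexed by the labels `0, …, n`, hence the `n + 1` entries.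
  obtain ⟨t1, s1, r1, b1, -, h1, -⟩ := does_fill (W := W) (a := 33) (r := 21) (b := P.n + 1)
    (hi := .bin .add (.var 0) (.lit 1)) (e := .lit 0) (fun _ => 0) hs hW
    (fun s' e1 _ => by simpa [Expr.eval, Op.eval, e1] using h.n_eq)
    (fun s' _ _ v _ _ _ _ => ⟨rfl, by omega⟩)
  have F1 := r1.fits hs
  have H1 := h.of_runs r1 (by decide) (by decide)
  have a24 : s1.arr 24 = s.arr 24 := r1.arr_eq (by decide)
  have a32 : s1.arr 32 = s.arr 32 := r1.arr_eq (by decide)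
  have a107 : s1.arr 107 = s.arr 107 := r1.arr_eq (by decide)
  have a30 : s1.arr 30 = s.arr 30 := r1.arr_eq (by decide)
  obtain ⟨t2, s2, r2, b2, -, h2⟩ := does_scatter (W := W) (a := 33) (r := 21) (elo := .lit 0)
    (hi := .var 0) (p := .bin .mul (.bin .sub (.lit 1) (.get 24 (.var 21))) (.get 32 (.var 21)))
    (i := .get 107 (.var 21)) (e := .lit 1) (s := s1) (lo := 0) (b := P.n) (v := 1)
    (fun j => (1 - s.arr 24 j) * s.arr 32 j ≠ 0) (s.arr 107) F1 (by omega) rfl (Nat.zero_le _)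
    (by omega) (fun s' e1 _ => by simpa [Expr.eval, e1] using H1.n_eq)
    (fun s' e1 e2 j _ _ _ hr => ⟨by simp [Expr.eval, Op.eval, hr, e2, a24, a32],
      fun _ => ⟨by simp [Expr.eval, hr, e2, a107], hs.2 _ _, rfl⟩⟩)
  have F2 := r2.fits F1
  have H2 := H1.of_runs r2 (by decide) (by decide)
  have c24 : s2.arr 24 = s.arr 24 := (r2.arr_eq (by decide)).trans a24
  have c107 : s2.arr 107 = s.arr 107 := (r2.arr_eq (by decide)).trans a107
  have c30 : s2.arr 30 = s.arr 30 := (r2.arr_eq (by decide)).trans a30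
  -- The label `0` may have been marked by vertices of `L` in no MEC; the factor `0 < label`
  -- discards it.
  obtain ⟨t3, s3, r3, b3, -, h3, -⟩ := does_fill (W := W) (a := 30) (r := 21) (b := P.n)
    (hi := .var 0) (e := .bin .lt (.lit 0) (.bin .add (.get 30 (.var 21))
      (.bin .mul (.bin .mul (.bin .sub (.lit 1) (.get 24 (.var 21)))
        (.bin .lt (.lit 0) (.get 107 (.var 21)))) (.get 33 (.get 107 (.var 21)))))) (s := s2)
    (fun v => if 0 < s.arr 30 v + (1 - s.arr 24 v) * (if 0 < s.arr 107 v then 1 else 0) *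
      s2.arr 33 (s.arr 107 v) then 1 else 0) F2 (by omega)
    (fun s' e1 _ => by simpa [Expr.eval, e1] using H2.n_eq)
    (fun s' _ e2 v _ _ hr e3 => ⟨by simp [Expr.eval, Op.eval, hr, e2, e3, c24, c107, c30], by
      split_ifs <;> omega⟩)
  refine ⟨_, s3, .seq _ _ _ _ _ _ _ r1 (.seq _ _ _ _ _ _ _ r2 r3), by omega, ?_⟩
  intro v
  have h33 : s2.arr 33 (s.arr 107 v) = if ∃ u : Fin P.n, u ∉ P.attr ↑U ∧ u ∈ L ∧
      s.arr 107 u = s.arr 107 v then 1 else 0 := by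
    rw [h2, h1 _ (Nat.lt_succ_of_le (hlab1 v))]
    congr 1
    apply propext
    constructor
    · rintro ⟨j, -, hj, h4, h5⟩
      refine ⟨⟨j, hj⟩, fun h => ?_, by_contra fun h => ?_, h5⟩
      · have := (hU _).1 h
        simp only at this
        simp [this] at h4
      · have := (hL _).2 (mem_coe.not.2 h)
        simp only at this
        simp [this] at h4
    · rintro ⟨u, h4, h5, h6⟩
      refine ⟨u, Nat.zero_le _, u.2, ?_, h6⟩
      rw [(hU u).2 h4, (hL u).1 h5]
      decide
  have hcore : v ∈ P.rabinCore L U ↔ v ∉ P.attr ↑U ∧ s.arr 107 v ≠ 0 ∧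
      ∃ u : Fin P.n, u ∉ P.attr ↑U ∧ u ∈ L ∧ s.arr 107 u = s.arr 107 v := by
    refine and_congr_right fun _ => ⟨?_, ?_⟩
    · rintro ⟨X, hX, hv, u, hu, h4, h5⟩
      obtain ⟨h6, h7⟩ := (hlab2 v u).2 ⟨X, hX, hv, hu⟩
      exact ⟨h6, u, h5, h4, h7.symm⟩
    · rintro ⟨h6, u, h5, h4, h7⟩
      obtain ⟨X, hX, hv, hu⟩ := (hlab2 v u).1 ⟨h6, h7.symm⟩
      exact ⟨X, hX, hv, u, hu, h4, h5⟩
  rw [h3 v v.2, h33, Set.mem_union, hcore]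
  by_cases hvG : v ∈ G
  · simp [hvG, (hG v).1 hvG]
  · rw [(hG v).2 hvG]
    by_cases hvU : v ∈ P.attr ↑U
    · simp [hvG, hvU, (hU v).1 hvU]
    · rw [(hU v).2 hvU]
      by_cases h0 : s.arr 107 v = 0
      · simp [hvG, h0]
      · simp only [hvG, hvU, Nat.pos_of_ne_zero h0]
        split_ifs with h5 <;> simp_all

/-- Given the decomposition `arr 29` of the MDP and the indicator `arr 30` of a set, compute the
indicator `arr 36` of the vertices from which player 1 can almost surely reach a maximal
end-component that meets the set. -/
def reach : Cmd :=
  .seq (fill 28 21 (.var 0) (.bin .add (.get 29 (.var 21))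
      (.bin .mul (.bin .eq (.get 29 (.var 21)) (.lit 0))
        (.bin .add (.bin .add (.var 0) (.lit 1)) (.var 21)))))
    (.seq (fill 21 21 (.var 20) (.get 28 (.get 20 (.var 21))))
    (.seq (fill 22 21 (.var 20) (.get 28 (.get 2 (.var 21))))
    (.seq (.set 22 (.bin .add (.bin .mul (.lit 2) (.var 0)) (.lit 1)))
    (.seq (fill 23 21 (.var 22) (.lit 0))
    (.seq (accum 23 21 (.var 20) (.get 21 (.var 21))
      (.bin .sub (.lit 1) (.bin .eq (.get 21 (.var 21)) (.get 22 (.var 21)))))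
    (.seq (scatter 23 21 (.lit 0) (.var 0)
      (.bin .mul (.get 0 (.var 21)) (.bin .eq (.get 29 (.var 21)) (.lit 0)))
      (.get 28 (.var 21)) (.lit 1))
    (.seq (scatter 23 21 (.lit 0) (.var 0)
      (.bin .mul (.bin .lt (.lit 0) (.get 29 (.var 21))) (.get 30 (.var 21)))
      (.get 29 (.var 21)) (.bin .add (.var 20) (.lit 1)))
    (.seq closure
      (fill 36 21 (.var 0) (.bin .sub (.lit 1) (.get 24 (.get 28 (.var 21)))))))))))))

theorem does_reach (hs : s.Fits W) (h : P.Loaded s) (hW : 2 * P.n + P.m + 2 < W)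
    (hlab : P.IsLabelling (s.arr 29)) {G : Set (Fin P.n)} (hG : P.IsIndicator (s.arr 30) G) :
    reach.Does W s (200 * P.m) (fun s' => P.IsIndicator (s'.arr 36) (P.winOf G)) := by
  classical
  have hnm := P.n_le_m
  have hm0 := P.m_pos
  -- The arithmetic form of `quotientNode`, as evaluated by the program.
  set nd : ℕ → ℕ := fun v => s.arr 29 v + (if s.arr 29 v = 0 then 1 else 0) * (P.n + 1 + v) with hnd
  have hndq : ∀ v : ℕ, nd v = MDP.quotientNode P.n (s.arr 29) v := by
    intro v
    simp only [hnd, MDP.quotientNode]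
    split_ifs with h0 <;> simp [h0]
  have hndlt : ∀ v : Fin P.n, nd v < 2 * P.n + 1 := fun v => hndq v ▸ hlab.quotientNode_lt v
  obtain ⟨t1, s1, r1, b1, -, h1, -⟩ := does_fill (W := W) (a := 28) (r := 21) (b := P.n)
    (hi := .var 0) (e := .bin .add (.get 29 (.var 21))
      (.bin .mul (.bin .eq (.get 29 (.var 21)) (.lit 0))
        (.bin .add (.bin .add (.var 0) (.lit 1)) (.var 21)))) nd hs (by omega)
    (fun s' e1 _ => by simpa [Expr.eval, e1] using h.n_eq)
    (fun s' e1 e2 v hv _ hr _ => ⟨by simp [Expr.eval, Op.eval, hr, e1, e2, h.n_eq, hnd], by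
      have := hndlt ⟨v, hv⟩
      simp only at this
      omega⟩)
  have F1 := r1.fits hs
  have H1 := h.of_runs r1 (by decide) (by decide)
  obtain ⟨t2, s2, r2, b2, -, h2, -⟩ := does_fill (W := W) (a := 21) (r := 21) (b := P.m)
    (hi := .var 20) (e := .get 28 (.get 20 (.var 21))) (fun e => s1.arr 28 (s1.arr 20 e)) F1 (by omega)
    (fun s' e1 _ => by simpa [Expr.eval, e1] using H1.m_eq)
    (fun s' _ e2 v _ _ hr _ => ⟨by simp [Expr.eval, hr, e2], F1.2 _ _⟩)
  have F2 := r2.fits F1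
  have H2 := H1.of_runs r2 (by decide) (by decide)
  obtain ⟨t3, s3, r3, b3, -, h3, -⟩ := does_fill (W := W) (a := 22) (r := 21) (b := P.m)
    (hi := .var 20) (e := .get 28 (.get 2 (.var 21))) (fun e => s2.arr 28 (s2.arr 2 e)) F2 (by omega)
    (fun s' e1 _ => by simpa [Expr.eval, e1] using H2.m_eq)
    (fun s' _ e2 v _ _ hr _ => ⟨by simp [Expr.eval, hr, e2], F2.2 _ _⟩)
  have F3 := r3.fits F2
  have H3 := H2.of_runs r3 (by decide) (by decide)
  have r4 : Runs W (.set 22 (.bin .add (.bin .mul (.lit 2) (.var 0)) (.lit 1))) s3 1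
      (s3.setReg 22 (2 * P.n + 1)) := by
    have e : Expr.eval s3 (.bin .add (.bin .mul (.lit 2) (.var 0)) (.lit 1)) = 2 * P.n + 1 := by
      simp [Expr.eval, Op.eval, H3.n_eq]
    exact e ▸ .set _ _ _ (by omega)
  have F4 := r4.fits F3
  have H4 := H3.of_runs r4 (by decide) (by decide)
  have N4 : (s3.setReg 22 (2 * P.n + 1)).reg 22 = 2 * P.n + 1 := by simp [State.setReg]
  set s4 := s3.setReg 22 (2 * P.n + 1) with hs4
  obtain ⟨t5, s5, r5, b5, -, h5, -⟩ := does_fill (W := W) (a := 23) (r := 21) (b := 2 * P.n + 1)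
    (hi := .var 22) (e := .lit 0) (fun _ => 0) F4 (by omega)
    (fun s' e1 _ => by simpa [Expr.eval, e1] using N4)
    (fun s' _ _ v _ _ _ _ => ⟨rfl, by omega⟩)
  have F5 := r5.fits F4
  have H5 := H4.of_runs r5 (by decide) (by decide)
  have es5 : ∀ e < P.m, s5.arr 21 e = nd (s.arr 20 e) := by
    intro e he
    rw [r5.arr_eq (by decide), r4.arr_eq (by decide), r3.arr_eq (by decide), h2 e he,
      h1 _ (H1.src_lt he), r1.arr_eq (by decide)]
  have ed5 : ∀ e < P.m, s5.arr 22 e = nd (s.arr 2 e) := by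
    intro e he
    rw [r5.arr_eq (by decide), r4.arr_eq (by decide), h3 e he, r2.arr_eq (by decide),
      h1 _ (H2.dst_lt he), r2.arr_eq (by decide), r1.arr_eq (by decide)]
  have eslt : ∀ e < P.m, s5.arr 21 e < 2 * P.n + 1 := fun e he =>
    es5 e he ▸ hndlt ⟨_, h.src_lt he⟩
  have edlt : ∀ e < P.m, s5.arr 22 e < 2 * P.n + 1 := fun e he =>
    ed5 e he ▸ hndlt ⟨_, h.dst_lt he⟩
  obtain ⟨t6, s6, r6, b6, -, h6⟩ := does_accum (W := W) (a := 23) (r := 21) (b := P.m)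
    (hi := .var 20) (i := .get 21 (.var 21))
    (e := .bin .sub (.lit 1) (.bin .eq (.get 21 (.var 21)) (.get 22 (.var 21)))) (s5.arr 21)
    (fun e => if s5.arr 21 e = s5.arr 22 e then 0 else 1) F5 (by omega)
    (fun s' e1 _ => by simpa [Expr.eval, e1] using H5.m_eq)
    (fun s' _ e2 j _ _ hr => ⟨by simp [Expr.eval, hr, e2], by
      simp only [Expr.eval, Op.eval, hr, e2 21 (by decide), e2 22 (by decide)]
      split_ifs <;> rfl, F5.2 _ _⟩)
    (fun j hj => by
      rw [h5 _ (eslt j hj), zero_add]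
      refine lt_of_le_of_lt (sum_le_card_nsmul _ _ 1 fun e _ => ?_) ?_
      · split_ifs <;> omega
      · have := (card_filter_le (range P.m) (fun e => s5.arr 21 e = s5.arr 21 j)).trans
          (card_range _).le
        rw [smul_eq_mul, mul_one]
        omega)
  have F6 := r6.fits F5
  have H6 := H5.of_runs r6 (by decide) (by decide)
  have a0 : s6.arr 0 = s.arr 0 := by
    rw [r6.arr_eq (by decide), r5.arr_eq (by decide), r4.arr_eq (by decide), r3.arr_eq (by decide),
      r2.arr_eq (by decide), r1.arr_eq (by decide)]
  have a28 : s6.arr 28 = s1.arr 28 := by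
    rw [r6.arr_eq (by decide), r5.arr_eq (by decide), r4.arr_eq (by decide), r3.arr_eq (by decide),
      r2.arr_eq (by decide)]
  have a29 : s6.arr 29 = s.arr 29 := by
    rw [r6.arr_eq (by decide), r5.arr_eq (by decide), r4.arr_eq (by decide), r3.arr_eq (by decide),
      r2.arr_eq (by decide), r1.arr_eq (by decide)]
  have a30 : s6.arr 30 = s.arr 30 := by
    rw [r6.arr_eq (by decide), r5.arr_eq (by decide), r4.arr_eq (by decide), r3.arr_eq (by decide),
      r2.arr_eq (by decide), r1.arr_eq (by decide)]
  -- The two scatters override the counts of non-loop edges, first at random vertices in no MEC and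
  -- then at MECs that meet `G`. The nested conditionals of the threshold list these writes from the
  -- last to the first.
  obtain ⟨t7, s7, r7, b7, -, h7⟩ := does_scatter (W := W) (a := 23) (r := 21) (elo := .lit 0)
    (hi := .var 0) (p := .bin .mul (.get 0 (.var 21)) (.bin .eq (.get 29 (.var 21)) (.lit 0)))
    (i := .get 28 (.var 21)) (e := .lit 1) (s := s6) (lo := 0) (b := P.n) (v := 1)
    (fun j => s.arr 0 j * (if s.arr 29 j = 0 then 1 else 0) ≠ 0) (s1.arr 28) F6 (by omega) rfl
    (Nat.zero_le _) (by omega) (fun s' e1 _ => by simpa [Expr.eval, e1] using H6.n_eq)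
    (fun s' e1 e2 j _ _ _ hr => ⟨by simp [Expr.eval, Op.eval, hr, e2, a0, a29],
      fun _ => ⟨by simp [Expr.eval, hr, e2, a28], F1.2 _ _, rfl⟩⟩)
  have F7 := r7.fits F6
  have H7 := H6.of_runs r7 (by decide) (by decide)
  have c29 : s7.arr 29 = s.arr 29 := (r7.arr_eq (by decide)).trans a29
  have c30 : s7.arr 30 = s.arr 30 := (r7.arr_eq (by decide)).trans a30
  obtain ⟨t8, s8, r8, b8, -, h8⟩ := does_scatter (W := W) (a := 23) (r := 21) (elo := .lit 0)
    (hi := .var 0) (p := .bin .mul (.bin .lt (.lit 0) (.get 29 (.var 21))) (.get 30 (.var 21)))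
    (i := .get 29 (.var 21)) (e := .bin .add (.var 20) (.lit 1)) (s := s7) (lo := 0) (b := P.n)
    (v := P.m + 1)
    (fun j => (if 0 < s.arr 29 j then 1 else 0) * s.arr 30 j ≠ 0) (s.arr 29) F7 (by omega) rfl
    (Nat.zero_le _) (by omega) (fun s' e1 _ => by simpa [Expr.eval, e1] using H7.n_eq)
    (fun s' e1 e2 j _ _ _ hr => ⟨by simp [Expr.eval, Op.eval, hr, e2, c29, c30],
      fun _ => ⟨by simp [Expr.eval, hr, e2, c29], hs.2 _ _, by
        simp [Expr.eval, Op.eval, e1, H7.m_eq]⟩⟩)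
  have F8 := r8.fits F7
  have H8 := H7.of_runs r8 (by decide) (by decide)
  have N8 : s8.reg 22 = 2 * P.n + 1 := by
    rw [r8.reg_eq (by decide), r7.reg_eq (by decide), r6.reg_eq (by decide), r5.reg_eq (by decide),
      N4]
  have d21 : s8.arr 21 = s5.arr 21 := by
    rw [r8.arr_eq (by decide), r7.arr_eq (by decide), r6.arr_eq (by decide)]
  have d22 : s8.arr 22 = s5.arr 22 := by
    rw [r8.arr_eq (by decide), r7.arr_eq (by decide), r6.arr_eq (by decide)]
  obtain ⟨t9, s9, r9, b9, h9⟩ := does_closure F8 N8 H8.m_eq (by omega)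
    (fun e he => d21 ▸ eslt e he) (fun e he => d22 ▸ edlt e he)
  have F9 := r9.fits F8
  have H9 := H8.of_runs r9 (by decide) (by decide)
  obtain ⟨t10, s10, r10, b10, -, h10, -⟩ := does_fill (W := W) (a := 36) (r := 21) (b := P.n)
    (hi := .var 0) (e := .bin .sub (.lit 1) (.get 24 (.get 28 (.var 21)))) (s := s9)
    (fun v => 1 - s9.arr 24 (s9.arr 28 v)) F9 (by omega)
    (fun s' e1 _ => by simpa [Expr.eval, e1] using H9.n_eq)
    (fun s' _ e2 v _ _ hr _ => ⟨by simp [Expr.eval, Op.eval, hr, e2], by omega⟩)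
  refine ⟨_, s10, .seq _ _ _ _ _ _ _ r1 (.seq _ _ _ _ _ _ _ r2 (.seq _ _ _ _ _ _ _ r3
    (.seq _ _ _ _ _ _ _ r4 (.seq _ _ _ _ _ _ _ r5 (.seq _ _ _ _ _ _ _ r6
    (.seq _ _ _ _ _ _ _ r7 (.seq _ _ _ _ _ _ _ r8 (.seq _ _ _ _ _ _ _ r9 r10)))))))),
    by omega, ?_⟩
  have a28' : ∀ v : Fin P.n, s9.arr 28 v = nd v := fun v => by
    rw [r9.arr_eq (by decide), r8.arr_eq (by decide), r7.arr_eq (by decide), a28, h1 v v.2]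
  intro v
  have key := hlab.mem_thrClosure_iff_mem_lose (es := s8.arr 21) (ed := s8.arr 22)
    (thr := s8.arr 23) h.edgeList (G := G)
    (fun e he => by rw [d21, es5 e he, hndq]) (fun e he => by rw [d22, ed5 e he, hndq])
    (fun v => by
      have hq := hndq v ▸ hndlt v
      have e1 : (∃ j, 0 ≤ j ∧ j < P.n ∧ (if 0 < s.arr 29 j then 1 else 0) * s.arr 30 j ≠ 0 ∧
          s.arr 29 j = MDP.quotientNode P.n (s.arr 29) v) ↔ ∃ u : Fin P.n, s.arr 29 u ≠ 0 ∧ u ∈ G ∧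
          s.arr 29 u = MDP.quotientNode P.n (s.arr 29) v := by
        constructor
        · rintro ⟨j, -, hj, h11, h12⟩
          refine ⟨⟨j, hj⟩, fun h => h11 ?_, by_contra fun h => h11 ?_, h12⟩
          · simp only at h
            simp [h]
          · have := (hG _).2 h
            simp only at this
            simp [this]
        · rintro ⟨u, h11, h12, h13⟩
          refine ⟨u, Nat.zero_le _, u.2, ?_, h13⟩
          rw [(hG u).1 h12, if_pos (Nat.pos_of_ne_zero h11)]
          decide
      have e2 : (∃ j, 0 ≤ j ∧ j < P.n ∧ s.arr 0 j * (if s.arr 29 j = 0 then 1 else 0) ≠ 0 ∧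
          s1.arr 28 j = MDP.quotientNode P.n (s.arr 29) v) ↔ v ∈ P.VR ∧ s.arr 29 v = 0 := by
        constructor
        · rintro ⟨j, -, hj, h11, h12⟩
          have h0 : s.arr 29 j = 0 := by_contra fun h => h11 (by simp [h])
          rw [h1 j hj, hndq] at h12
          have hjv := hlab.eq_of_quotientNode_eq (u := v) (v := ⟨j, hj⟩) h0 h12.symm
          subst hjv
          refine ⟨by_contra fun h13 => h11 ?_, h0⟩
          have := h.input.2.1 ⟨j, hj⟩
          rw [if_neg h13] at this
          simp only at this
          simp [this]
        · rintro ⟨h11, h12⟩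
          refine ⟨v, Nat.zero_le _, v.2, ?_, by rw [h1 v v.2, hndq]⟩
          rw [h.input.2.1 v, if_pos h11, if_pos h12]
          decide
      rw [h8, d21, d22]
      simp only [e1]
      congr 1
      rw [h7]
      simp only [e2]
      congr 1
      rw [h6, h5 _ hq, zero_add, ← filter_filter, card_filter]
      exact sum_congr rfl fun e _ => by split_ifs <;> simp_all) v
  rw [h10 v v.2, a28', h9 _ (hndlt v), hndq, key, MDP.winOf, Set.mem_compl_iff]
  split_ifs with hl <;> simp [hl]

end Cmd

/-! ### The algorithms -/

namespace Cmd

variable {W T : ℕ} {A : Cmd} {P : MDP} {s : State}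

def clear (x : ℕ) : Cmd := fill x 21 (.var 0) (.lit 0)

theorem does_clear (hs : s.Fits W) (h : P.Loaded s) (x : ℕ) :
    (clear x).Does W s (5 * P.m) (fun s' => P.IsIndicator (s'.arr x) ∅) := by
  have hnm := P.n_le_m
  have hm0 := P.m_pos
  have hnW := h.n_lt hs
  exact (does_fill (fun _ => 0) hs hnW (fun s' e1 _ => by simpa [Expr.eval, e1] using h.n_eq)
    (fun s' _ _ v _ _ _ _ => ⟨rfl, by omega⟩)).mono (by omega) fun t s' _ h' v =>
      ⟨fun hv => absurd hv (Set.notMem_empty v), fun _ => h'.2.1 v v.2⟩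

/-- The union of the sets with the indicators `arr x` and `arr y` replaces the former. -/
def unite (x y : ℕ) : Cmd :=
  fill x 21 (.var 0) (.bin .lt (.lit 0) (.bin .add (.get x (.var 21)) (.get y (.var 21))))

theorem does_unite (hs : s.Fits W) (h : P.Loaded s) (hW : 1 < W) {x y : ℕ} (hxy : y ≠ x)
    {S S' : Set (Fin P.n)} (hS : P.IsIndicator (s.arr x) S) (hS' : P.IsIndicator (s.arr y) S') :
    (unite x y).Does W s (5 * P.m) (fun s' => P.IsIndicator (s'.arr x) (S ∪ S')) := by
  have hnm := P.n_le_m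
  have hm0 := P.m_pos
  have hnW := h.n_lt hs
  refine (does_fill (s := s) (fun v => if 0 < s.arr x v + s.arr y v then 1 else 0) hs hnW
    (fun s' e1 _ => by simpa [Expr.eval, e1] using h.n_eq)
    (fun s' _ e2 v _ _ hr e3 => ⟨by simp [Expr.eval, Op.eval, hr, e3, e2 y hxy], by
      split_ifs <;> omega⟩)).mono (by omega) fun t s' _ h' v => ?_
  rw [h'.2.1 v v.2]
  by_cases h1 : v ∈ S
  · simp [h1, (hS v).1 h1]
  · by_cases h2 : v ∈ S'
    · simp [h2, (hS' v).1 h2]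
    · simp [h1, h2, (hS v).2 h1, (hS' v).2 h2]

def complement (x y : ℕ) : Cmd :=
  fill x 21 (.var 0) (.bin .sub (.lit 1) (.get y (.var 21)))

theorem does_complement (hs : s.Fits W) (h : P.Loaded s) (hW : 1 < W) {x y : ℕ} (hxy : y ≠ x)
    {S : Set (Fin P.n)} (hS : P.IsIndicator (s.arr y) S) :
    (complement x y).Does W s (5 * P.m) (fun s' => P.IsIndicator (s'.arr x) Sᶜ) := by
  have hnm := P.n_le_m
  have hm0 := P.m_pos
  have hnW := h.n_lt hs
  refine (does_fill (s := s) (fun v => 1 - s.arr y v) hs hnW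
    (fun s' e1 _ => by simpa [Expr.eval, e1] using h.n_eq)
    (fun s' _ e2 v _ _ hr _ => ⟨by simp [Expr.eval, Op.eval, hr, e2 y hxy], by omega⟩)).mono
    (by omega) fun t s' _ h' v => ?_
  rw [h'.2.1 v v.2]
  by_cases h1 : v ∈ S
  · simp [h1, (hS v).1 h1]
  · simp [h1, (hS v).2 h1]

/-- Copy the result from `arr x`. -/
def output (x : ℕ) : Cmd := fill 7 21 (.var 0) (.get x (.var 21))

theorem does_output (hs : s.Fits W) (h : P.Loaded s) {x : ℕ} (hx : x ≠ 7) {S : Set (Fin P.n)}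
    (hS : P.IsIndicator (s.arr x) S) :
    (output x).Does W s (5 * P.m) (P.OutputsSet S) := by
  have hnm := P.n_le_m
  have hm0 := P.m_pos
  have hnW := h.n_lt hs
  refine (does_fill (s := s) (s.arr x) hs hnW
    (fun s' e1 _ => by simpa [Expr.eval, e1] using h.n_eq)
    (fun s' _ e2 v _ _ hr _ => ⟨by simp [Expr.eval, hr, e2 x hx], hs.2 _ _⟩)).mono
    (by omega) fun t s' _ h' v => ?_
  rw [h'.2.1 v v.2]
  split_ifs with hv
  · exact (hS v).1 hv
  · exact (hS v).2 hv

/-- A loop over the `k` sets of the input that collects a union in `arr x`. -/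
theorem does_unionLoop {k K x : ℕ} {c : Cmd} {S : Fin k → Set (Fin P.n)} (hs : s.Fits W)
    (hk : s.reg 1 = k) (hc : 1 ∉ c.wr) (hc' : 26 ∉ c.wr) (h₀ : P.IsIndicator (s.arr x) ∅)
    (hstep : ∀ (i : Fin k) (G : Set (Fin P.n)) (s' : State),
      (∀ y, y ≠ 26 → y ∉ c.wr → s'.reg y = s.reg y) → (∀ a, a ∉ c.wa → s'.arr a = s.arr a) →
      s'.Fits W → s'.reg 26 = i → P.IsIndicator (s'.arr x) G →
      c.Does W s' K (fun s'' => P.IsIndicator (s''.arr x) (G ∪ S i))) :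
    (c.forLoop 26 (.lit 0) (.var 1)).Does W s (k * (K + 2) + 2)
      (fun s' => P.IsIndicator (s'.arr x) {v | ∃ i, v ∈ S i}) := by
  have hfr : ∀ s', (c.forLoop 26 (.lit 0) (.var 1)).Frame s s' →
      (∀ y, y ≠ 26 → y ∉ c.wr → s'.reg y = s.reg y) ∧ ∀ a, a ∉ c.wa → s'.arr a = s.arr a := by
    refine fun s' h => ⟨fun y hy hy' => h.1 y ?_, fun a ha => h.2 a ?_⟩
    · simp [forLoop, loop, wr, hy, hy']
    · simp [forLoop, loop, wa, ha]
  refine (does_forLoop (W := W) (lo := 0) (b := k) (K := K)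
    (fun j s' => P.IsIndicator (s'.arr x) {v | ∃ i : Fin k, (i : ℕ) < j ∧ v ∈ S i})
    rfl (Nat.zero_le _) ?_ hs (fun j s' hf _ => ?_) (hk ▸ hs.1 1) ?_).mono (by simp) ?_
  · simpa [State.setReg] using h₀
  · rw [← hk]
    exact (hfr s' hf).1 1 (by decide) hc
  · rintro j s' - hj hf hW hr hI
    refine (hstep ⟨j, hj⟩ _ s' (hfr s' hf).1 (hfr s' hf).2 hW hr hI).mono le_rfl ?_
    refine fun t s'' hrun h => ⟨(hrun.reg_eq hc').trans hr, ?_⟩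
    have heq : {v | ∃ i : Fin k, (i : ℕ) < j + 1 ∧ v ∈ S i} =
        {v | ∃ i : Fin k, (i : ℕ) < j ∧ v ∈ S i} ∪ S ⟨j, hj⟩ := by
      ext v
      constructor
      · rintro ⟨i, hi, hv⟩
        rcases Nat.lt_succ_iff_lt_or_eq.1 hi with h | h
        · exact .inl ⟨i, h, hv⟩
        · exact .inr ((Fin.ext h : i = ⟨j, hj⟩) ▸ hv)
      · rintro (⟨i, hi, hv⟩ | hv)
        · exact ⟨i, Nat.lt_succ_of_lt hi, hv⟩
        · exact ⟨_, Nat.lt_succ_self j, hv⟩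
    rw [heq]
    exact h
  · rintro t s' - ⟨-, h, -⟩
    have heq : {v | ∃ i, v ∈ S i} = {v | ∃ i : Fin k, (i : ℕ) < k ∧ v ∈ S i} := by
      ext v
      exact exists_congr fun i => (and_iff_right i.2).symm
    rw [heq]
    exact h

/-- Prepare and clear `arr x`; repeat `c` for every `i < k`, with `i` in register `26`; run `d`. -/
def forFamily (A : Cmd) (x : ℕ) (c d : Cmd) : Cmd :=
  .seq (prepare A) (.seq (clear x) (.seq (c.forLoop 26 (.lit 0) (.var 1)) d))

/-- Shared by all algorithms except the one for Büchi objectives. The labels of `P` in array `29`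
are computed once and survive all iterations, because the body does not write there; only the body
is charged `k` times. -/
theorem does_forFamily {k K D x : ℕ} {c d : Cmd} {S : Fin k → Set (Fin P.n)}
    {Q : State → Prop} (hs : s.Fits W) (h : P.Input s) (hk : s.reg 1 = k) (hW : P.n + 1 < W)
    (hA : A.Decomposes P W T) (hx : x ∉ [0, 1, 2, 3, 4, 5, 6, 20, 29])
    (hcr : ∀ x ∈ [0, 1, 20, 26], x ∉ c.wr)
    (hca : ∀ x ∈ [0, 1, 2, 3, 4, 5, 6, 20, 29], x ∉ c.wa)
    (hstep : ∀ (i : Fin k) (G : Set (Fin P.n)) (s' : State), P.Loaded s' →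
      P.IsLabelling (s'.arr 29) → (∀ a ∈ [3, 4, 5, 6], s'.arr a = s.arr a) → s'.Fits W →
      s'.reg 26 = i → P.IsIndicator (s'.arr x) G →
      c.Does W s' K (fun s'' => P.IsIndicator (s''.arr x) (G ∪ S i)))
    (hend : ∀ s' : State, P.Loaded s' → P.IsLabelling (s'.arr 29) → s'.Fits W →
      P.IsIndicator (s'.arr x) {v | ∃ i, v ∈ S i} → d.Does W s' D Q) :
    (forFamily A x c d).Does W s (60 * P.m + T + k * (K + 2) + D) Q := by
  have hm0 := P.m_pos
  obtain ⟨t1, s1, r1, b1, h1, h2⟩ := does_prepare hs h hW hA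
  have F1 := r1.fits hs
  obtain ⟨t2, s2, r2, b2, h3⟩ := does_clear F1 h1 x
  have F2 := r2.fits F1
  have hxa : ∀ a ∈ [0, 1, 2, 3, 4, 5, 6, 20, 29], s2.arr a = s1.arr a := fun a ha =>
    r2.arr_eq (by
      rw [show (clear x).wa = [x] from rfl, List.mem_singleton]
      exact fun h => hx (h ▸ ha))
  have hL2 : P.Loaded s2 := h1.of_eq
    (fun y hy => r2.reg_eq (by
      revert y
      simp [clear, fill, forLoop, loop, wr]))
    (fun a ha => hxa a (by
      revert a
      decide))
  have hl2 : P.IsLabelling (s2.arr 29) := by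
    rw [hxa 29 (by decide)]
    exact h2
  have hk2 : s2.reg 1 = k := by
    rw [r2.reg_eq (by simp [clear, fill, forLoop, loop, wr]), ← hk]
    refine r1.reg_eq fun h => ?_
    rcases wr_prepare h with h | h
    · exact absurd h (by decide)
    · omega
  have hin : ∀ a ∈ [3, 4, 5, 6], s2.arr a = s.arr a := by
    intro a ha
    rw [hxa a (by revert a; decide)]
    refine r1.arr_eq fun h => ?_
    rcases wa_prepare h with h | h
    · exact (show ∀ a ∈ [3, 4, 5, 6], a ∉ [20, 24, 29, 34] by decide) a ha h
    · simp at ha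
      omega
  obtain ⟨t3, s3, r3, b3, h4⟩ := does_unionLoop (S := S) F2 hk2 (hcr 1 (by decide))
    (hcr 26 (by decide)) h3 (fun i G s' e1 e2 hf h26 hI => hstep i G s'
      (hL2.of_eq (fun y hy => e1 y (by rintro rfl; revert hy; decide) (hcr y (by revert y; decide)))
        (fun a ha => e2 a (hca a (by revert a; decide))))
      (by rw [e2 29 (hca 29 (by decide))]; exact hl2)
      (fun a ha => (e2 a (hca a (by revert a; decide))).trans (hin a ha)) hf h26 hI)
  have F3 := r3.fits F2
  have e1 : ∀ y, y ≠ 26 → y ∉ c.wr → s3.reg y = s2.reg y := fun y hy hy' =>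
    r3.reg_eq (by simp [forLoop, loop, wr, hy, hy'])
  have e2 : ∀ a, a ∉ c.wa → s3.arr a = s2.arr a := fun a ha =>
    r3.arr_eq (by simp [forLoop, loop, wa, ha])
  obtain ⟨t4, s4, r4, b4, h5⟩ := hend s3
    (hL2.of_eq (fun y hy => e1 y (by rintro rfl; revert hy; decide) (hcr y (by revert y; decide)))
      (fun a ha => e2 a (hca a (by revert a; decide))))
    (by rw [e2 29 (hca 29 (by decide))]; exact hl2) F3 h4
  exact ⟨_, s4, .seq _ _ _ _ _ _ _ r1 (.seq _ _ _ _ _ _ _ r2 (.seq _ _ _ _ _ _ _ r3 r4)),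
    by omega, h5⟩

end Cmd

/-- If `A` needs words beyond the power `d` of the size, the exponent `d + 2` serves both `A` on all
MDPs that are not larger than `P` and, through the square, the numbers up to `2n + m + 2` of the
surrounding program. -/
theorem Cmd.solves_of_does {A prog : Cmd} {MEC : ℕ → ℕ → ℕ} (hA : ComputesMECs A MEC) {ι : Type}
    {size : ι → ℕ} {input out : ι → State → Prop} {time : ι → ℕ} (P : ι → MDP)
    (hsize : ∀ I, (P I).n + (P I).m ≤ size I)
    (h : ∀ I W s, 2 * (P I).n + (P I).m + 2 < W → A.Decomposes (P I) W (MEC (P I).n (P I).m) →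
      s.Fits W → input I s → prog.Does W s (time I) (out I)) :
    prog.Solves size input out time := by
  obtain ⟨tm, ⟨d, hd⟩, hle⟩ := hA
  refine ⟨d + 2, fun I W s hW hs hin => ?_⟩
  have hpow : ((P I).n + (P I).m + 2) ^ (d + 2) ≤ W :=
    (Nat.pow_le_pow_left (by have := hsize I; omega) _).trans hW
  have h1 : ((P I).n + (P I).m + 2) ^ 2 ≤ W :=
    (Nat.pow_le_pow_right (by omega) (by omega)).trans hpow
  have h2 : ((P I).n + (P I).m + 2) ^ d ≤ W :=
    (Nat.pow_le_pow_right (by omega) (by omega)).trans hpow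
  obtain ⟨t, s', hr, ht, ho⟩ := h I W s (by nlinarith) (fun Q hn hm u hu hQ => by
    obtain ⟨t, u', hr, ho, ht⟩ := hd Q W u
      ((Nat.pow_le_pow_left (by simp only; omega) d).trans h2) hu hQ
    exact ⟨t, u', hr, ht.trans (hle Q _ _ hn hm), ho⟩) hs hin
  exact ⟨t, s', hr, ho, ht⟩

/-! ### The five algorithms -/

namespace Cmd

variable {W T : ℕ} {A : Cmd} {P : MDP} {s : State}

def buchiObjective (A : Cmd) : Cmd :=
  .seq (prepare A) (.seq (clear 30) (.seq (scatter 30 21 (.lit 0) (.get 3 (.var 1)) (.lit 1)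
    (.get 4 (.var 21)) (.lit 1)) (.seq reach (output 36))))

/-- The concatenated lists are scanned once, regardless of which set a member belongs to. This costs
`O(b)` without any term in `k`, and one reachability computation follows. -/
theorem does_buchiObjective {k : ℕ} {F : Fin k → Finset (Fin P.n)} (hs : s.Fits W) (h : P.Input s)
    (hk : s.reg 1 = k) (hF : ListsFamily (s.arr 3) (s.arr 4) F) (hW : 2 * P.n + P.m + 2 < W)
    (hA : A.Decomposes P W T) :
    (buchiObjective A).Does W s (300 * P.m + T + 4 * ∑ i, (F i).card)
      (P.OutputsSet (P.almostSure (⋃ i, P.buchi (F i)))) := by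
  classical
  have hm0 := P.m_pos
  obtain ⟨t1, s1, r1, b1, h1, h2⟩ := does_prepare hs h (by omega) hA
  have F1 := r1.fits hs
  obtain ⟨t2, s2, r2, b2, h3⟩ := does_clear F1 h1 30
  have F2 := r2.fits F1
  have H2 := h1.of_runs r2 (by decide) (by decide)
  have a3 : ∀ a ∈ [3, 4], s2.arr a = s.arr a := by
    intro a ha
    rw [r2.arr_eq ((show ∀ a ∈ [3, 4], a ∉ (clear 30).wa by decide) a ha)]
    refine r1.arr_eq fun h => ?_
    rcases wa_prepare h with h | h
    · exact (show ∀ a ∈ [3, 4], a ∉ [20, 24, 29, 34] by decide) a ha h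
    · simp at ha
      omega
  have k2 : s2.reg 1 = k := by
    rw [r2.reg_eq (by decide), ← hk]
    refine r1.reg_eq fun h => ?_
    rcases wr_prepare h with h | h
    · exact absurd h (by decide)
    · omega
  have hb := hF.off_eq_sum
  obtain ⟨t3, s3, r3, b3, -, h4⟩ := does_scatter (W := W) (a := 30) (r := 21) (elo := .lit 0)
    (hi := .get 3 (.var 1)) (p := .lit 1) (i := .get 4 (.var 21)) (e := .lit 1) (s := s2) (lo := 0)
    (b := s.arr 3 k) (v := 1) (fun _ => True) (s.arr 4) F2 (hs.2 _ _) rfl (Nat.zero_le _) (by omega)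
    (fun s' e1 e2 => by simp [Expr.eval, e1, e2, a3, k2])
    (fun s' e1 e2 j _ _ _ hr => ⟨by simp [Expr.eval],
      fun _ => ⟨by simp [Expr.eval, hr, e2, a3], hs.2 _ _, rfl⟩⟩)
  have F3 := r3.fits F2
  have H3 := H2.of_runs r3 (by decide) (by decide)
  have hI : P.IsIndicator (s3.arr 30) {v | ∃ i, v ∈ F i} := by
    intro v
    rw [h4]
    constructor
    · rintro ⟨i, hi⟩
      obtain ⟨e, he1, he2, he3⟩ := hF.exists_pos hi
      exact if_pos ⟨e, Nat.zero_le _,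
        he2.trans_le (hF.off_mono (Nat.succ_le_of_lt i.2) le_rfl), trivial, he3⟩
    · intro hv
      rw [if_neg, (h3 v).2 (Set.notMem_empty v)]
      rintro ⟨e, -, he, -, he3⟩
      obtain ⟨i, he1, he2⟩ := hF.exists_index he
      obtain ⟨w, hw, hwe⟩ := hF.exists_elt he1 he2
      have : w = v := Fin.ext (hwe.symm.trans he3)
      exact hv ⟨i, this ▸ hw⟩
  have hl : P.IsLabelling (s3.arr 29) := by
    rw [r3.arr_eq (by decide), r2.arr_eq (by decide)]
    exact h2
  obtain ⟨t4, s4, r4, b4, h5⟩ := does_reach F3 H3 hW hl hI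
  have H4 := H3.of_runs r4 (by decide) (by decide)
  obtain ⟨t5, s5, r5, b5, h6⟩ := does_output (r4.fits F3) H4 (by decide) h5
  refine ⟨_, s5, .seq _ _ _ _ _ _ _ r1 (.seq _ _ _ _ _ _ _ r2 (.seq _ _ _ _ _ _ _ r3
    (.seq _ _ _ _ _ _ _ r4 r5))), by omega, ?_⟩
  rw [MDP.almostSure_iUnion_buchi_eq_winOf]
  exact h6

def buchiQuery (A : Cmd) : Cmd :=
  forFamily A 35 (.seq (indicator 30 3 4) (.seq reach (unite 35 36))) (output 35)

theorem iUnion_eq_setOf {α : Type*} {k : ℕ} (S : Fin k → Set α) : ⋃ i, S i = {v | ∃ i, v ∈ S i} := by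
  ext v
  exact Set.mem_iUnion

/-- Only linear work is repeated for each set, and since a set has at most `n ≤ m` members no term
in `b` appears. -/
theorem does_buchiQuery {k : ℕ} {F : Fin k → Finset (Fin P.n)} (hs : s.Fits W) (h : P.Input s)
    (hk : s.reg 1 = k) (hF : ListsFamily (s.arr 3) (s.arr 4) F) (hW : 2 * P.n + P.m + 2 < W)
    (hA : A.Decomposes P W T) :
    (buchiQuery A).Does W s (60 * P.m + T + k * (220 * P.m + 2) + 5 * P.m)
      (P.OutputsSet (⋃ i, P.almostSure (P.buchi (F i)))) := by
  have hm0 := P.m_pos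
  have hnm := P.n_le_m
  refine does_forFamily (S := fun i => P.almostSure (P.buchi (F i))) hs h hk (by omega) hA
    (by decide) (by decide) (by decide) (fun i G s1 H1 hl ha F1 hi hG => ?_)
    (fun s' hl _ hf hI => does_output hf hl (by decide) (iUnion_eq_setOf _ ▸ hI))
  obtain ⟨t2, s2, r2, b2, h2⟩ := does_indicator (x := 30) (o := 3) (l := 4) F1 H1.n_eq (by omega)
    (F := F) (by rw [ha 3 (by decide), ha 4 (by decide)]; exact hF) (by decide) (by decide) hi
  have F2 := r2.fits F1
  have H2 := H1.of_runs r2 (by decide) (by decide)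
  obtain ⟨t3, s3, r3, b3, h3⟩ := does_reach F2 H2 hW (by rw [r2.arr_eq (by decide)]; exact hl) h2
  have F3 := r3.fits F2
  have H3 := H2.of_runs r3 (by decide) (by decide)
  obtain ⟨t4, s4, r4, b4, h4⟩ := does_unite (x := 35) (y := 36) F3 H3 (by omega) (by decide)
    (by rw [r3.arr_eq (by decide), r2.arr_eq (by decide)]; exact hG) h3
  refine ⟨_, s4, .seq _ _ _ _ _ _ _ r2 (.seq _ _ _ _ _ _ _ r3 r4), by omega, ?_⟩
  simp only [MDP.almostSure_buchi_eq_winOf]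
  exact h4

def coBuchiObjective (A : Cmd) : Cmd :=
  forFamily A 30 (.seq (indicator 31 3 4) (.seq attractor (.seq (complement 31 24) (unite 30 31))))
    (.seq reach (output 36))

/-- One attractor per set; the complements are united before a single reachability computation. -/
theorem does_coBuchiObjective {k : ℕ} {F : Fin k → Finset (Fin P.n)} (hs : s.Fits W)
    (h : P.Input s) (hk : s.reg 1 = k) (hF : ListsFamily (s.arr 3) (s.arr 4) F)
    (hW : 2 * P.n + P.m + 2 < W) (hA : A.Decomposes P W T) :
    (coBuchiObjective A).Does W s (60 * P.m + T + k * (140 * P.m + 2) + 205 * P.m)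
      (P.OutputsSet (P.almostSure (⋃ i, P.coBuchi (F i)))) := by
  have hm0 := P.m_pos
  have hnm := P.n_le_m
  refine does_forFamily (S := fun i => (P.attr ↑(F i))ᶜ) hs h hk (by omega) hA
    (by decide) (by decide) (by decide) (fun i G s1 H1 hl ha F1 hi hG => ?_)
    (fun s1 H1 hl F1 hI => ?_)
  · obtain ⟨t2, s2, r2, b2, h2⟩ := does_indicator (x := 31) (o := 3) (l := 4) F1 H1.n_eq (by omega)
      (F := F) (by rw [ha 3 (by decide), ha 4 (by decide)]; exact hF) (by decide) (by decide) hi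
    have F2 := r2.fits F1
    have H2 := H1.of_runs r2 (by decide) (by decide)
    obtain ⟨t3, s3, r3, b3, h3⟩ := does_attractor F2 H2 (by omega) h2
    have F3 := r3.fits F2
    have H3 := H2.of_runs r3 (by decide) (by decide)
    obtain ⟨t4, s4, r4, b4, h4⟩ := does_complement (x := 31) F3 H3 (by omega) (by decide) h3
    have F4 := r4.fits F3
    have H4 := H3.of_runs r4 (by decide) (by decide)
    obtain ⟨t5, s5, r5, b5, h5⟩ := does_unite (x := 30) (y := 31) F4 H4 (by omega) (by decide)
      (by rw [r4.arr_eq (by decide), r3.arr_eq (by decide), r2.arr_eq (by decide)]; exact hG) h4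
    exact ⟨_, s5, .seq _ _ _ _ _ _ _ r2 (.seq _ _ _ _ _ _ _ r3 (.seq _ _ _ _ _ _ _ r4 r5)),
      by omega, h5⟩
  · obtain ⟨t2, s2, r2, b2, h2⟩ := does_reach F1 H1 hW hl hI
    have H2 := H1.of_runs r2 (by decide) (by decide)
    obtain ⟨t3, s3, r3, b3, h3⟩ := does_output (r2.fits F1) H2 (by decide) h2
    refine ⟨_, s3, .seq _ _ _ _ _ _ _ r2 r3, by omega, ?_⟩
    rw [MDP.almostSure_iUnion_coBuchi_eq_winOf]
    exact h3

def coBuchiQuery (A : Cmd) : Cmd :=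
  forFamily A 35 (.seq (indicator 31 3 4) (.seq attractor (.seq (complement 30 24)
    (.seq reach (unite 35 36))))) (output 35)

/-- Here the reachability computation is repeated for each set, and its results are united. -/
theorem does_coBuchiQuery {k : ℕ} {F : Fin k → Finset (Fin P.n)} (hs : s.Fits W) (h : P.Input s)
    (hk : s.reg 1 = k) (hF : ListsFamily (s.arr 3) (s.arr 4) F) (hW : 2 * P.n + P.m + 2 < W)
    (hA : A.Decomposes P W T) :
    (coBuchiQuery A).Does W s (60 * P.m + T + k * (340 * P.m + 2) + 5 * P.m)
      (P.OutputsSet (⋃ i, P.almostSure (P.coBuchi (F i)))) := by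
  have hm0 := P.m_pos
  have hnm := P.n_le_m
  refine does_forFamily (S := fun i => P.almostSure (P.coBuchi (F i))) hs h hk (by omega) hA
    (by decide) (by decide) (by decide) (fun i G s1 H1 hl ha F1 hi hG => ?_)
    (fun s' hl _ hf hI => does_output hf hl (by decide) (iUnion_eq_setOf _ ▸ hI))
  obtain ⟨t2, s2, r2, b2, h2⟩ := does_indicator (x := 31) (o := 3) (l := 4) F1 H1.n_eq (by omega)
    (F := F) (by rw [ha 3 (by decide), ha 4 (by decide)]; exact hF) (by decide) (by decide) hi
  have F2 := r2.fits F1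
  have H2 := H1.of_runs r2 (by decide) (by decide)
  obtain ⟨t3, s3, r3, b3, h3⟩ := does_attractor F2 H2 (by omega) h2
  have F3 := r3.fits F2
  have H3 := H2.of_runs r3 (by decide) (by decide)
  obtain ⟨t4, s4, r4, b4, h4⟩ := does_complement (x := 30) F3 H3 (by omega) (by decide) h3
  have F4 := r4.fits F3
  have H4 := H3.of_runs r4 (by decide) (by decide)
  obtain ⟨t5, s5, r5, b5, h5⟩ := does_reach F4 H4 hW
    (by rw [r4.arr_eq (by decide), r3.arr_eq (by decide), r2.arr_eq (by decide)]; exact hl) h4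
  have F5 := r5.fits F4
  have H5 := H4.of_runs r5 (by decide) (by decide)
  obtain ⟨t6, s6, r6, b6, h6⟩ := does_unite (x := 35) (y := 36) F5 H5 (by omega) (by decide)
    (by
      rw [r5.arr_eq (by decide), r4.arr_eq (by decide), r3.arr_eq (by decide),
        r2.arr_eq (by decide)]
      exact hG) h5
  refine ⟨_, s6, .seq _ _ _ _ _ _ _ r2 (.seq _ _ _ _ _ _ _ r3 (.seq _ _ _ _ _ _ _ r4
    (.seq _ _ _ _ _ _ _ r5 r6))), by omega, ?_⟩
  simp only [MDP.almostSure_coBuchi_eq_winOf]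
  exact h6

def rabinStep (A : Cmd) : Cmd :=
  .seq (indicator 31 5 6) (.seq attractor (.seq (indicator 32 3 4) (.seq (decompose A) mark)))

theorem wr_rabinStep {x : ℕ} (h : x ∈ (rabinStep A).wr) :
    x ∈ [21, 22, 23, 24, 25, 27] ∨ 100 ≤ x := by
  simp only [rabinStep, wr, List.mem_append] at h
  rcases h with h | h | h | h | h
  · exact .inl ((show ∀ x ∈ (indicator 31 5 6).wr, x ∈ [21, 22, 23, 24, 25, 27] by decide) x h)
  · exact .inl ((show ∀ x ∈ attractor.wr, x ∈ [21, 22, 23, 24, 25, 27] by decide) x h)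
  · exact .inl ((show ∀ x ∈ (indicator 32 3 4).wr, x ∈ [21, 22, 23, 24, 25, 27] by decide) x h)
  · exact (wr_decompose h).imp_left
      ((show ∀ x ∈ [21, 27], x ∈ [21, 22, 23, 24, 25, 27] by decide) x)
  · exact .inl ((show ∀ x ∈ mark.wr, x ∈ [21, 22, 23, 24, 25, 27] by decide) x h)

theorem wa_rabinStep {x : ℕ} (h : x ∈ (rabinStep A).wa) :
    x ∈ [21, 22, 23, 24, 25, 26, 27, 30, 31, 32, 33, 34] ∨ 100 ≤ x := by
  simp only [rabinStep, wa, List.mem_append] at h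
  rcases h with h | h | h | h | h
  · exact .inl ((show ∀ x ∈ (indicator 31 5 6).wa,
      x ∈ [21, 22, 23, 24, 25, 26, 27, 30, 31, 32, 33, 34] by decide) x h)
  · exact .inl ((show ∀ x ∈ attractor.wa,
      x ∈ [21, 22, 23, 24, 25, 26, 27, 30, 31, 32, 33, 34] by decide) x h)
  · exact .inl ((show ∀ x ∈ (indicator 32 3 4).wa,
      x ∈ [21, 22, 23, 24, 25, 26, 27, 30, 31, 32, 33, 34] by decide) x h)
  · exact (wa_decompose h).imp_left
      ((show ∀ x ∈ [34], x ∈ [21, 22, 23, 24, 25, 26, 27, 30, 31, 32, 33, 34] by decide) x)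
  · exact .inl ((show ∀ x ∈ mark.wa,
      x ∈ [21, 22, 23, 24, 25, 26, 27, 30, 31, 32, 33, 34] by decide) x h)

def rabin (A : Cmd) : Cmd := forFamily A 30 (rabinStep A) (.seq reach (output 36))

/-- Each pair requires a decomposition of its own restriction, which is the source of the term `k *
T`. -/
theorem does_rabin {k : ℕ} {L U : Fin k → Finset (Fin P.n)} (hs : s.Fits W) (h : P.Input s)
    (hk : s.reg 1 = k) (hL : ListsFamily (s.arr 3) (s.arr 4) L)
    (hU : ListsFamily (s.arr 5) (s.arr 6) U) (hW : 2 * P.n + P.m + 2 < W)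
    (hA : A.Decomposes P W T) :
    (rabin A).Does W s (60 * P.m + T + k * (180 * P.m + T + 2) + 205 * P.m)
      (P.OutputsSet (P.almostSure (P.rabin L U))) := by
  have hm0 := P.m_pos
  have hnm := P.n_le_m
  refine does_forFamily (S := fun i => P.rabinCore (L i) (U i)) hs h hk (by omega) hA
    (by decide) (fun x hx h => ?_) (fun x hx h => ?_)
    (fun i G s1 H1 hl ha F1 hi hG => ?_) (fun s1 H1 hl F1 hI => ?_)
  · rcases wr_rabinStep h with h | h
    · exact (show ∀ x ∈ [0, 1, 20, 26], x ∉ [21, 22, 23, 24, 25, 27] by decide) x hx h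
    · simp at hx
      omega
  · rcases wa_rabinStep h with h | h
    · exact (show ∀ x ∈ [0, 1, 2, 3, 4, 5, 6, 20, 29],
        x ∉ [21, 22, 23, 24, 25, 26, 27, 30, 31, 32, 33, 34] by decide) x hx h
    · simp at hx
      omega
  · obtain ⟨t2, s2, r2, b2, h2⟩ := does_indicator (x := 31) (o := 5) (l := 6) F1 H1.n_eq (by omega)
      (F := U) (by rw [ha 5 (by decide), ha 6 (by decide)]; exact hU) (by decide) (by decide) hi
    have F2 := r2.fits F1
    have H2 := H1.of_runs r2 (by decide) (by decide)
    obtain ⟨t3, s3, r3, b3, h3⟩ := does_attractor F2 H2 (by omega) h2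
    have F3 := r3.fits F2
    have H3 := H2.of_runs r3 (by decide) (by decide)
    obtain ⟨t4, s4, r4, b4, h4⟩ := does_indicator (x := 32) (o := 3) (l := 4) F3 H3.n_eq (by omega)
      (F := L) (by
        rw [r3.arr_eq (by decide), r2.arr_eq (by decide), r3.arr_eq (by decide),
          r2.arr_eq (by decide), ha 3 (by decide), ha 4 (by decide)]
        exact hL) (by decide) (by decide)
      ((r3.reg_eq (by decide)).trans ((r2.reg_eq (by decide)).trans hi))
    have F4 := r4.fits F3
    have H4 := H3.of_runs r4 (by decide) (by decide)
    have h24 : P.IsIndicator (s4.arr 24) (P.attr ↑(U i)) := by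
      rw [r4.arr_eq (by decide)]
      exact h3
    obtain ⟨t5, s5, r5, b5, h5⟩ := does_decompose F4 H4 (by omega) hA (P.attrClosed_attr _) h24
    have F5 := r5.fits F4
    have H5 := loaded_decompose H4 r5
    have e5 : ∀ a ∈ [24, 30, 32], s5.arr a = s4.arr a := by
      refine fun a ha => r5.arr_eq fun h => ?_
      rcases wa_decompose h with h | h <;> simp at ha h <;> omega
    obtain ⟨t6, s6, r6, b6, h6⟩ := does_mark (L := L i) (U := U i) (G := G) F5 H5 (by omega)
      (by rw [e5 32 (by decide)]; exact h4) (by rw [e5 24 (by decide)]; exact h24)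
      (by
        rw [e5 30 (by decide), r4.arr_eq (by decide), r3.arr_eq (by decide), r2.arr_eq (by decide)]
        exact hG) h5
    exact ⟨_, s6, .seq _ _ _ _ _ _ _ r2 (.seq _ _ _ _ _ _ _ r3 (.seq _ _ _ _ _ _ _ r4
      (.seq _ _ _ _ _ _ _ r5 r6))), by omega, h6⟩
  · obtain ⟨t2, s2, r2, b2, h2⟩ := does_reach F1 H1 hW hl hI
    have H2 := H1.of_runs r2 (by decide) (by decide)
    obtain ⟨t3, s3, r3, b3, h3⟩ := does_output (r2.fits F1) H2 (by decide) h2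
    refine ⟨_, s3, .seq _ _ _ _ _ _ _ r2 r3, by omega, ?_⟩
    rw [MDP.almostSure_rabin_eq_winOf]
    exact h3

end Cmd

/-! ### The time bounds -/

theorem mainTheorem9 (A : Cmd) (MEC : ℕ → ℕ → ℕ) (hA : ComputesMECs A MEC)
    (hMEC : ∃ c : ℕ, ∀ P : MDP, P.m ≤ c * MEC P.n P.m) :
    -- Rabin objectives
    (∃ (prog : Cmd) (C : ℕ), prog.ComputesRabin
      (fun I => I.P.almostSure (I.P.rabin I.L I.U))
      (fun I => C * (I.k * MEC I.P.n I.P.m))) ∧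
    -- disjunctive Büchi objectives
    (∃ (prog : Cmd) (C : ℕ), prog.ComputesTarget
      (fun I => I.P.almostSure (⋃ i, I.P.buchi (I.T i)))
      (fun I => C * (MEC I.P.n I.P.m + I.b))) ∧
    -- disjunctive Büchi queries
    (∃ (prog : Cmd) (C : ℕ), prog.ComputesTarget
      (fun I => ⋃ i, I.P.almostSure (I.P.buchi (I.T i)))
      (fun I => C * (I.k * I.P.m + MEC I.P.n I.P.m))) ∧
    -- disjunctive coBüchi objectives
    (∃ (prog : Cmd) (C : ℕ), prog.ComputesTarget
      (fun I => I.P.almostSure (⋃ i, I.P.coBuchi (I.T i)))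
      (fun I => C * (I.k * I.P.m + MEC I.P.n I.P.m))) ∧
    -- disjunctive coBüchi queries
    (∃ (prog : Cmd) (C : ℕ), prog.ComputesTarget
      (fun I => ⋃ i, I.P.almostSure (I.P.coBuchi (I.T i)))
      (fun I => C * (I.k * I.P.m + MEC I.P.n I.P.m))) := by
  obtain ⟨c, hc⟩ := hMEC
  refine ⟨⟨A.rabin, 450 * c + 10, ?_⟩, ⟨A.buchiObjective, 300 * c + 5, ?_⟩,
    ⟨A.buchiQuery, 65 * c + 250, ?_⟩, ⟨A.coBuchiObjective, 265 * c + 250, ?_⟩,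
    ⟨A.coBuchiQuery, 65 * c + 350, ?_⟩⟩
  · refine Cmd.solves_of_does hA (fun I : RabinInstance => I.P)
      (fun I => by unfold RabinInstance.size; omega) ?_
    rintro I W s hW hdec hs ⟨h1, h2, h3, h4⟩
    refine (Cmd.does_rabin hs h1 h2 h3 h4 hW hdec).mono ?_ fun _ _ _ h => h
    have hm := hc I.P
    have hm0 := I.P.m_pos
    have hk := I.k_pos
    generalize MEC I.P.n I.P.m = T at hm ⊢
    generalize I.P.m = m at hm hm0 ⊢
    generalize I.k = k at hk ⊢
    -- From `0 < m ≤ c * T`. Together with `0 < k` this absorbs the additive constants and the terms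
    -- without a factor `k`.
    have hT : 1 ≤ T := Nat.pos_of_ne_zero (by rintro rfl; omega)
    calc 60 * m + T + k * (180 * m + T + 2) + 205 * m
        ≤ k * (265 * m + T) + k * (180 * m + T + 2) := by nlinarith
      _ = k * (445 * m + 2 * T + 2) := by ring
      _ ≤ k * ((450 * c + 10) * T) := Nat.mul_le_mul_left _ (by nlinarith)
      _ = (450 * c + 10) * (k * T) := by ring
  · refine Cmd.solves_of_does hA (fun I : TargetInstance => I.P)
      (fun I => by unfold TargetInstance.size; omega) ?_
    rintro I W s hW hdec hs ⟨h1, h2, h3⟩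
    refine (Cmd.does_buchiObjective hs h1 h2 h3 hW hdec).mono ?_ fun _ _ _ h => h
    have hm := hc I.P
    change _ ≤ (300 * c + 5) * (_ + ∑ i, (I.T i).card)
    generalize ∑ i, (I.T i).card = b
    generalize MEC I.P.n I.P.m = T at hm ⊢
    generalize I.P.m = m at hm ⊢
    calc 300 * m + T + 4 * b ≤ 300 * (c * T) + T + 4 * b := by omega
      _ ≤ 300 * (c * T) + T + 4 * b + (4 * T + (300 * c + 1) * b) := Nat.le_add_right _ _
      _ = (300 * c + 5) * (T + b) := by ring
  · refine Cmd.solves_of_does hA (fun I : TargetInstance => I.P)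
      (fun I => by unfold TargetInstance.size; omega) ?_
    rintro I W s hW hdec hs ⟨h1, h2, h3⟩
    refine (Cmd.does_buchiQuery hs h1 h2 h3 hW hdec).mono ?_ fun _ _ _ h => h
    have hm := hc I.P
    -- `k ≤ k * m` pays for the constant overhead of the iterations.
    have hkm := Nat.mul_le_mul_left I.k I.P.m_pos
    nlinarith
  · refine Cmd.solves_of_does hA (fun I : TargetInstance => I.P)
      (fun I => by unfold TargetInstance.size; omega) ?_
    rintro I W s hW hdec hs ⟨h1, h2, h3⟩
    refine (Cmd.does_coBuchiObjective hs h1 h2 h3 hW hdec).mono ?_ fun _ _ _ h => h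
    have hm := hc I.P
    have hkm := Nat.mul_le_mul_left I.k I.P.m_pos
    nlinarith
  · refine Cmd.solves_of_does hA (fun I : TargetInstance => I.P)
      (fun I => by unfold TargetInstance.size; omega) ?_
    rintro I W s hW hdec hs ⟨h1, h2, h3⟩
    refine (Cmd.does_coBuchiQuery hs h1 h2 h3 hW hdec).mono ?_ fun _ _ _ h => h
    have hm := hc I.P
    have hkm := Nat.mul_le_mul_left I.k I.P.m_pos
    nlinarith
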